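/- Let $F \in \mathbb{Q}[x,y]$ be a polynomial of total degree $4$ that is irreducible over $\mathbb{Q}$ and satisfies $F(\mathbb{Z}^2) \subseteq \mathbb{Z}_{\geq 0}$, where $F(\mathbb{Z}^2) = \{F(x,y) : (x,y) \in \mathbb{Z}^2\}$. Then there exists a constant $C > 0$, depending only on $F$, such that for every integer $N \geq 2$ $$ \#\bigl(F(\mathbb{Z}^2) \cap [1,N]\bigr) \leq C\, \frac{N}{\sqrt{\log N}}. $$ -/

import Mathlib

/-- The set `F(ℤ²)` of values of `F ∈ ℚ[x,y]` at integer points. The variables `x`, `y` are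
indexed by `0`, `1 : Fin 2`. -/
def valueSet (F : MvPolynomial (Fin 2) ℚ) : Set ℚ :=
  {q | ∃ x y : ℤ, q = MvPolynomial.eval ![(x : ℚ), (y : ℚ)] F}

/-- `𝓡_F(𝔅) = F(ℤ²) ∩ 𝔅` for a set `𝔅` of real numbers. -/
def representedIn (F : MvPolynomial (Fin 2) ℚ) (B : Set ℝ) : Set ℝ :=
  ((fun q : ℚ => (q : ℝ)) '' valueSet F) ∩ B

/-! Let `Q` be the top form of `F`. Restriction to rational lines, scaling and density turn
nonnegativity of `F` on `ℤ²` into nonnegativity of `Q` on `ℝ²`, and the real zeros of `Q` decide the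
count. In every case but one, only `O(N^(3/4))` values lie below `N`.

If `Q` is positive definite, then `F ≤ N` forces `|x|, |y| ≪ N^(1/4)`.

If `Q` has an irrational zero `θ`, nonnegativity makes it a double root, so `Q = κ q²` with `q` a
rational quadratic. Testing `F ≥ 0` at integer points close to the asymptotes of conics with leading
part `q` shows that the cubic terms are divisible by `q`. Hence `F = κ z² + R` with `z = q + linear`
and `deg R ≤ 2`. Either `F` is a quadratic polynomial in `z` alone, or `R` is positive in both
asymptotic directions and `F ≤ N` gives `|z|, |y| ≪ √N`.

If `Q` has a rational zero, a unimodular substitution moves it to `(0, 1)`. Then `F` has degree at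
most two in `y` and `Q` is `x²` times a nonnegative quadratic form. Usually the values up to `N`
come from `O(N^(1/4))` parallel lines, each carrying `O(√N)` of them. The exception is `Q = c x⁴`:
completing the square in `y` may leave a quadratic polynomial in `x`, and `F` is then, up to
denominators, a shifted form `u² + D v²`.

That form needs the upper bound in Landau's theorem. Apart from a square factor, `u² + D v²` has no
prime factor `p` with `χ(p) = -1`, where `χ(n) = J(-D | n)`. The simple pole of `ζ(s) L(s, χ)`
bounds the square of the sum of `n^(-s)` over products of split primes, so the reciprocal sum up to
`y` is `O(√log y)` (`AllSplit.exists_sum_inv_le`). Chebyshev's bound for `ψ` converts this into a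
count (`NoInertFactor.exists_card_le`). -/

/-! ### Integers composed of split and ramified primes -/

/-- `n ≠ 0` all of whose prime factors `p` satisfy `p ∣ M` or `χ p = 1`. -/
def NoInertFactor {M : ℕ} (χ : DirichletCharacter ℂ M) (n : ℕ) : Prop :=
  n ≠ 0 ∧ ∀ p : ℕ, p.Prime → p ∣ n → p ∣ M ∨ χ p = 1

/-- `n ≠ 0` all of whose prime factors `p` satisfy `χ p = 1`. -/
def AllSplit {M : ℕ} (χ : DirichletCharacter ℂ M) (n : ℕ) : Prop :=
  n ≠ 0 ∧ ∀ p : ℕ, p.Prime → p ∣ n → χ p = 1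

lemma NoInertFactor.of_dvd {M : ℕ} {χ : DirichletCharacter ℂ M} {n d : ℕ}
    (h : NoInertFactor χ n) (hd : d ∣ n) : NoInertFactor χ d :=
  ⟨ne_zero_of_dvd_ne_zero h.1 hd, fun p hp hpd => h.2 p hp (hpd.trans hd)⟩

lemma AllSplit.of_dvd {M : ℕ} {χ : DirichletCharacter ℂ M} {n d : ℕ}
    (h : AllSplit χ n) (hd : d ∣ n) : AllSplit χ d :=
  ⟨ne_zero_of_dvd_ne_zero h.1 hd, fun p hp hpd => h.2 p hp (hpd.trans hd)⟩

lemma AllSplit.mul {M : ℕ} {χ : DirichletCharacter ℂ M} {m n : ℕ}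
    (hm : AllSplit χ m) (hn : AllSplit χ n) : AllSplit χ (m * n) :=
  ⟨mul_ne_zero hm.1 hn.1, fun p hp hpd =>
    (hp.dvd_mul.1 hpd).elim (hm.2 p hp) (hn.2 p hp)⟩

lemma AllSplit.apply_eq_one {M : ℕ} {χ : DirichletCharacter ℂ M} {n : ℕ} :
    AllSplit χ n → χ n = 1 := by
  induction n using induction_on_primes with
  | zero => exact fun h => absurd rfl h.1
  | one => intro _; simp
  | prime_mul p a hp ih =>
    intro h
    rw [Nat.cast_mul, map_mul, h.2 p hp (dvd_mul_right _ _), ih (h.of_dvd (dvd_mul_left _ _)),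
      one_mul]

/-- The coefficient is the divisor sum of `χ`, and every divisor of an all-split number is
all-split, hence contributes 1. -/
lemma AllSplit.zetaMul_eq {M : ℕ} {χ : DirichletCharacter ℂ M} {n : ℕ} (h : AllSplit χ n) :
    χ.zetaMul n = (n.divisors.card : ℂ) := by
  rw [DirichletCharacter.zetaMul, ArithmeticFunction.coe_zeta_mul_apply,
    Finset.card_eq_sum_ones, Nat.cast_sum]
  refine Finset.sum_congr rfl fun d hd => ?_
  have hd' := h.of_dvd (Nat.dvd_of_mem_divisors hd)
  simp [toArithmeticFunction, hd'.1, hd'.apply_eq_one]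

/-- Isolates the ramified part, whose reciprocal sum is a finite Euler product and costs only a
constant. -/
lemma NoInertFactor.exists_mul {M : ℕ} [NeZero M] {χ : DirichletCharacter ℂ M} {n : ℕ} :
    NoInertFactor χ n →
      ∃ a b : ℕ, a ∈ Nat.factoredNumbers M.primeFactors ∧ AllSplit χ b ∧ a * b = n := by
  induction n using induction_on_primes with
  | zero => exact fun h => absurd rfl h.1
  | one =>
    exact fun _ => ⟨1, 1, Nat.mem_factoredNumbers'.2 fun p hp h => absurd h hp.not_dvd_one,
      ⟨one_ne_zero, fun p hp h => absurd h hp.not_dvd_one⟩, rfl⟩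
  | prime_mul p k hp ih =>
    intro h
    obtain ⟨a, b, ha, hb, rfl⟩ := ih (h.of_dvd (dvd_mul_left _ _))
    rcases h.2 p hp (dvd_mul_right _ _) with hpM | hpM
    · refine ⟨p * a, b, Nat.mul_mem_factoredNumbers ?_ ha, hb, mul_assoc _ _ _⟩
      rw [Nat.mem_factoredNumbers']
      intro q hq hqp
      rw [(Nat.prime_dvd_prime_iff_eq hq hp).1 hqp]
      exact Nat.mem_primeFactors.2 ⟨hp, hpM, NeZero.ne M⟩
    · refine ⟨a, p * b, ha, AllSplit.mul ⟨hp.ne_zero, fun q hq hqp => ?_⟩ hb, by ring⟩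
      rwa [(Nat.prime_dvd_prime_iff_eq hq hp).1 hqp]

/-- The full sum of reciprocals is the finite Euler product of `(1 - 1/p)⁻¹` over the primes in `s`.
-/
lemma exists_sum_factoredNumbers_inv_le (s : Finset ℕ) :
    ∃ C : ℝ, 0 < C ∧ ∀ T : Finset ℕ, (∀ n ∈ T, n ∈ Nat.factoredNumbers s) →
      ∑ n ∈ T, (n : ℝ)⁻¹ ≤ C := by
  let f : ℕ →* ℝ := ⟨⟨fun n => (n : ℝ)⁻¹, by simp⟩, fun a b => by simp [mul_comm]⟩
  have hf : ∀ {p : ℕ}, p.Prime → ‖f p‖ < 1 := by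
    intro p hp
    have : (1 : ℝ) < p := by exact_mod_cast hp.one_lt
    change ‖(p : ℝ)⁻¹‖ < 1
    rw [norm_inv, Real.norm_natCast]
    exact inv_lt_one_of_one_lt₀ this
  have hs := (EulerProduct.summable_and_hasSum_factoredNumbers_prod_filter_prime_geometric hf s).1
  refine ⟨(∑' m : Nat.factoredNumbers s, ‖f m‖) + 1, by positivity, fun T hT => ?_⟩
  have h1 := hs.sum_le_tsum (T.subtype (· ∈ Nat.factoredNumbers s)) (fun _ _ => norm_nonneg _)
  have h2 : ∑ n ∈ T.subtype (· ∈ Nat.factoredNumbers s), ‖f n‖ = ∑ n ∈ T, (n : ℝ)⁻¹ := by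
    rw [Finset.sum_subtype_of_mem (fun n : ℕ => ‖f n‖) hT]
    refine Finset.sum_congr rfl fun n _ => ?_
    change ‖(n : ℝ)⁻¹‖ = _
    rw [norm_inv, Real.norm_natCast]
  linarith

/-! ### Reciprocal sums from the pole of `ζ(s) L(s, χ)` -/

lemma exists_norm_sub_one_mul_riemannZeta_le :
    ∃ C : ℝ, 0 < C ∧ ∀ s : ℝ, 1 < s → s ≤ 2 → ‖((s : ℂ) - 1) * riemannZeta s‖ ≤ C := by
  have hc : Continuous fun s : ℝ => DirichletCharacter.LFunctionTrivChar₁ 1 (s : ℂ) :=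
    (DirichletCharacter.differentiable_LFunctionTrivChar₁ 1).continuous.comp
      Complex.continuous_ofReal
  obtain ⟨C, hC⟩ := (isCompact_Icc (a := (1 : ℝ)) (b := 2)).exists_bound_of_continuousOn
    hc.continuousOn
  refine ⟨max C 1, by positivity, fun s h1 h2 => ?_⟩
  have h := hC s ⟨h1.le, h2⟩
  have hne : (s : ℂ) ≠ 1 := by exact_mod_cast h1.ne'
  rw [DirichletCharacter.LFunctionTrivChar₁, Function.update_of_ne hne,
    DirichletCharacter.LFunctionTrivChar, DirichletCharacter.LFunction_modOne_eq] at h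
  exact h.trans (le_max_left _ _)

lemma LSeries_zetaMul_eq {M : ℕ} [NeZero M] (χ : DirichletCharacter ℂ M) {s : ℂ} (hs : 1 < s.re) :
    LSeries χ.zetaMul s = riemannZeta s * χ.LFunction s := by
  rw [DirichletCharacter.zetaMul, ← ArithmeticFunction.coe_mul, LSeries_convolution',
    χ.LFunction_eq_LSeries hs]
  · congr 1
    · simp_rw [← ArithmeticFunction.LSeries_zeta_eq_riemannZeta hs,
        ← ArithmeticFunction.natCoe_apply]
    · exact (LSeries_congr χ.apply_eq_toArithmeticFunction_apply s).symm
  · exact ArithmeticFunction.LSeriesSummable_zeta_iff.mpr hs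
  · exact (LSeriesSummable_congr _ fun h ↦ (χ.apply_eq_toArithmeticFunction_apply h).symm).mpr <|
      ZMod.LSeriesSummable_of_one_lt_re χ hs

/-- For quadratic `χ` the coefficients of `ζ(s) L(s, χ)` are nonnegative, so a finite subsum is at
most the whole series. The factor `L(s, χ)` is bounded on `[1, 2]` and `ζ` has a simple pole. -/
lemma exists_sum_zetaMul_le {M : ℕ} [NeZero M] {χ : DirichletCharacter ℂ M} (hχ : χ ≠ 1)
    (hχ2 : χ ^ 2 = 1) :
    ∃ C : ℝ, 0 < C ∧ ∀ s : ℝ, 1 < s → s ≤ 2 → ∀ T : Finset ℕ, 0 ∉ T →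
      ∑ n ∈ T, (χ.zetaMul n).re * (n : ℝ) ^ (-s) ≤ C / (s - 1) := by
  obtain ⟨C₁, hC₁, h₁⟩ := exists_norm_sub_one_mul_riemannZeta_le
  have hc : Continuous fun s : ℝ => χ.LFunction (s : ℂ) :=
    (DirichletCharacter.differentiable_LFunction hχ).continuous.comp Complex.continuous_ofReal
  obtain ⟨C₂, h₂⟩ := (isCompact_Icc (a := (1 : ℝ)) (b := 2)).exists_bound_of_continuousOn
    hc.continuousOn
  refine ⟨C₁ * max C₂ 1, by positivity, fun s hs1 hs2 T hT => ?_⟩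
  have hre : 1 < (s : ℂ).re := by simpa using hs1
  have hsum : LSeriesSummable χ.zetaMul s := χ.LSeriesSummable_zetaMul hre
  have hL := LSeries_zetaMul_eq χ hre
  have hterm : ∀ n : ℕ, LSeries.term χ.zetaMul s n
      = (((χ.zetaMul n).re * (n : ℝ) ^ (-s) : ℝ) : ℂ) ∨ n = 0 := by
    intro n
    rcases eq_or_ne n 0 with h | h
    · exact Or.inr h
    left
    have h0 := DirichletCharacter.zetaMul_nonneg hχ2 n
    have h3 : χ.zetaMul n = ((χ.zetaMul n).re : ℂ) := Complex.eq_re_of_ofReal_le (r := 0) (by simpa using h0)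
    rw [LSeries.term_of_ne_zero h, Complex.ofReal_mul, ← h3, Complex.ofReal_cpow (Nat.cast_nonneg n),
      Complex.ofReal_neg, Complex.cpow_neg, div_eq_mul_inv, Complex.ofReal_natCast]
  have hre_nonneg : ∀ n, 0 ≤ (χ.zetaMul n).re := fun n =>
    (Complex.nonneg_iff.1 (DirichletCharacter.zetaMul_nonneg hχ2 n)).1
  have hn : ∀ n, 0 ≤ (LSeries.term χ.zetaMul s n).re := by
    intro n
    rcases hterm n with h | h
    · rw [h, Complex.ofReal_re]; exact mul_nonneg (hre_nonneg n) (by positivity)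
    · simp [h]
  have hsre : Summable fun n => (LSeries.term χ.zetaMul s n).re := (Complex.hasSum_re hsum.hasSum).summable
  calc ∑ n ∈ T, (χ.zetaMul n).re * (n : ℝ) ^ (-s)
      = ∑ n ∈ T, (LSeries.term χ.zetaMul s n).re := by
        refine Finset.sum_congr rfl fun n hnT => ?_
        rcases hterm n with h | h
        · rw [h, Complex.ofReal_re]
        · exact absurd (h ▸ hnT) hT
    _ ≤ ∑' n, (LSeries.term χ.zetaMul s n).re := hsre.sum_le_tsum T fun n _ => hn n
    _ = (LSeries χ.zetaMul s).re := (Complex.hasSum_re hsum.hasSum).tsum_eq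
    _ ≤ ‖LSeries χ.zetaMul s‖ := Complex.re_le_norm _
    _ = ‖riemannZeta s‖ * ‖χ.LFunction s‖ := by rw [hL, norm_mul]
    _ ≤ C₁ / (s - 1) * max C₂ 1 := by
        have hs0 : 0 < s - 1 := by linarith
        refine mul_le_mul ?_ ((h₂ s ⟨hs1.le, hs2⟩).trans (le_max_left _ _)) (norm_nonneg _) (by positivity)
        rw [le_div_iff₀ hs0]
        have := h₁ s hs1 hs2
        rw [norm_mul, ← Complex.ofReal_one, ← Complex.ofReal_sub, Complex.norm_real, Real.norm_of_nonneg hs0.le] at this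
        linarith
    _ = C₁ * max C₂ 1 / (s - 1) := by ring

/-- Expanding the square, a product `n` arises from at most `d(n)` pairs, and `d(n)` is exactly the
coefficient of `ζ L` at an all-split `n`. This is where the square root of the logarithm originates.
-/
lemma AllSplit.sq_sum_rpow_le {M : ℕ} {χ : DirichletCharacter ℂ M}
    (T : Finset ℕ) (hT : ∀ n ∈ T, AllSplit χ n) (s : ℝ) :
    (∑ n ∈ T, (n : ℝ) ^ (-s)) ^ 2 ≤
      ∑ n ∈ (T ×ˢ T).image (fun x => x.1 * x.2), (χ.zetaMul n).re * (n : ℝ) ^ (-s) := by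
  rw [sq, Finset.sum_mul_sum, ← Finset.sum_product',
    ← Finset.sum_fiberwise_of_maps_to (s := T ×ˢ T) (g := fun x => x.1 * x.2)
      (fun x hx => Finset.mem_image_of_mem _ hx)]
  refine Finset.sum_le_sum fun n hn => ?_
  obtain ⟨⟨a, b⟩, hab, rfl⟩ := Finset.mem_image.1 hn
  rw [Finset.mem_product] at hab
  have hs := (hT _ hab.1).mul (hT _ hab.2)
  have h1 : ∀ x ∈ (T ×ˢ T).filter (fun x => x.1 * x.2 = a * b),
      (x.1 : ℝ) ^ (-s) * (x.2 : ℝ) ^ (-s) = ((a * b : ℕ) : ℝ) ^ (-s) := by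
    intro x hx
    rw [← (Finset.mem_filter.1 hx).2, Nat.cast_mul,
      Real.mul_rpow (Nat.cast_nonneg _) (Nat.cast_nonneg _)]
  rw [Finset.sum_congr rfl h1, Finset.sum_const, nsmul_eq_mul, hs.zetaMul_eq, Complex.natCast_re]
  refine mul_le_mul_of_nonneg_right (Nat.cast_le.2 ?_) (by positivity)
  refine Finset.card_le_card_of_injOn Prod.fst (fun x hx => ?_) (fun x hx y hy hxy => ?_)
  · have := (Finset.mem_filter.1 hx).2
    exact Nat.mem_divisors.2 ⟨⟨x.2, this.symm⟩, hs.1⟩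
  · have hx2 := (Finset.mem_filter.1 hx).2
    have hy2 := (Finset.mem_filter.1 hy).2
    have hx0 : 0 < x.1 := by
      rcases Nat.eq_zero_or_pos x.1 with h | h
      · rw [h, zero_mul] at hx2; exact absurd hx2.symm hs.1
      · exact h
    refine Prod.ext hxy (Nat.eq_of_mul_eq_mul_left hx0 ?_)
    rw [hx2, hxy, hy2]

/-- Rankin's trick with `s = 1 + 1/L`, `L = 1 + log y`: for `n ≤ y` one has `n⁻¹ ≤ e · n^(-s)`, and
the bound `C/(s - 1) = C L` for the square gives `√(C L)`. -/
lemma AllSplit.exists_sum_inv_le {M : ℕ} [NeZero M] {χ : DirichletCharacter ℂ M} (hχ : χ ≠ 1)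
    (hχ2 : χ ^ 2 = 1) :
    ∃ C : ℝ, 0 < C ∧ ∀ y : ℝ, 1 ≤ y → ∀ T : Finset ℕ, (∀ n ∈ T, AllSplit χ n ∧ (n : ℝ) ≤ y) →
      ∑ n ∈ T, (n : ℝ)⁻¹ ≤ C * √(1 + Real.log y) := by
  obtain ⟨C, hC, h⟩ := exists_sum_zetaMul_le hχ hχ2
  refine ⟨Real.exp 1 * √C, by positivity, fun y hy T hT => ?_⟩
  have hlog : 0 ≤ Real.log y := Real.log_nonneg hy
  set L := 1 + Real.log y with hL
  have hL1 : 1 ≤ L := by linarith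
  have hsq := (AllSplit.sq_sum_rpow_le T (fun n hn => (hT n hn).1) (1 + 1 / L)).trans
    (h (1 + 1 / L) (by linarith [show 0 < 1 / L by positivity])
      (by linarith [(div_le_one (by linarith : 0 < L)).2 hL1]) _ ?_)
  · have h2 : ∑ n ∈ T, (n : ℝ) ^ (-(1 + 1 / L)) ≤ √C * √L := by
      rw [← Real.sqrt_mul hC.le]
      refine Real.le_sqrt_of_sq_le (hsq.trans_eq ?_)
      field_simp
      ring
    have h3 : ∑ n ∈ T, (n : ℝ)⁻¹ ≤ ∑ n ∈ T, Real.exp 1 * (n : ℝ) ^ (-(1 + 1 / L)) := by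
      refine Finset.sum_le_sum fun n hn => ?_
      obtain ⟨⟨hn0, -⟩, hny⟩ := hT n hn
      have hnpos : (0 : ℝ) < n := by exact_mod_cast Nat.pos_of_ne_zero hn0
      have hn1 : (1 : ℝ) ≤ n := by exact_mod_cast Nat.one_le_iff_ne_zero.2 hn0
      rw [neg_add, Real.rpow_add hnpos, Real.rpow_neg_one, mul_left_comm]
      refine le_mul_of_one_le_right (by positivity) ?_
      rw [Real.rpow_def_of_pos hnpos, ← Real.exp_add]
      refine Real.one_le_exp ?_
      have : Real.log n / L ≤ 1 := by
        rw [div_le_one (by linarith)]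
        linarith [Real.log_le_log hnpos hny]
      have h5 : Real.log n * -(1 / L) = -(Real.log n / L) := by ring
      linarith
    calc _ ≤ _ := h3
      _ = Real.exp 1 * ∑ n ∈ T, (n : ℝ) ^ (-(1 + 1 / L)) := by rw [Finset.mul_sum]
      _ ≤ Real.exp 1 * (√C * √L) := by gcongr
      _ = _ := by ring
  · intro h0
    obtain ⟨⟨a, b⟩, hab, h0⟩ := Finset.mem_image.1 h0
    rw [Finset.mem_product] at hab
    exact ((hT _ hab.1).1.mul (hT _ hab.2).1).1 h0

lemma NoInertFactor.exists_sum_inv_le {M : ℕ} [NeZero M] {χ : DirichletCharacter ℂ M}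
    (hχ : χ ≠ 1) (hχ2 : χ ^ 2 = 1) :
    ∃ C : ℝ, 0 < C ∧ ∀ y : ℝ, 1 ≤ y → ∀ T : Finset ℕ,
      (∀ n ∈ T, NoInertFactor χ n ∧ (n : ℝ) ≤ y) →
      ∑ n ∈ T, (n : ℝ)⁻¹ ≤ C * √(1 + Real.log y) := by
  obtain ⟨C₁, hC₁, h₁⟩ := exists_sum_factoredNumbers_inv_le M.primeFactors
  obtain ⟨C₂, hC₂, h₂⟩ := AllSplit.exists_sum_inv_le hχ hχ2
  refine ⟨C₁ * C₂, by positivity, fun y hy T hT => ?_⟩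
  have hex : ∀ n : ℕ, ∃ a b : ℕ, n ∈ T → a ∈ Nat.factoredNumbers M.primeFactors ∧
      AllSplit χ b ∧ a * b = n := by
    intro n
    by_cases hn : n ∈ T
    · obtain ⟨a, b, h⟩ := (hT n hn).1.exists_mul
      exact ⟨a, b, fun _ => h⟩
    · exact ⟨0, 0, fun h => absurd h hn⟩
  choose a b hab using hex
  calc ∑ n ∈ T, (n : ℝ)⁻¹ = ∑ n ∈ T, ((a n : ℝ)⁻¹ * (b n : ℝ)⁻¹) := by
        refine Finset.sum_congr rfl fun n hn => ?_
        rw [← mul_inv, ← Nat.cast_mul, (hab n hn).2.2]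
    _ = ∑ x ∈ T.image (fun n => (a n, b n)), ((x.1 : ℝ)⁻¹ * (x.2 : ℝ)⁻¹) := by
        rw [Finset.sum_image]
        intro m hm n hn hmn
        have hmn' := Prod.mk.inj hmn
        rw [← (hab m hm).2.2, ← (hab n hn).2.2, hmn'.1, hmn'.2]
    _ ≤ ∑ x ∈ (T.image a) ×ˢ (T.image b), ((x.1 : ℝ)⁻¹ * (x.2 : ℝ)⁻¹) := by
        refine Finset.sum_le_sum_of_subset_of_nonneg (fun x hx => ?_)
          (fun _ _ _ => by positivity)
        obtain ⟨n, hn, rfl⟩ := Finset.mem_image.1 hx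
        exact Finset.mem_product.2
          ⟨Finset.mem_image_of_mem a hn, Finset.mem_image_of_mem b hn⟩
    _ = (∑ m ∈ T.image a, (m : ℝ)⁻¹) * ∑ m ∈ T.image b, (m : ℝ)⁻¹ := by
        rw [Finset.sum_mul_sum, Finset.sum_product]
    _ ≤ C₁ * (C₂ * √(1 + Real.log y)) := by
        refine mul_le_mul (h₁ _ fun m hm => ?_) (h₂ y hy _ fun m hm => ?_)
          (Finset.sum_nonneg fun _ _ => by positivity) hC₁.le
        · obtain ⟨n, hn, rfl⟩ := Finset.mem_image.1 hm
          exact (hab n hn).1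
        · obtain ⟨n, hn, rfl⟩ := Finset.mem_image.1 hm
          refine ⟨(hab n hn).2.1, le_trans (Nat.cast_le.2 ?_) (hT n hn).2⟩
          exact Nat.le_of_dvd (Nat.pos_of_ne_zero (hT n hn).1.1)
            ⟨a n, by rw [mul_comm, (hab n hn).2.2]⟩
    _ = _ := by ring

/-! ### From reciprocal sums to cardinalities -/

-- Write `log n` as the sum of `Λ(n/m)` over `m ∣ n` and exchange sums. Closure under divisors keeps
-- `m` in `T`, and for fixed `m` the quotients `n/m` are distinct integers in `[1, y/m]`.
open ArithmeticFunction in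
lemma sum_log_le_sum_psi (T : Finset ℕ) (hdiv : ∀ n ∈ T, n ≠ 0 ∧ ∀ d, d ∣ n → d ∈ T) {y : ℝ}
    (hy : ∀ n ∈ T, (n : ℝ) ≤ y) :
    ∑ n ∈ T, Real.log n ≤ ∑ m ∈ T, Chebyshev.psi (y / m) := by
  have h1 : ∀ n ∈ T, Real.log n = ∑ m ∈ T, if m ∣ n then vonMangoldt (n / m) else 0 := by
    intro n hn
    rw [← vonMangoldt_sum, ← Nat.sum_div_divisors n vonMangoldt, ← Finset.sum_filter]
    refine Finset.sum_congr ?_ fun _ _ => rfl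
    ext m
    rw [Nat.mem_divisors, Finset.mem_filter]
    exact ⟨fun h => ⟨(hdiv n hn).2 m h.1, h.1⟩, fun h => ⟨h.2, (hdiv n hn).1⟩⟩
  rw [Finset.sum_congr rfl h1, Finset.sum_comm]
  refine Finset.sum_le_sum fun m hm => ?_
  have hm0 : 0 < m := Nat.pos_of_ne_zero (hdiv m hm).1
  have hm0' : (0 : ℝ) < m := by exact_mod_cast hm0
  rw [← Finset.sum_filter, Chebyshev.psi]
  rw [← Finset.sum_image (s := T.filter (m ∣ ·)) (g := fun n => n / m) (f := fun k => vonMangoldt k)]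
  · refine Finset.sum_le_sum_of_subset_of_nonneg (fun k hk => ?_)
      (fun _ _ _ => vonMangoldt_nonneg)
    obtain ⟨n, hn, rfl⟩ := Finset.mem_image.1 hk
    obtain ⟨hnT, hmn⟩ := Finset.mem_filter.1 hn
    have hn0 : 0 < n := Nat.pos_of_ne_zero (hdiv n hnT).1
    rw [Finset.mem_Ioc]
    refine ⟨Nat.div_pos (Nat.le_of_dvd hn0 hmn) hm0, Nat.le_floor ?_⟩
    rw [Nat.cast_div hmn hm0'.ne']
    gcongr
    exact hy n hnT
  · intro n hn k hk hnk
    exact (Nat.div_left_inj (Finset.mem_filter.1 hn).2 (Finset.mem_filter.1 hk).2).1 hnk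

/-- Weighting each element by `log n` gains a logarithm: `∑ log n ≤ ∑ ψ(y/m) ≪ y ∑ 1/m ≪ y √log y`,
and dividing by `log y` leaves `y / √log y`. -/
lemma NoInertFactor.exists_card_le {M : ℕ} [NeZero M] {χ : DirichletCharacter ℂ M}
    (hχ : χ ≠ 1) (hχ2 : χ ^ 2 = 1) :
    ∃ C : ℝ, 0 < C ∧ ∀ y : ℝ, 1 ≤ y → ∀ T : Finset ℕ,
      (∀ n ∈ T, NoInertFactor χ n ∧ (n : ℝ) ≤ y) →
      (T.card : ℝ) ≤ C * (y / √(1 + Real.log y)) := by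
  classical
  obtain ⟨C, hC, h⟩ := NoInertFactor.exists_sum_inv_le hχ hχ2
  refine ⟨(Real.log 4 + 4 + 2) * C, by positivity, fun y hy T₀ hT₀ => ?_⟩
  have hlog : 0 ≤ Real.log y := Real.log_nonneg hy
  -- The given set is enlarged to all admissible integers up to `y`, which is closed under divisors.
  set T := (Finset.range (⌊y⌋₊ + 1)).filter (NoInertFactor χ) with hTdef
  have hT : ∀ n ∈ T, NoInertFactor χ n ∧ (n : ℝ) ≤ y := by
    intro n hn
    rw [hTdef, Finset.mem_filter, Finset.mem_range, Nat.lt_succ_iff] at hn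
    exact ⟨hn.2, (Nat.le_floor_iff (by linarith)).1 hn.1⟩
  have hsub : T₀ ⊆ T := by
    intro n hn
    rw [hTdef, Finset.mem_filter, Finset.mem_range, Nat.lt_succ_iff]
    exact ⟨Nat.le_floor (hT₀ n hn).2, (hT₀ n hn).1⟩
  have hcard : (T₀.card : ℝ) ≤ T.card := by exact_mod_cast Finset.card_le_card hsub
  refine hcard.trans ?_
  have hlogsum := sum_log_le_sum_psi T (fun n hn => ⟨(hT n hn).1.1, fun d hd => by
    have h1 := (hT n hn).1.of_dvd hd
    rw [hTdef, Finset.mem_filter, Finset.mem_range, Nat.lt_succ_iff]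
    exact ⟨Nat.le_floor (le_trans (Nat.cast_le.2 (Nat.le_of_dvd (Nat.pos_of_ne_zero (hT n hn).1.1) hd))
      (hT n hn).2), h1⟩⟩) (fun n hn => (hT n hn).2)
  have hS := h y hy T hT
  set L := 1 + Real.log y with hL
  -- Since `log (y/n) ≤ y/n - 1`, replacing `log n` by `1 + log y` costs at most a multiple of
  -- `y/n`, which the reciprocal sum controls.
  have hpoint : ∀ n ∈ T, L ≤ Real.log n + 2 * (y * (n : ℝ)⁻¹) := by
    intro n hn
    obtain ⟨⟨hn0, -⟩, hny⟩ := hT n hn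
    have hnpos : (0 : ℝ) < n := by exact_mod_cast Nat.pos_of_ne_zero hn0
    have h1 : 1 ≤ y / n := (one_le_div hnpos).2 hny
    have h2 := Real.log_le_sub_one_of_pos (show 0 < y / n by positivity)
    rw [Real.log_div (by linarith) hnpos.ne'] at h2
    rw [← div_eq_mul_inv]
    linarith
  have hmain : T.card * L ≤ (Real.log 4 + 4 + 2) * C * y * √L := by
    calc (T.card : ℝ) * L = ∑ n ∈ T, L := by rw [Finset.sum_const, nsmul_eq_mul]
      _ ≤ ∑ n ∈ T, (Real.log n + 2 * (y * (n : ℝ)⁻¹)) := Finset.sum_le_sum hpoint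
      _ = ∑ n ∈ T, Real.log n + 2 * y * ∑ n ∈ T, (n : ℝ)⁻¹ := by
          rw [Finset.sum_add_distrib, Finset.mul_sum]
          congr 1
          exact Finset.sum_congr rfl fun _ _ => by ring
      _ ≤ ∑ n ∈ T, (Real.log 4 + 4) * (y / n) + 2 * y * ∑ n ∈ T, (n : ℝ)⁻¹ := by
          refine add_le_add_left ?_ _
          refine hlogsum.trans (Finset.sum_le_sum fun n _ => ?_)
          exact Chebyshev.psi_le_const_mul_self (by positivity)
      _ = (Real.log 4 + 4 + 2) * y * ∑ n ∈ T, (n : ℝ)⁻¹ := by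
          simp only [div_eq_mul_inv, ← Finset.mul_sum]
          ring
      _ ≤ (Real.log 4 + 4 + 2) * y * (C * √L) := by gcongr
      _ = _ := by ring
  have hLpos : 0 < L := by linarith
  have hsL : 0 < √L := Real.sqrt_pos.2 hLpos
  rw [← mul_div_assoc, le_div_iff₀ hsL]
  refine le_of_mul_le_mul_right ?_ hsL
  calc (T.card : ℝ) * √L * √L = T.card * L := by rw [mul_assoc, Real.mul_self_sqrt hLpos.le]
    _ ≤ _ := hmain

/-! ### The character `n ↦ J(-D | n)` and the form `u² + D v²` -/

open NumberTheorySymbols in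
lemma jacobiSym_neg_mod {D b : ℕ} (hb : Odd b) : J(-D | b % (4 * D)) = J(-D | b) := by
  rw [jacobiSym.mod_right (-D) hb, Int.natAbs_neg, Int.natAbs_natCast]

lemma ZMod.odd_of_isUnit_natCast {D b : ℕ} (hb : IsUnit (b : ZMod (4 * D))) : Odd b := by
  have h := (ZMod.isUnit_iff_coprime _ _).1 hb
  exact Nat.Coprime.odd_of_right (h.coprime_dvd_right ⟨2 * D, by ring⟩ : Nat.Coprime b 2)

open NumberTheorySymbols Classical in
/-- The Dirichlet character `n ↦ J(-D | n)` modulo `4 * D`. -/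
noncomputable def negJacobiChar (D : ℕ) [NeZero D] : DirichletCharacter ℂ (4 * D) where
  toFun a := if IsUnit a then ((J(-D | a.val) : ℤ) : ℂ) else 0
  map_one' := by
    have h : 1 < 4 * D := by have := NeZero.pos D; omega
    rw [if_pos isUnit_one, ZMod.val_one_eq_one_mod, Nat.mod_eq_of_lt h, jacobiSym.one_right,
      Int.cast_one]
  map_mul' a b := by
    by_cases ha : IsUnit a
    · by_cases hb : IsUnit b
      · have ha' : Odd a.val := ZMod.odd_of_isUnit_natCast (D := D) (by simpa using ha)
        have hb' : Odd b.val := ZMod.odd_of_isUnit_natCast (D := D) (by simpa using hb)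
        rw [if_pos ha, if_pos hb, if_pos (ha.mul hb), ZMod.val_mul,
          jacobiSym_neg_mod (ha'.mul hb'), jacobiSym.mul_right' _ ha'.pos.ne' hb'.pos.ne',
          Int.cast_mul]
      · rw [if_neg hb, if_neg (fun h => hb (isUnit_of_mul_isUnit_right h)), mul_zero]
    · rw [if_neg ha, if_neg (fun h => ha (isUnit_of_mul_isUnit_left h)), zero_mul]
  map_nonunit' a ha := if_neg ha

open NumberTheorySymbols in
lemma negJacobiChar_natCast {D : ℕ} [NeZero D] {b : ℕ} (hb : b.Coprime (4 * D)) :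
    negJacobiChar D b = ((J(-D | b) : ℤ) : ℂ) := by
  have hu := (ZMod.isUnit_iff_coprime b (4 * D)).2 hb
  change (if IsUnit (b : ZMod (4 * D)) then _ else _) = _
  rw [if_pos hu, ZMod.val_natCast, jacobiSym_neg_mod (ZMod.odd_of_isUnit_natCast hu)]

lemma negJacobiChar_sq (D : ℕ) [NeZero D] : negJacobiChar D ^ 2 = 1 := by
  refine MulChar.isQuadratic_iff_sq_eq_one.1 fun a => ?_
  change (if IsUnit a then _ else _) = _ ∨ (if IsUnit a then _ else _) = _ ∨
    (if IsUnit a then _ else _) = _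
  split_ifs with h
  · rcases jacobiSym.trichotomy (-D) a.val with h | h | h <;> simp [h]
  · simp

-- Modulo `4D - 1` one has `4D ≡ 1` with 4 a square, so `D` has symbol 1, while `-1` has symbol `-1`
-- because `4D - 1 ≡ 3 (mod 4)`. This one value shows that the character is nontrivial for every `D
-- > 0`.
open NumberTheorySymbols in
lemma jacobiSym_neg_four_mul_sub_one {D : ℕ} (hD : 0 < D) : J(-D | 4 * D - 1) = -1 := by
  have hodd : Odd (4 * D - 1) := ⟨2 * D - 1, by omega⟩
  have h4 : J(4 | 4 * D - 1) = 1 := jacobiSym.at_four hodd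
  have h1 : J(4 * D | 4 * D - 1) = 1 := by
    rw [jacobiSym.mod_left' (a₂ := 1) (b := 4 * D - 1), jacobiSym.one_left]
    refine Int.ModEq.symm (Int.modEq_iff_dvd.2 ⟨1, ?_⟩)
    push_cast [show 1 ≤ 4 * D by omega]
    ring
  rw [jacobiSym.mul_left, h4, one_mul] at h1
  rw [jacobiSym.neg _ hodd, h1, mul_one, ZMod.χ₄_nat_three_mod_four (by omega)]

lemma negJacobiChar_ne_one (D : ℕ) [NeZero D] : negJacobiChar D ≠ 1 := by
  intro h
  have hD : 0 < D := NeZero.pos D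
  have hcop : (4 * D - 1).Coprime (4 * D) := by
    have := Nat.coprime_self_add_right (m := 4 * D - 1) (n := 1)
    rw [show 4 * D - 1 + 1 = 4 * D by omega] at this
    exact this.2 (Nat.coprime_one_right _)
  have h1 := negJacobiChar_natCast (D := D) hcop
  rw [jacobiSym_neg_four_mul_sub_one hD, h,
    MulChar.one_apply ((ZMod.isUnit_iff_coprime _ _).2 hcop)] at h1
  norm_num at h1

/-- Divide `u, v` by their gcd `k`. A prime `p ∤ 4D` dividing `u'² + D v'²` with `u', v'` coprime
cannot divide `v'`, so `-D` is a square modulo `p`. -/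
lemma exists_eq_sq_mul_noInertFactor {D : ℕ} [NeZero D] {n : ℕ} (hn : 0 < n) {u v : ℤ}
    (h : (n : ℤ) = u ^ 2 + D * v ^ 2) :
    ∃ k m : ℕ, 0 < k ∧ NoInertFactor (negJacobiChar D) m ∧ n = k ^ 2 * m := by
  have hg : 0 < u.gcd v := by
    refine Nat.pos_of_ne_zero fun h0 => ?_
    rw [Int.gcd_eq_zero_iff] at h0
    rw [h0.1, h0.2] at h
    norm_num at h
    omega
  obtain ⟨u', hu⟩ := Int.gcd_dvd_left (a := u) (b := v)
  obtain ⟨v', hv⟩ := Int.gcd_dvd_right (a := u) (b := v)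
  have hcop : IsCoprime u' v' := by
    have h1 := Int.gcd_div_gcd_div_gcd hg
    have hg' : ((u.gcd v : ℕ) : ℤ) ≠ 0 := by exact_mod_cast hg.ne'
    rw [Int.ediv_eq_of_eq_mul_right hg' hu, Int.ediv_eq_of_eq_mul_right hg' hv] at h1
    exact Int.isCoprime_iff_gcd_eq_one.2 h1
  set k := u.gcd v
  have hnonneg : 0 ≤ u' ^ 2 + D * v' ^ 2 := by positivity
  obtain ⟨m, hm⟩ := Int.eq_ofNat_of_zero_le hnonneg
  have hnm : n = k ^ 2 * m := by
    zify
    rw [← hm, h, hu, hv]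
    ring
  refine ⟨k, m, hg, ⟨fun h0 => ?_, fun p hp hpm => ?_⟩, hnm⟩
  · rw [hnm, h0, mul_zero] at hn
    exact absurd hn (lt_irrefl _)
  by_cases hpM : p ∣ 4 * D
  · exact Or.inl hpM
  right
  have hfact := Fact.mk hp
  have hpc : p.Coprime (4 * D) := (Nat.Prime.coprime_iff_not_dvd hp).2 hpM
  have hpD : ¬ p ∣ D := fun h => hpM (h.mul_left 4)
  have hpm' : (p : ℤ) ∣ u' ^ 2 + D * v' ^ 2 := by rw [hm]; exact_mod_cast hpm
  have hpv : ¬ (p : ℤ) ∣ v' := by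
    intro hpv
    have h2 : (p : ℤ) ∣ u' ^ 2 := by
      have h3 : (p : ℤ) ∣ D * v' ^ 2 := (dvd_pow hpv two_ne_zero).mul_left _
      exact (dvd_add_left h3).1 hpm'
    have h4 := Int.Prime.dvd_pow' hp h2
    have h5 := hcop.isUnit_of_dvd' h4 hpv
    exact (Nat.prime_iff_prime_int.1 hp).not_isUnit h5
  rw [negJacobiChar_natCast hpc, ← jacobiSym.legendreSym.to_jacobiSym,
    legendreSym.eq_one_of_sq_sub_mul_sq_eq_zero (x := (u' : ZMod p)) (y := (v' : ZMod p)),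
    Int.cast_one]
  · push_cast
    rw [neg_ne_zero]
    exact fun h => hpD ((ZMod.natCast_eq_zero_iff D p).1 h)
  · exact fun h => hpv ((ZMod.intCast_zmod_eq_zero_iff_dvd v' p).1 h)
  · have := (ZMod.intCast_zmod_eq_zero_iff_dvd _ p).2 hpm'
    push_cast at this ⊢
    linear_combination this

/-- The number of `n ≤ y` of the form `u² + D v²` is `O(y / √log y)`. -/
theorem exists_card_sq_add_mul_sq_le {D : ℕ} (hD : 0 < D) :
    ∃ C : ℝ, 0 < C ∧ ∀ y : ℝ, 1 ≤ y → ∀ T : Finset ℕ,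
      (∀ n ∈ T, 0 < n ∧ (n : ℝ) ≤ y ∧ ∃ u v : ℤ, (n : ℤ) = u ^ 2 + D * v ^ 2) →
      (T.card : ℝ) ≤ C * (y / √(1 + Real.log y)) := by
  classical
  have : NeZero D := ⟨hD.ne'⟩
  obtain ⟨C, hC, h⟩ := NoInertFactor.exists_card_le (negJacobiChar_ne_one D) (negJacobiChar_sq D)
  -- For each square factor `k²` the count up to `y/k²` is `O(k^(-3/2))` times the target bound, so
  -- summing over `k` costs a constant.
  have hsum : Summable fun k : ℕ => √2 * ((k : ℝ) ^ (3 / 2 : ℝ))⁻¹ :=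
    (Real.summable_nat_rpow_inv.2 (by norm_num)).mul_left _
  refine ⟨C * (∑' k : ℕ, √2 * ((k : ℝ) ^ (3 / 2 : ℝ))⁻¹ + 1), by positivity, fun y hy T hT => ?_⟩
  set R := y / √(1 + Real.log y) with hR
  have hlog : 0 ≤ Real.log y := Real.log_nonneg hy
  have hR0 : 0 ≤ R := by positivity
  have hex : ∀ n : ℕ, ∃ k m : ℕ, n ∈ T →
      0 < k ∧ NoInertFactor (negJacobiChar D) m ∧ n = k ^ 2 * m := by
    intro n
    by_cases hn : n ∈ T
    · obtain ⟨h1, -, u, v, h2⟩ := hT n hn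
      obtain ⟨k, m, h3⟩ := exists_eq_sq_mul_noInertFactor h1 h2
      exact ⟨k, m, fun _ => h3⟩
    · exact ⟨0, 0, fun h => absurd h hn⟩
  choose k m hkm using hex
  have hfib : ∀ j ∈ T.image k,
      (((T.filter fun n => k n = j).card : ℕ) : ℝ) ≤ C * (√2 * ((j : ℝ) ^ (3 / 2 : ℝ))⁻¹) * R := by
    intro j hj
    obtain ⟨n₀, hn₀, rfl⟩ := Finset.mem_image.1 hj
    set j := k n₀
    have hj0 : 0 < j := (hkm n₀ hn₀).1
    have hj1 : (1 : ℝ) ≤ j := by exact_mod_cast hj0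
    have hj2 : (0 : ℝ) < (j : ℝ) ^ 2 := by positivity
    have hdiv : ∀ n ∈ T, k n = j → (m n : ℝ) ≤ y / (j : ℝ) ^ 2 := by
      intro n hn hk
      rw [le_div_iff₀ hj2]
      have h1 := (hkm n hn).2.2
      rw [hk] at h1
      calc (m n : ℝ) * (j : ℝ) ^ 2 = ((j ^ 2 * m n : ℕ) : ℝ) := by push_cast; ring
        _ = n := by rw [← h1]
        _ ≤ y := (hT n hn).2.1
    have hm1 : 1 ≤ y / (j : ℝ) ^ 2 := by
      refine le_trans ?_ (hdiv n₀ hn₀ rfl)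
      exact_mod_cast Nat.one_le_iff_ne_zero.2 (hkm n₀ hn₀).2.1.1
    have hcard : (T.filter fun n => k n = j).card ≤ ((T.filter fun n => k n = j).image m).card := by
      rw [Finset.card_image_of_injOn]
      intro a ha b hb hab
      rw [Finset.mem_coe, Finset.mem_filter] at ha hb
      rw [(hkm a ha.1).2.2, (hkm b hb.1).2.2, ha.2, hb.2]
      exact congrArg _ hab
    have hG := h (y / (j : ℝ) ^ 2) hm1 ((T.filter fun n => k n = j).image m) (by
      intro a ha
      obtain ⟨n, hn, rfl⟩ := Finset.mem_image.1 ha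
      rw [Finset.mem_filter] at hn
      exact ⟨(hkm n hn.1).2.1, hdiv n hn.1 hn.2⟩)
    refine (Nat.cast_le.2 hcard).trans (hG.trans ?_)
    rw [mul_assoc]
    refine mul_le_mul_of_nonneg_left ?_ hC.le
    have hlogj : 0 ≤ Real.log j := Real.log_nonneg hj1
    have hl1 : 0 ≤ Real.log (y / (j : ℝ) ^ 2) := Real.log_nonneg hm1
    -- Uses `log j ≤ j - 1`. Shrinking the logarithm from `y` to `y/j²` costs at most `√(2j)`, which
    -- turns `j⁻²` into the summable `j^(-3/2)`.
    have hkey : 1 + Real.log y ≤ (1 + Real.log (y / (j : ℝ) ^ 2)) * (2 * j) := by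
      have h1 : Real.log (y / (j : ℝ) ^ 2) = Real.log y - 2 * Real.log j := by
        rw [Real.log_div (by linarith) hj2.ne', Real.log_pow]; norm_num
      have h2 := Real.log_le_sub_one_of_pos (show (0 : ℝ) < j by linarith)
      have h3 : Real.log y = Real.log (y / (j : ℝ) ^ 2) + 2 * Real.log j := by rw [h1]; ring
      rw [h3]
      nlinarith
    have hsq : √(1 + Real.log y) ≤ √(1 + Real.log (y / (j : ℝ) ^ 2)) * (√2 * √j) := by
      rw [← Real.sqrt_mul (by norm_num), ← Real.sqrt_mul (by linarith)]
      exact Real.sqrt_le_sqrt hkey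
    have hs1 : 0 < √(1 + Real.log y) := Real.sqrt_pos.2 (by linarith)
    have hs2 : 0 < √(1 + Real.log (y / (j : ℝ) ^ 2)) := Real.sqrt_pos.2 (by linarith)
    have hj32 : (j : ℝ) ^ 2 = (j : ℝ) ^ (3 / 2 : ℝ) * √j := by
      rw [Real.sqrt_eq_rpow, ← Real.rpow_add (by linarith), ← Real.rpow_natCast]
      norm_num
    have hjp : 0 < (j : ℝ) ^ (3 / 2 : ℝ) := by positivity
    have hsj : 0 < √(j : ℝ) := Real.sqrt_pos.2 (by linarith)
    rw [hR, div_le_iff₀ hs2]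
    calc y / (j : ℝ) ^ 2 = y / (j : ℝ) ^ 2 * √(1 + Real.log y) / √(1 + Real.log y) := by
          field_simp
      _ ≤ y / (j : ℝ) ^ 2 * (√(1 + Real.log (y / (j : ℝ) ^ 2)) * (√2 * √j))
          / √(1 + Real.log y) := by gcongr
      _ = _ := by
          rw [show y / (j : ℝ) ^ 2 * (√(1 + Real.log (y / (j : ℝ) ^ 2)) * (√2 * √j)) =
            y / ((j : ℝ) ^ (3 / 2 : ℝ) * √j) * (√(1 + Real.log (y / (j : ℝ) ^ 2)) * (√2 * √j)) by
              rw [← hj32]]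
          field_simp
  calc (T.card : ℝ) = ∑ j ∈ T.image k, ((T.filter fun n => k n = j).card : ℝ) := by
        rw [Finset.card_eq_sum_card_image k T, Nat.cast_sum]
    _ ≤ ∑ j ∈ T.image k, C * (√2 * ((j : ℝ) ^ (3 / 2 : ℝ))⁻¹) * R := Finset.sum_le_sum hfib
    _ = C * (∑ j ∈ T.image k, √2 * ((j : ℝ) ^ (3 / 2 : ℝ))⁻¹) * R := by
        rw [Finset.mul_sum, Finset.sum_mul]
    _ ≤ C * (∑' k : ℕ, √2 * ((k : ℝ) ^ (3 / 2 : ℝ))⁻¹ + 1) * R := by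
        have := hsum.sum_le_tsum (T.image k) (fun _ _ => by positivity)
        gcongr
        linarith

/-! ### Sparse sets and elementary counting -/

/-- A set of natural numbers with `O(y / √log y)` positive elements up to `y`. -/
def SparseSet (S : Set ℕ) : Prop :=
  ∃ C : ℝ, 0 < C ∧ ∀ y : ℝ, 1 ≤ y → ∀ T : Finset ℕ, (∀ n ∈ T, 0 < n ∧ (n : ℝ) ≤ y ∧ n ∈ S) →
    (T.card : ℝ) ≤ C * (y / √(1 + Real.log y))

/-- A bound `O(y^(3/4))` is more than enough, since `√(1 + log y) ≪ y^(1/4)`. All cases except the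
binary quadratic one end here. -/
lemma sparseSet_of_card_le {S : Set ℕ} {C : ℝ}
    (h : ∀ y : ℝ, 1 ≤ y → ∀ T : Finset ℕ, (∀ n ∈ T, 0 < n ∧ (n : ℝ) ≤ y ∧ n ∈ S) →
      (T.card : ℝ) ≤ C * (√y * √√y)) : SparseSet S := by
  refine ⟨(|C| + 1) * √2, by positivity, fun y hy T hT => ?_⟩
  have hlog : 0 ≤ Real.log y := Real.log_nonneg hy
  have hs : 0 < √y := Real.sqrt_pos.2 (by linarith)
  have hss : 0 < √√y := Real.sqrt_pos.2 hs
  have hl : 0 < √(1 + Real.log y) := Real.sqrt_pos.2 (by linarith)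
  have h1 : √(1 + Real.log y) ≤ √2 * √√y := by
    rw [← Real.sqrt_mul (by norm_num)]
    refine Real.sqrt_le_sqrt ?_
    have h2 := Real.log_le_sub_one_of_pos hs
    rw [Real.log_sqrt (by linarith)] at h2
    linarith
  rw [← mul_div_assoc, le_div_iff₀ hl]
  calc (T.card : ℝ) * √(1 + Real.log y) ≤ (|C| + 1) * (√y * √√y) * (√2 * √√y) := by
        refine mul_le_mul ((h y hy T hT).trans ?_) h1 hl.le (by positivity)
        gcongr
        linarith [le_abs_self C]
    _ = (|C| + 1) * √2 * (√y * (√√y * √√y)) := by ring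
    _ = (|C| + 1) * √2 * y := by
        rw [Real.mul_self_sqrt hs.le, Real.mul_self_sqrt (by linarith)]

lemma Finset.card_int_le_of_abs_sub_le {I : Finset ℤ} {a R : ℝ} (hR : 0 ≤ R)
    (h : ∀ z ∈ I, |(z : ℝ) - a| ≤ R) : (I.card : ℝ) ≤ 2 * R + 1 := by
  have hsub : I ⊆ Finset.Icc ⌈a - R⌉ ⌊a + R⌋ := by
    intro z hz
    have := abs_le.1 (h z hz)
    exact Finset.mem_Icc.2 ⟨Int.ceil_le.2 (by linarith), Int.le_floor.2 (by linarith)⟩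
  have h1 : (I.card : ℝ) ≤ (Finset.Icc ⌈a - R⌉ ⌊a + R⌋).card := by
    exact_mod_cast Finset.card_le_card hsub
  refine h1.trans ?_
  rw [Int.card_Icc]
  rcases le_total 0 (⌊a + R⌋ + 1 - ⌈a - R⌉) with h2 | h2
  · have h3 : (((⌊a + R⌋ + 1 - ⌈a - R⌉).toNat : ℤ) : ℝ) = (⌊a + R⌋ + 1 - ⌈a - R⌉ : ℤ) := by
      rw [Int.toNat_of_nonneg h2]
    rw [Int.cast_natCast] at h3
    rw [h3]
    push_cast
    linarith [Int.floor_le (a + R), Int.le_ceil (a - R)]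
  · rw [Int.toNat_of_nonpos h2]
    simp only [Nat.cast_zero]
    linarith

/-- Completing the square puts `|t - v|` between `a` and `b` with `b - a ≤ √(2B/p)`, that is, `t` in
two short intervals. The bound is uniform in `r` and `s`, as needed for families of quadratics. -/
lemma Finset.card_int_le_of_abs_quadratic_le {I : Finset ℤ} {p r s B : ℝ} (hp : 0 < p)
    (hB : 0 ≤ B) (h : ∀ t ∈ I, |p * (t : ℝ) ^ 2 + r * t + s| ≤ B) :
    (I.card : ℝ) ≤ 2 * √(2 * B / p) + 2 := by
  classical
  set v := -r / (2 * p) with hv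
  set w := (r ^ 2 / (4 * p) - s) / p with hw
  set a := √(w - B / p) with ha
  set b := √(w + B / p) with hb
  have hBp : 0 ≤ B / p := by positivity
  have hab : b - a ≤ √(2 * B / p) := by
    have hle : w + B / p ≤ (w - B / p) + 2 * B / p := by ring_nf; rfl
    have h2 : 0 ≤ 2 * B / p := by positivity
    have h1 : b ≤ a + √(2 * B / p) := by
      refine Real.sqrt_le_iff.2 ⟨by positivity, hle.trans ?_⟩
      have h3 : w - B / p ≤ a ^ 2 := by
        rcases le_total 0 (w - B / p) with h4 | h4
        · rw [ha, Real.sq_sqrt h4]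
        · exact h4.trans (sq_nonneg a)
      rw [add_sq, Real.sq_sqrt h2]
      have h5 : 0 ≤ 2 * a * √(2 * B / p) := by positivity
      linarith
    linarith
  have hmem : ∀ t ∈ I, a ≤ |(t : ℝ) - v| ∧ |(t : ℝ) - v| ≤ b := by
    intro t ht
    have h1 : p * (t : ℝ) ^ 2 + r * t + s = p * (((t : ℝ) - v) ^ 2 - w) := by
      rw [hv, hw]; field_simp; ring
    have h2 := h t ht
    rw [h1, abs_mul, abs_of_pos hp, mul_comm, ← le_div_iff₀ hp] at h2
    have h3 := abs_le.1 h2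
    rw [← Real.sqrt_sq_eq_abs]
    exact ⟨Real.sqrt_le_sqrt (by linarith), Real.sqrt_le_sqrt (by linarith)⟩
  have hcov : I = I.filter (fun t : ℤ => v ≤ t) ∪ I.filter (fun t : ℤ => ¬ v ≤ (t : ℝ)) :=
    (Finset.filter_union_filter_not_eq _ _).symm
  have hR : 0 ≤ √(2 * B / p) / 2 := by positivity
  have h1 : ((I.filter (fun t : ℤ => v ≤ t)).card : ℝ) ≤ 2 * (√(2 * B / p) / 2) + 1 := by
    refine Finset.card_int_le_of_abs_sub_le (a := v + (a + b) / 2) hR fun t ht => ?_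
    rw [Finset.mem_filter] at ht
    have h4 := hmem t ht.1
    rw [abs_of_nonneg (by linarith [ht.2])] at h4
    rw [abs_le]
    constructor <;> linarith
  have h2 : ((I.filter (fun t : ℤ => ¬ v ≤ (t : ℝ))).card : ℝ) ≤ 2 * (√(2 * B / p) / 2) + 1 := by
    refine Finset.card_int_le_of_abs_sub_le (a := v - (a + b) / 2) hR fun t ht => ?_
    rw [Finset.mem_filter] at ht
    have h4 := hmem t ht.1
    rw [abs_of_neg (by linarith [not_le.1 ht.2])] at h4
    rw [abs_le]
    constructor <;> linarith
  have h3 : (I.card : ℝ) ≤ (I.filter (fun t : ℤ => v ≤ t)).card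
      + (I.filter (fun t : ℤ => ¬ v ≤ (t : ℝ))).card := by
    rw [← Nat.cast_add, ← Finset.card_filter_add_card_filter_not (s := I) (fun t : ℤ => v ≤ (t : ℝ))]
  linarith

/-- If every element of `T` has a preimage satisfying `P`, then `T` is at most as large as the
finite sets of elements satisfying `P`. -/
lemma Finset.card_le_of_forall_exists {α : Type*} {T : Finset ℕ} {P : α → Prop} {g : α → ℕ} {b : ℝ}
    (hP : ∀ I : Finset α, (∀ a ∈ I, P a) → (I.card : ℝ) ≤ b) (h : ∀ n ∈ T, ∃ a, P a ∧ g a = n) :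
    (T.card : ℝ) ≤ b := by
  classical
  have h' : ∀ n : T, ∃ a, P a ∧ g a = n := fun n => h n n.2
  choose a ha using h'
  have hinj : Function.Injective a := by
    intro m n hmn
    have h1 := (ha m).2
    rw [hmn] at h1
    exact Subtype.ext (h1.symm.trans (ha n).2)
  have hc := hP (T.attach.image a) (by
    intro x hx
    obtain ⟨n, -, rfl⟩ := Finset.mem_image.1 hx
    exact (ha n).1)
  rwa [Finset.card_image_of_injective _ hinj, Finset.card_attach] at hc

lemma Finset.card_le_of_fiber {T : Finset ℕ} {Q : ℤ → ℕ → Prop} {A R b : ℝ} (hR : 0 ≤ R)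
    (hb : 0 ≤ b) (h : ∀ n ∈ T, ∃ k : ℤ, |(k : ℝ) - A| ≤ R ∧ Q k n)
    (hQ : ∀ k : ℤ, ∀ T' ⊆ T, (∀ n ∈ T', Q k n) → (T'.card : ℝ) ≤ b) :
    (T.card : ℝ) ≤ (2 * R + 1) * b := by
  classical
  have hex : ∀ n : ℕ, ∃ k : ℤ, n ∈ T → |(k : ℝ) - A| ≤ R ∧ Q k n := by
    intro n
    by_cases hn : n ∈ T
    · obtain ⟨k, hk⟩ := h n hn
      exact ⟨k, fun _ => hk⟩
    · exact ⟨0, fun h => absurd h hn⟩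
  choose k hk using hex
  have h1 : ((T.image k).card : ℝ) ≤ 2 * R + 1 := by
    refine Finset.card_int_le_of_abs_sub_le (a := A) hR fun z hz => ?_
    obtain ⟨n, hn, rfl⟩ := Finset.mem_image.1 hz
    exact (hk n hn).1
  calc (T.card : ℝ) = ∑ j ∈ T.image k, ((T.filter fun n => k n = j).card : ℝ) := by
        rw [Finset.card_eq_sum_card_image k T, Nat.cast_sum]
    _ ≤ ∑ j ∈ T.image k, b := by
        refine Finset.sum_le_sum fun j _ => hQ j _ (Finset.filter_subset _ _) fun n hn => ?_
        rw [Finset.mem_filter] at hn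
        exact hn.2 ▸ (hk n hn.1).2
    _ = (T.image k).card * b := by rw [Finset.sum_const, nsmul_eq_mul]
    _ ≤ _ := mul_le_mul_of_nonneg_right h1 hb

/-! ### Polynomials that are nonnegative on the integers -/

lemma nonneg_of_forall_nat_linear {A K : ℝ} (h : ∀ n : ℕ, 0 < n → 0 ≤ A * n + K) : 0 ≤ A := by
  by_contra! hA
  obtain ⟨n, hn⟩ := exists_nat_gt (K / (-A))
  rw [div_lt_iff₀ (by linarith)] at hn
  have h1 := h (n + 1) n.succ_pos
  push_cast at h1
  nlinarith

/-- A real polynomial of degree at most four which is nonnegative at the positive integers has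
nonnegative leading coefficient. -/
lemma quartic_coeff_nonneg {a₀ a₁ a₂ a₃ a₄ : ℝ}
    (h : ∀ n : ℕ, 0 < n → 0 ≤ a₀ + a₁ * n + a₂ * (n : ℝ) ^ 2 + a₃ * (n : ℝ) ^ 3 + a₄ * (n : ℝ) ^ 4) :
    0 ≤ a₄ ∧ (a₄ = 0 → 0 ≤ a₃) ∧ (a₄ = 0 → a₃ = 0 → 0 ≤ a₂) ∧
      (a₄ = 0 → a₃ = 0 → a₂ = 0 → 0 ≤ a₁) := by
  refine ⟨nonneg_of_forall_nat_linear (K := |a₀| + |a₁| + |a₂| + |a₃|) fun n hn => ?_, fun h4 =>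
    nonneg_of_forall_nat_linear (K := |a₀| + |a₁| + |a₂|) fun n hn => ?_, fun h4 h3 =>
    nonneg_of_forall_nat_linear (K := |a₀| + |a₁|) fun n hn => ?_, fun h4 h3 h2 =>
    nonneg_of_forall_nat_linear (K := a₀) fun n hn => ?_⟩
  all_goals
    have h1 := h n hn
    have hn1 : (1 : ℝ) ≤ n := by exact_mod_cast hn
    have hn2 : (1 : ℝ) ≤ (n : ℝ) ^ 2 := one_le_pow₀ hn1
    have hn3 : (1 : ℝ) ≤ (n : ℝ) ^ 3 := one_le_pow₀ hn1
  · have e : a₀ + a₁ * n + a₂ * (n : ℝ) ^ 2 + a₃ * (n : ℝ) ^ 3 + a₄ * (n : ℝ) ^ 4 ≤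
        (a₄ * n + (|a₀| + |a₁| + |a₂| + |a₃|)) * (n : ℝ) ^ 3 := by
      have e0 : a₀ ≤ |a₀| * (n : ℝ) ^ 3 := (le_abs_self _).trans (le_mul_of_one_le_right (abs_nonneg _) hn3)
      have e1 : a₁ * n ≤ |a₁| * (n : ℝ) ^ 3 :=
        mul_le_mul (le_abs_self _) (le_self_pow₀ hn1 (by norm_num)) (by linarith) (abs_nonneg _)
      have e2 : a₂ * (n : ℝ) ^ 2 ≤ |a₂| * (n : ℝ) ^ 3 :=
        mul_le_mul (le_abs_self _) (pow_le_pow_right₀ hn1 (by norm_num)) (by positivity) (abs_nonneg _)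
      have e3 : a₃ * (n : ℝ) ^ 3 ≤ |a₃| * (n : ℝ) ^ 3 :=
        mul_le_mul_of_nonneg_right (le_abs_self _) (by positivity)
      linarith
    exact nonneg_of_mul_nonneg_left (h1.trans e) (by positivity)
  · have e : a₀ + a₁ * n + a₂ * (n : ℝ) ^ 2 + a₃ * (n : ℝ) ^ 3 + a₄ * (n : ℝ) ^ 4 ≤
        (a₃ * n + (|a₀| + |a₁| + |a₂|)) * (n : ℝ) ^ 2 := by
      have e0 : a₀ ≤ |a₀| * (n : ℝ) ^ 2 := (le_abs_self _).trans (le_mul_of_one_le_right (abs_nonneg _) hn2)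
      have e1 : a₁ * n ≤ |a₁| * (n : ℝ) ^ 2 :=
        mul_le_mul (le_abs_self _) (le_self_pow₀ hn1 (by norm_num)) (by linarith) (abs_nonneg _)
      have e2 : a₂ * (n : ℝ) ^ 2 ≤ |a₂| * (n : ℝ) ^ 2 :=
        mul_le_mul_of_nonneg_right (le_abs_self _) (by positivity)
      rw [h4]
      linarith
    exact nonneg_of_mul_nonneg_left (h1.trans e) (by positivity)
  · have e : a₀ + a₁ * n + a₂ * (n : ℝ) ^ 2 + a₃ * (n : ℝ) ^ 3 + a₄ * (n : ℝ) ^ 4 ≤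
        (a₂ * n + (|a₀| + |a₁|)) * (n : ℝ) := by
      have e0 : a₀ ≤ |a₀| * (n : ℝ) := (le_abs_self _).trans (le_mul_of_one_le_right (abs_nonneg _) hn1)
      have e1 : a₁ * n ≤ |a₁| * (n : ℝ) := mul_le_mul_of_nonneg_right (le_abs_self _) (by positivity)
      rw [h4, h3]
      linarith
    exact nonneg_of_mul_nonneg_left (h1.trans e) (by positivity)
  · rw [h4, h3, h2] at h1
    linarith

/-- A quartic polynomial that is nonnegative on `ℤ`: sign conditions on its coefficients. -/
lemma quartic_coeff_of_nonneg {a₀ a₁ a₂ a₃ a₄ : ℝ}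
    (h : ∀ t : ℤ, 0 ≤ a₀ + a₁ * t + a₂ * (t : ℝ) ^ 2 + a₃ * (t : ℝ) ^ 3 + a₄ * (t : ℝ) ^ 4) :
    0 ≤ a₄ ∧ (a₄ = 0 → a₃ = 0 ∧ 0 ≤ a₂ ∧ (a₂ = 0 → a₁ = 0)) := by
  obtain ⟨p4, p3, p2, p1⟩ := quartic_coeff_nonneg (fun n _ => by exact_mod_cast h n)
  obtain ⟨-, m3, -, m1⟩ := quartic_coeff_nonneg (a₀ := a₀) (a₁ := -a₁) (a₂ := a₂) (a₃ := -a₃)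
    (a₄ := a₄) (fun n _ => by
      have := h (-(n : ℤ))
      push_cast at this
      linarith)
  refine ⟨p4, fun h4 => ?_⟩
  have h3 : a₃ = 0 := by linarith [p3 h4, m3 h4]
  exact ⟨h3, p2 h4 h3, fun h2 => by linarith [p1 h4 h3 h2, m1 h4 (by rw [h3, neg_zero]) h2]⟩

/-- A cubic polynomial with values in `ℕ` takes `O(√y)` values up to `y`, uniformly. -/
lemma card_values_cubic_le {f : ℤ → ℕ} {a₀ a₁ a₂ a₃ : ℝ}
    (hf : ∀ t : ℤ, (f t : ℝ) = a₀ + a₁ * t + a₂ * (t : ℝ) ^ 2 + a₃ * (t : ℝ) ^ 3) {y : ℝ}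
    (hy : 1 ≤ y) {T : Finset ℕ} (hT : ∀ n ∈ T, (n : ℝ) ≤ y ∧ ∃ t, f t = n) :
    (T.card : ℝ) ≤ 6 * √y := by
  have hs : 1 ≤ √y := Real.one_le_sqrt.2 hy
  obtain ⟨-, h4⟩ := quartic_coeff_of_nonneg (a₀ := a₀) (a₁ := a₁) (a₂ := a₂) (a₃ := a₃) (a₄ := 0)
    (fun t => by rw [zero_mul, add_zero, ← hf]; positivity)
  obtain ⟨h3, h2, h1⟩ := h4 rfl
  subst h3
  rcases h2.eq_or_lt with h2 | h2
  · have h1 := h1 h2.symm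
    have hcard : T.card ≤ 1 := by
      refine Finset.card_le_one.2 fun m hm n hn => ?_
      obtain ⟨-, s, rfl⟩ := hT m hm
      obtain ⟨-, t, rfl⟩ := hT n hn
      have : (f s : ℝ) = f t := by rw [hf, hf, ← h2, h1]; ring
      exact_mod_cast this
    have : (T.card : ℝ) ≤ 1 := by exact_mod_cast hcard
    linarith
  -- The second difference `2 a₂` is an integer, so once positive it is at least 1; this makes the
  -- bound independent of the polynomial.
  · have hint : (2 * a₂ : ℝ) = ((f 1 - 2 * f 0 + f (-1) : ℤ) : ℝ) := by
      push_cast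
      rw [hf, hf, hf]
      push_cast
      ring
    have ha : (1 : ℝ) ≤ 2 * a₂ := by
      have : (0 : ℝ) < ((f 1 - 2 * f 0 + f (-1) : ℤ) : ℝ) := by rw [← hint]; linarith
      rw [hint]
      exact_mod_cast Int.add_one_le_iff.2 (Int.cast_pos.1 this)
    have hbound : 2 * √(2 * y / a₂) + 2 ≤ 6 * √y := by
      have h5 : √(2 * y / a₂) ≤ √(2 ^ 2 * y) := by
        refine Real.sqrt_le_sqrt ?_
        rw [div_le_iff₀ h2]
        nlinarith
      rw [Real.sqrt_mul (by norm_num), Real.sqrt_sq (by norm_num)] at h5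
      linarith
    refine le_trans (Finset.card_le_of_forall_exists (P := fun t => (f t : ℝ) ≤ y) (g := f)
      (fun I hI => Finset.card_int_le_of_abs_quadratic_le (r := a₁) (s := a₀) h2
        (by linarith : 0 ≤ y) fun t ht => ?_) fun n hn => ?_) hbound
    · have h6 : a₂ * (t : ℝ) ^ 2 + a₁ * t + a₀ = f t := by rw [hf]; ring
      rw [h6, abs_of_nonneg (Nat.cast_nonneg _)]
      exact hI t ht
    · obtain ⟨hny, t, rfl⟩ := hT n hn
      exact ⟨t, hny, rfl⟩

/-- The values up to `y` that are attained on the first `O(y ^ (1/4))` members of a family of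
cubic polynomials. -/
lemma card_values_strip_le {g : ℤ → ℤ → ℕ}
    (hg : ∀ k, ∃ a₀ a₁ a₂ a₃ : ℝ, ∀ t : ℤ,
      (g k t : ℝ) = a₀ + a₁ * t + a₂ * (t : ℝ) ^ 2 + a₃ * (t : ℝ) ^ 3)
    {B y : ℝ} (hB : 0 ≤ B) (hy : 1 ≤ y) {T : Finset ℕ}
    (hT : ∀ n ∈ T, (n : ℝ) ≤ y ∧ ∃ k t : ℤ, |(k : ℝ)| ≤ B * √√y ∧ g k t = n) :
    (T.card : ℝ) ≤ (12 * B + 6) * (√y * √√y) := by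
  have hs : 1 ≤ √y := Real.one_le_sqrt.2 hy
  have hss : 1 ≤ √√y := Real.one_le_sqrt.2 hs
  have h := Finset.card_le_of_fiber (T := T) (Q := fun k n => ∃ t, g k t = n) (A := 0)
    (R := B * √√y) (b := 6 * √y) (by positivity) (by positivity) (fun n hn => by
      obtain ⟨-, k, t, hk, ht⟩ := hT n hn
      exact ⟨k, by rwa [sub_zero], t, ht⟩) (fun k T' hT' hQ => by
      obtain ⟨a₀, a₁, a₂, a₃, ha⟩ := hg k
      exact card_values_cubic_le ha hy fun n hn => ⟨(hT n (hT' hn)).1, hQ n hn⟩)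
  refine h.trans ?_
  nlinarith [mul_nonneg (sub_nonneg.2 hss) (by linarith : 0 ≤ √y)]

lemma abs_le_mul_sqrt_sqrt {x B y : ℝ} (hB : 0 ≤ B) (hy : 0 ≤ y) (h : x ^ 4 ≤ B ^ 4 * y) :
    |x| ≤ B * √√y := by
  have h1 : |x| ^ 4 ≤ (B * √√y) ^ 4 := by
    have h2 : √√y ^ 4 = y := by
      rw [show √√y ^ 4 = (√√y ^ 2) ^ 2 by ring, Real.sq_sqrt (Real.sqrt_nonneg y), Real.sq_sqrt hy]
    rw [mul_pow, h2, show |x| ^ 4 = (|x| ^ 2) ^ 2 by ring, sq_abs]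
    linarith [show (x ^ 2) ^ 2 = x ^ 4 by ring]
  exact le_of_pow_le_pow_left₀ (by norm_num) (by positivity) h1

lemma one_le_div_sqrt_one_add_log {y : ℝ} (hy : 1 ≤ y) : 1 ≤ y / √(1 + Real.log y) := by
  have h1 := Real.log_le_sub_one_of_pos (show 0 < y by linarith)
  have hlog : 0 ≤ Real.log y := Real.log_nonneg hy
  rw [one_le_div (Real.sqrt_pos.2 (by linarith))]
  refine Real.sqrt_le_iff.2 ⟨by linarith, ?_⟩
  nlinarith

/-! ### Values of quadratic polynomials -/

lemma sparseSet_of_quadratic {S : Set ℕ} {p q s : ℝ} (hp : 0 < p)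
    (h : ∀ n ∈ S, ∃ w : ℤ, (n : ℝ) = p * (w : ℝ) ^ 2 + q * w + s) : SparseSet S := by
  refine sparseSet_of_card_le (C := 2 * √(2 / p) + 2) fun y hy T hT => ?_
  have hs : 1 ≤ √y := Real.one_le_sqrt.2 hy
  have hss : 1 ≤ √√y := Real.one_le_sqrt.2 hs
  refine (Finset.card_le_of_forall_exists
    (P := fun w : ℤ => |p * (w : ℝ) ^ 2 + q * w + s| ≤ y)
    (g := fun w : ℤ => ⌊p * (w : ℝ) ^ 2 + q * w + s⌋₊) (fun I hI =>
      Finset.card_int_le_of_abs_quadratic_le hp (by linarith) hI) fun n hn => ?_).trans ?_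
  · obtain ⟨-, hny, hnS⟩ := hT n hn
    obtain ⟨w, hw⟩ := h n hnS
    refine ⟨w, ?_, ?_⟩
    · rw [← hw, abs_of_nonneg (Nat.cast_nonneg n)]
      exact hny
    · rw [← hw, Nat.floor_natCast]
  · have h1 : √(2 * y / p) = √(2 / p) * √y := by
      rw [← Real.sqrt_mul (by positivity)]
      congr 1
      ring
    rw [h1]
    have h2 : √y ≤ √y * √√y := le_mul_of_one_le_right (by linarith) hss
    nlinarith [mul_le_mul_of_nonneg_left h2 (Real.sqrt_nonneg (2 / p))]

/-- The natural numbers represented by a positive definite diagonal binary quadratic polynomial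
with rational coefficients form a sparse set. -/
lemma sparseSet_of_binary_quadratic {S : Set ℕ} {p q s : ℚ} (hp : 0 < p) (hq : 0 < q)
    (h : ∀ n ∈ S, ∃ u v : ℤ, (n : ℚ) = p * (u : ℚ) ^ 2 + q * (v : ℚ) ^ 2 + s) : SparseSet S := by
  classical
  obtain ⟨a, ha⟩ : ∃ a : ℕ, (a : ℤ) = p.num * q.den :=
    Int.eq_ofNat_of_zero_le (by have := Rat.num_pos.2 hp; positivity) |>.imp fun _ h => h.symm
  obtain ⟨b, hb⟩ : ∃ b : ℕ, (b : ℤ) = q.num * p.den :=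
    Int.eq_ofNat_of_zero_le (by have := Rat.num_pos.2 hq; positivity) |>.imp fun _ h => h.symm
  set d : ℕ := p.den * q.den with hd
  have hpd : (p.den : ℚ) ≠ 0 := by exact_mod_cast p.den_ne_zero
  have hqd : (q.den : ℚ) ≠ 0 := by exact_mod_cast q.den_ne_zero
  have hd0 : 0 < d := Nat.mul_pos p.den_pos q.den_pos
  have hda : (d : ℚ) * p = a := by
    have h1 : (a : ℚ) = p.num * q.den := by exact_mod_cast congrArg (Int.cast : ℤ → ℚ) ha
    rw [h1, hd, Nat.cast_mul]
    linear_combination (q.den : ℚ) * (Rat.den_mul_eq_num p)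
  have hdb : (d : ℚ) * q = b := by
    have h1 : (b : ℚ) = q.num * p.den := by exact_mod_cast congrArg (Int.cast : ℤ → ℚ) hb
    rw [h1, hd, Nat.cast_mul]
    linear_combination (p.den : ℚ) * (Rat.den_mul_eq_num q)
  have hd0' : (0 : ℚ) < d := by exact_mod_cast hd0
  have ha0' : (0 : ℚ) < a := by rw [← hda]; positivity
  have hb0' : (0 : ℚ) < b := by rw [← hdb]; positivity
  have ha0 : 0 < a := by exact_mod_cast ha0'
  have hb0 : 0 < b := by exact_mod_cast hb0'
  obtain ⟨C, hC, hcard⟩ := exists_card_sq_add_mul_sq_le (D := a * b) (by positivity)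
  -- With `a = d p` and `b = d q`, the identity is `a d (n - s) = (a u)² + (a b) v²`.
  have hex : ∀ n ∈ S, ∃ m : ℕ, (m : ℚ) = a * d * (n - s) ∧
      ∃ u v : ℤ, (m : ℤ) = u ^ 2 + (a * b : ℕ) * v ^ 2 := by
    intro n hn
    obtain ⟨u, v, huv⟩ := h n hn
    refine ⟨((a * u) ^ 2 + (a * b : ℕ) * v ^ 2 : ℤ).toNat, ?_, a * u, v, ?_⟩
    · have h1 : ((((a * u) ^ 2 + (a * b : ℕ) * v ^ 2 : ℤ).toNat : ℤ) : ℚ) =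
        (((a * u) ^ 2 + (a * b : ℕ) * v ^ 2 : ℤ) : ℚ) := by
        rw [Int.toNat_of_nonneg (by positivity)]
      rw [Int.cast_natCast] at h1
      rw [h1, huv]
      push_cast
      linear_combination -(a : ℚ) * u ^ 2 * hda - (a : ℚ) * v ^ 2 * hdb
    · rw [Int.toNat_of_nonneg (by positivity)]
  have hex' : ∀ n : ℕ, ∃ m : ℕ, n ∈ S → (m : ℚ) = a * d * (n - s) ∧
      ∃ u v : ℤ, (m : ℤ) = u ^ 2 + (a * b : ℕ) * v ^ 2 := by
    intro n
    by_cases hn : n ∈ S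
    · obtain ⟨m, hm⟩ := hex n hn
      exact ⟨m, fun _ => hm⟩
    · exact ⟨0, fun h => absurd h hn⟩
  choose m hm using hex'
  set K : ℝ := a * d * (1 + |(s : ℝ)|) with hK
  have had : (1 : ℝ) ≤ a * d := by exact_mod_cast Nat.one_le_iff_ne_zero.2 (by positivity)
  have hK1 : 1 ≤ K := by rw [hK]; nlinarith [abs_nonneg (s : ℝ)]
  refine ⟨C * K + 1, by positivity, fun y hy T hT => ?_⟩
  have hlog : 0 ≤ Real.log y := Real.log_nonneg hy
  have hinj : Set.InjOn m T := by
    intro n₁ h₁ n₂ h₂ h12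
    have e1 := (hm n₁ (hT n₁ h₁).2.2).1
    have e2 := (hm n₂ (hT n₂ h₂).2.2).1
    rw [h12, e2] at e1
    have e3 := mul_left_cancel₀ (by positivity : (a : ℚ) * d ≠ 0) e1
    have e4 : (n₁ : ℚ) = n₂ := by linarith
    exact_mod_cast e4
  -- For `n ≤ y` the transformed integer is at most `a d (y + |s|) ≤ K y`. The value 0 is erased
  -- because the count concerns positive integers; it accounts for the `+ 1` in the constant.
  have h1 := hcard (K * y) (by nlinarith) ((T.image m).erase 0) (by
    intro k hk
    obtain ⟨hk0, hk⟩ := Finset.mem_erase.1 hk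
    obtain ⟨n, hn, rfl⟩ := Finset.mem_image.1 hk
    obtain ⟨-, hny, hnS⟩ := hT n hn
    obtain ⟨e1, e2⟩ := hm n hnS
    refine ⟨Nat.pos_of_ne_zero hk0, ?_, e2⟩
    have e3 : (m n : ℝ) = a * d * (n - s) := by exact_mod_cast congrArg (Rat.cast : ℚ → ℝ) e1
    rw [e3, hK, mul_assoc _ (1 + |(s : ℝ)|)]
    refine mul_le_mul_of_nonneg_left ?_ (by linarith)
    nlinarith [neg_abs_le (s : ℝ), abs_nonneg (s : ℝ)])
  have h2 : (T.card : ℝ) ≤ ((T.image m).erase 0).card + 1 := by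
    rw [← Finset.card_image_of_injOn hinj]
    have := Finset.pred_card_le_card_erase (s := T.image m) (a := 0)
    exact_mod_cast (by omega : (T.image m).card ≤ ((T.image m).erase 0).card + 1)
  have h3 : K * y / √(1 + Real.log (K * y)) ≤ K * (y / √(1 + Real.log y)) := by
    rw [← mul_div_assoc]
    have h4 : Real.log y ≤ Real.log (K * y) := Real.log_le_log (by linarith) (by nlinarith)
    have h5 : 0 < √(1 + Real.log y) := Real.sqrt_pos.2 (by linarith)
    gcongr
  have h6 := one_le_div_sqrt_one_add_log hy
  nlinarith [mul_le_mul_of_nonneg_left h3 hC.le]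

/-! ### Lower bounds from dominating terms -/

/-- If all monomials are small compared to `W`, then so is any linear combination. -/
lemma sum_mul_ge_of_dominated {ι : Type*} [Fintype ι] (a m : ι → ℝ) {κ W R : ℝ} (hκ : 0 < κ)
    (hW : 0 ≤ W) (hR : 2 * (∑ i, |a i|) / κ + 1 ≤ R) (hm : ∀ i, |m i| * R ≤ W) :
    -(κ / 2 * W) ≤ ∑ i, a i * m i := by
  have hS : 0 ≤ ∑ i, |a i| := Finset.sum_nonneg fun _ _ => abs_nonneg _
  have hR0 : 0 < R := by
    have : 0 ≤ 2 * (∑ i, |a i|) / κ := by positivity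
    linarith
  have h1 : ∑ i, |a i| ≤ κ / 2 * R := by
    have : 2 * (∑ i, |a i|) / κ ≤ R := by linarith
    rw [div_le_iff₀ hκ] at this
    linarith
  have h2 : ∑ i, -(|a i| * (W / R)) ≤ ∑ i, a i * m i := by
    refine Finset.sum_le_sum fun i _ => ?_
    have h3 : |m i| ≤ W / R := by rw [le_div_iff₀ hR0]; exact hm i
    have h4 := neg_abs_le (a i * m i)
    rw [abs_mul] at h4
    nlinarith [mul_le_mul_of_nonneg_left h3 (abs_nonneg (a i))]
  refine le_trans ?_ h2
  rw [Finset.sum_neg_distrib, ← Finset.sum_mul, neg_le_neg_iff, ← mul_div_assoc, div_le_iff₀ hR0]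
  nlinarith

/-- Lower bound `x² (x² + y²) ≪ F` in a region `|x| ≥ R`. -/
lemma exists_lower_bound_sq_mul_sq_add_sq {κ : ℝ} (hκ : 0 < κ)
    (a₃₀ a₂₁ a₁₂ a₂₀ a₁₁ a₀₂ a₁₀ a₀₁ a₀₀ : ℝ) :
    ∃ R : ℝ, 1 ≤ R ∧ ∀ x y : ℝ, R ≤ |x| →
      κ / 2 * (x ^ 2 * (x ^ 2 + y ^ 2)) ≤ κ * (x ^ 2 * (x ^ 2 + y ^ 2)) + (a₃₀ * x ^ 3 +
        a₂₁ * x ^ 2 * y + a₁₂ * x * y ^ 2 + a₂₀ * x ^ 2 + a₁₁ * x * y + a₀₂ * y ^ 2 + a₁₀ * x +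
        a₀₁ * y + a₀₀) := by
  let a : Fin 9 → ℝ := ![a₃₀, a₂₁, a₁₂, a₂₀, a₁₁, a₀₂, a₁₀, a₀₁, a₀₀]
  have hR1 : 1 ≤ 2 * (∑ i, |a i|) / κ + 1 := by
    have : 0 ≤ 2 * (∑ i, |a i|) / κ := by positivity
    linarith
  refine ⟨2 * (∑ i, |a i|) / κ + 1, hR1, fun x y hx => ?_⟩
  generalize hRdef : 2 * (∑ i, |a i|) / κ + 1 = R at *
  have h := sum_mul_ge_of_dominated a
    ![x ^ 3, x ^ 2 * y, x * y ^ 2, x ^ 2, x * y, y ^ 2, x, y, 1] (W := x ^ 2 * (x ^ 2 + y ^ 2))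
    (R := R) hκ (by positivity) hRdef.le (by
      have hx1 : 1 ≤ |x| := hR1.trans hx
      have hX2 : x ^ 2 = |x| ^ 2 := (sq_abs x).symm
      have hY2 : y ^ 2 = |y| ^ 2 := (sq_abs y).symm
      have hY := abs_nonneg y
      rw [hX2, hY2]
      simp only [Fin.forall_fin_succ, Matrix.cons_val_zero, Matrix.cons_val_succ, abs_mul, abs_pow,
        abs_abs, abs_one, IsEmpty.forall_iff, and_true]
      generalize |x| = X at *
      generalize |y| = Y at *
      have hX0 : 0 ≤ X := by linarith
      have hX2' : X ≤ X ^ 2 := by nlinarith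
      have hX4 : X ^ 2 ≤ X ^ 4 := by nlinarith [sq_nonneg X]
      have hXY : X * Y ≤ X ^ 2 + Y ^ 2 := by nlinarith [sq_nonneg (X - Y), sq_nonneg X, sq_nonneg Y]
      have hXY2 : 0 ≤ X ^ 2 * Y ^ 2 := by positivity
      have hW1 : X ^ 2 + Y ^ 2 ≤ X ^ 2 * (X ^ 2 + Y ^ 2) :=
        le_mul_of_one_le_left (by positivity) (by nlinarith)
      refine ⟨?_, ?_, ?_, ?_, ?_, ?_, ?_, ?_, ?_⟩
      · have := mul_le_mul_of_nonneg_left hx (by positivity : 0 ≤ X ^ 3)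
        nlinarith
      · have := mul_le_mul_of_nonneg_left hx (by positivity : 0 ≤ X ^ 2 * Y)
        nlinarith [mul_le_mul_of_nonneg_left hXY (by positivity : 0 ≤ X ^ 2)]
      · have := mul_le_mul_of_nonneg_left hx (by positivity : 0 ≤ X * Y ^ 2)
        nlinarith [sq_nonneg (X ^ 2)]
      · have := mul_le_mul_of_nonneg_left (hx.trans hX2') (by positivity : 0 ≤ X ^ 2)
        nlinarith
      · have := mul_le_mul_of_nonneg_left hx (by positivity : 0 ≤ X * Y)
        have h2 : X * Y * X ≤ X ^ 2 * (X * Y) := by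
          nlinarith [mul_le_mul_of_nonneg_left hX2' (by positivity : 0 ≤ X * Y)]
        nlinarith [mul_le_mul_of_nonneg_left hXY (by positivity : 0 ≤ X ^ 2)]
      · have := mul_le_mul_of_nonneg_left (hx.trans hX2') (by positivity : 0 ≤ Y ^ 2)
        nlinarith [sq_nonneg (X ^ 2)]
      · have := mul_le_mul_of_nonneg_left hx hX0
        nlinarith
      · have := mul_le_mul_of_nonneg_left hx hY
        nlinarith
      · nlinarith)
  simp only [a, Fin.sum_univ_succ, Fin.sum_univ_zero, Matrix.cons_val_zero, Matrix.cons_val_succ] at h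
  linarith

/-- Lower bound `x² y² ≪ F` in a region `|x|, |y| ≥ R`. -/
lemma exists_lower_bound_sq_mul_sq {κ : ℝ} (hκ : 0 < κ)
    (a₂₁ a₁₂ a₂₀ a₁₁ a₀₂ a₁₀ a₀₁ a₀₀ : ℝ) :
    ∃ R : ℝ, 1 ≤ R ∧ ∀ x y : ℝ, R ≤ |x| → R ≤ |y| →
      κ / 2 * (x ^ 2 * y ^ 2) ≤ κ * (x ^ 2 * y ^ 2) + (a₂₁ * x ^ 2 * y + a₁₂ * x * y ^ 2 +
        a₂₀ * x ^ 2 + a₁₁ * x * y + a₀₂ * y ^ 2 + a₁₀ * x + a₀₁ * y + a₀₀) := by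
  let a : Fin 8 → ℝ := ![a₂₁, a₁₂, a₂₀, a₁₁, a₀₂, a₁₀, a₀₁, a₀₀]
  have hR1 : 1 ≤ 2 * (∑ i, |a i|) / κ + 1 := by
    have : 0 ≤ 2 * (∑ i, |a i|) / κ := by positivity
    linarith
  refine ⟨2 * (∑ i, |a i|) / κ + 1, hR1, fun x y hx hy => ?_⟩
  generalize hRdef : 2 * (∑ i, |a i|) / κ + 1 = R at *
  have h := sum_mul_ge_of_dominated a
    ![x ^ 2 * y, x * y ^ 2, x ^ 2, x * y, y ^ 2, x, y, 1] (W := x ^ 2 * y ^ 2)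
    (R := R) hκ (by positivity) hRdef.le (by
      have hx1 : 1 ≤ |x| := hR1.trans hx
      have hy1 : 1 ≤ |y| := hR1.trans hy
      have hX2 : x ^ 2 = |x| ^ 2 := (sq_abs x).symm
      have hY2 : y ^ 2 = |y| ^ 2 := (sq_abs y).symm
      rw [hX2, hY2]
      simp only [Fin.forall_fin_succ, Matrix.cons_val_zero, Matrix.cons_val_succ, abs_mul, abs_pow,
        abs_abs, abs_one, IsEmpty.forall_iff, and_true]
      generalize |x| = X at *
      generalize |y| = Y at *
      have hX0 : 0 ≤ X := by linarith
      have hY0 : 0 ≤ Y := by linarith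
      have hX2' : X ≤ X ^ 2 := by nlinarith
      have hY2' : Y ≤ Y ^ 2 := by nlinarith
      have hXY1 : X * Y ≤ X ^ 2 * Y ^ 2 := mul_le_mul hX2' hY2' hY0 (by positivity)
      refine ⟨?_, ?_, ?_, ?_, ?_, ?_, ?_, ?_⟩
      · have := mul_le_mul_of_nonneg_left hy (by positivity : 0 ≤ X ^ 2 * Y)
        linarith
      · have := mul_le_mul_of_nonneg_left hx (by positivity : 0 ≤ X * Y ^ 2)
        linarith
      · exact mul_le_mul_of_nonneg_left (hy.trans hY2') (by positivity)
      · have h2 := mul_le_mul_of_nonneg_left hy (by positivity : 0 ≤ X * Y)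
        have h3 : X * Y * Y ≤ X ^ 2 * Y ^ 2 := by
          nlinarith [mul_le_mul_of_nonneg_right hX2' (by positivity : 0 ≤ Y ^ 2)]
        linarith
      · have := mul_le_mul_of_nonneg_left (hx.trans hX2') (by positivity : 0 ≤ Y ^ 2)
        linarith
      · exact (mul_le_mul_of_nonneg_left hy hX0).trans hXY1
      · have := mul_le_mul_of_nonneg_left hx hY0
        linarith
      · nlinarith)
  simp only [a, Fin.sum_univ_succ, Fin.sum_univ_zero, Matrix.cons_val_zero, Matrix.cons_val_succ] at h
  linarith

/-- Either `|x|` is below the threshold `R`, or the lower bound `κ x⁴ ≤ y` applies; the constant `R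
+ 1/κ` serves both cases. -/
lemma abs_le_of_lower_bound {x κ R y : ℝ} (hκ : 0 < κ) (hR : 1 ≤ R) (hy : 1 ≤ y)
    (h : R ≤ |x| → κ * x ^ 4 ≤ y) : |x| ≤ (R + 1 / κ) * √√y := by
  have hk : 0 < 1 / κ := by positivity
  rcases le_total R |x| with hx | hx
  · refine abs_le_mul_sqrt_sqrt (by linarith) (by linarith) ?_
    have h1 : 1 / κ ≤ (R + 1 / κ) ^ 4 := by
      have : R + 1 / κ ≤ (R + 1 / κ) ^ 4 := le_self_pow₀ (by linarith) (by norm_num)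
      linarith
    have h2 : x ^ 4 ≤ 1 / κ * y := by
      rw [one_div, ← div_eq_inv_mul, le_div_iff₀ hκ]
      linarith [h hx]
    exact h2.trans (mul_le_mul_of_nonneg_right h1 (by linarith))
  · have hss : 1 ≤ √√y := Real.one_le_sqrt.2 (Real.one_le_sqrt.2 hy)
    nlinarith

/-! ### Quartic functions and nonnegativity of the top form -/

/-- The binary quartic form with coefficients `c i j`, `i + j = 4`. -/
def quarticForm (c : ℕ → ℕ → ℚ) (x y : ℝ) : ℝ :=
  c 4 0 * x ^ 4 + c 3 1 * x ^ 3 * y + c 2 2 * x ^ 2 * y ^ 2 + c 1 3 * x * y ^ 3 + c 0 4 * y ^ 4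

/-- The terms of degree at most three of a quartic polynomial with coefficients `c i j`. -/
def cubicPart (c : ℕ → ℕ → ℚ) (x y : ℝ) : ℝ :=
  c 3 0 * x ^ 3 + c 2 1 * x ^ 2 * y + c 1 2 * x * y ^ 2 + c 0 3 * y ^ 3 +
    c 2 0 * x ^ 2 + c 1 1 * x * y + c 0 2 * y ^ 2 + c 1 0 * x + c 0 1 * y + c 0 0

/-- The polynomial of degree at most four in two variables with coefficients `c i j`. -/
def quarticEval (c : ℕ → ℕ → ℚ) (x y : ℝ) : ℝ := quarticForm c x y + cubicPart c x y

/-- `f` is the restriction to `ℤ²` of the quartic polynomial with coefficients `c`. -/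
def IsQuarticFun (c : ℕ → ℕ → ℚ) (f : ℤ → ℤ → ℕ) : Prop :=
  ∀ x y : ℤ, (f x y : ℝ) = quarticEval c x y

/-- Restriction of a quartic polynomial to a line. -/
lemma IsQuarticFun.line {c : ℕ → ℕ → ℚ} {f : ℤ → ℤ → ℕ} (hf : IsQuarticFun c f) (u v a b : ℤ) :
    ∃ a₀ a₁ a₂ a₃ : ℝ, ∀ t : ℤ, (f (u + a * t) (v + b * t) : ℝ) =
      a₀ + a₁ * t + a₂ * (t : ℝ) ^ 2 + a₃ * (t : ℝ) ^ 3 + quarticForm c a b * (t : ℝ) ^ 4 := by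
  refine ⟨quarticEval c u v,
    c 4 0 * (4 * u ^ 3 * a) + c 3 1 * (3 * u ^ 2 * a * v + u ^ 3 * b)
      + c 2 2 * (2 * u * a * v ^ 2 + u ^ 2 * (2 * v * b)) + c 1 3 * (a * v ^ 3 + u * (3 * v ^ 2 * b))
      + c 0 4 * (4 * v ^ 3 * b)
      + c 3 0 * (3 * u ^ 2 * a) + c 2 1 * (2 * u * a * v + u ^ 2 * b)
      + c 1 2 * (a * v ^ 2 + u * (2 * v * b)) + c 0 3 * (3 * v ^ 2 * b)
      + c 2 0 * (2 * u * a) + c 1 1 * (a * v + u * b) + c 0 2 * (2 * v * b) + c 1 0 * a + c 0 1 * b,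
    c 4 0 * (6 * u ^ 2 * a ^ 2) + c 3 1 * (3 * u * a ^ 2 * v + 3 * u ^ 2 * a * b)
      + c 2 2 * (a ^ 2 * v ^ 2 + 4 * u * a * v * b + u ^ 2 * b ^ 2)
      + c 1 3 * (3 * a * v ^ 2 * b + 3 * u * v * b ^ 2) + c 0 4 * (6 * v ^ 2 * b ^ 2)
      + c 3 0 * (3 * u * a ^ 2) + c 2 1 * (a ^ 2 * v + 2 * u * a * b)
      + c 1 2 * (2 * a * v * b + u * b ^ 2) + c 0 3 * (3 * v * b ^ 2)
      + c 2 0 * a ^ 2 + c 1 1 * (a * b) + c 0 2 * b ^ 2,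
    c 4 0 * (4 * u * a ^ 3) + c 3 1 * (a ^ 3 * v + 3 * u * a ^ 2 * b)
      + c 2 2 * (2 * a ^ 2 * v * b + 2 * u * a * b ^ 2) + c 1 3 * (3 * a * v * b ^ 2 + u * b ^ 3)
      + c 0 4 * (4 * v * b ^ 3)
      + c 3 0 * a ^ 3 + c 2 1 * (a ^ 2 * b) + c 1 2 * (a * b ^ 2) + c 0 3 * b ^ 3, fun t => ?_⟩
  rw [hf]
  simp only [quarticEval, quarticForm, cubicPart]
  push_cast
  ring

/-- The value of the form is the leading coefficient of `f` along the line through the origin with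
direction `(a, b)`. -/
lemma IsQuarticFun.quarticForm_int_nonneg {c : ℕ → ℕ → ℚ} {f : ℤ → ℤ → ℕ} (hf : IsQuarticFun c f)
    (a b : ℤ) : 0 ≤ quarticForm c a b := by
  obtain ⟨a₀, a₁, a₂, a₃, h⟩ := hf.line 0 0 a b
  exact (quartic_coeff_of_nonneg fun t => by rw [← h]; positivity).1

lemma quarticForm_smul (c : ℕ → ℕ → ℚ) (t x y : ℝ) :
    quarticForm c (t * x) (t * y) = t ^ 4 * quarticForm c x y := by
  simp only [quarticForm]; ring

lemma IsQuarticFun.quarticForm_rat_nonneg {c : ℕ → ℕ → ℚ} {f : ℤ → ℤ → ℕ}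
    (hf : IsQuarticFun c f) (a b : ℚ) : 0 ≤ quarticForm c a b := by
  have h := hf.quarticForm_int_nonneg (a.num * b.den) (b.num * a.den)
  have ha : (a.den : ℝ) ≠ 0 := by exact_mod_cast a.den_ne_zero
  have hb : (b.den : ℝ) ≠ 0 := by exact_mod_cast b.den_ne_zero
  have ha' : (a.num : ℝ) = a.den * a := by exact_mod_cast (Rat.den_mul_eq_num a).symm
  have hb' : (b.num : ℝ) = b.den * b := by exact_mod_cast (Rat.den_mul_eq_num b).symm
  push_cast at h
  rw [ha', hb', show (a.den : ℝ) * a * b.den = (a.den * b.den) * a by ring,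
    show (b.den : ℝ) * b * a.den = (a.den * b.den) * b by ring, quarticForm_smul] at h
  exact nonneg_of_mul_nonneg_right h (by positivity)

lemma continuous_quarticForm (c : ℕ → ℕ → ℚ) :
    Continuous fun p : ℝ × ℝ => quarticForm c p.1 p.2 := by
  unfold quarticForm; fun_prop

lemma IsQuarticFun.quarticForm_nonneg {c : ℕ → ℕ → ℚ} {f : ℤ → ℤ → ℕ} (hf : IsQuarticFun c f)
    (x y : ℝ) : 0 ≤ quarticForm c x y := by
  have hd : DenseRange (Prod.map ((↑) : ℚ → ℝ) ((↑) : ℚ → ℝ)) :=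
    Rat.denseRange_cast.prodMap Rat.denseRange_cast
  have hcl : IsClosed {p : ℝ × ℝ | 0 ≤ quarticForm c p.1 p.2} :=
    isClosed_le continuous_const (continuous_quarticForm c)
  exact hd.induction_on (p := fun p : ℝ × ℝ => 0 ≤ quarticForm c p.1 p.2) (x, y) hcl
    fun q => hf.quarticForm_rat_nonneg q.1 q.2

/-- Values attained in the strip `|x| ≪ y^(1/4)`. -/
lemma IsQuarticFun.sparseSet_of_strip {c : ℕ → ℕ → ℚ} {f : ℤ → ℤ → ℕ} (hf : IsQuarticFun c f)
    (h04 : c 0 4 = 0) {B : ℝ} (hB : 0 ≤ B)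
    (h : ∀ x z : ℤ, ∀ y : ℝ, 1 ≤ y → (f x z : ℝ) ≤ y → |(x : ℝ)| ≤ B * √√y) :
    SparseSet {n | ∃ x y, f x y = n} := by
  refine sparseSet_of_card_le (C := 12 * B + 6) fun y hy T hT =>
    card_values_strip_le (g := f) (fun k => ?_) hB hy fun n hn => ?_
  · obtain ⟨a₀, a₁, a₂, a₃, h⟩ := hf.line k 0 0 1
    refine ⟨a₀, a₁, a₂, a₃, fun t => ?_⟩
    have := h t
    simp only [zero_mul, add_zero, zero_add, one_mul] at this
    rw [this]
    simp [quarticForm, h04]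
  · obtain ⟨-, hny, x, z, rfl⟩ := hT n hn
    exact ⟨hny, x, z, h x z y hy hny, rfl⟩

/-! ### Top form divisible by `x²` with a nonzero cofactor at `(0, 1)` -/

section VerticalZero

variable {c : ℕ → ℕ → ℚ} {f : ℤ → ℤ → ℕ}

/-- If the top form vanishes at `(0, 1)`, then `f` has degree at most two in `y`. -/
lemma IsQuarticFun.coeff_of_c04_eq_zero (hf : IsQuarticFun c f) (h04 : c 0 4 = 0) :
    c 1 3 = 0 ∧ c 0 3 = 0 ∧
      ∀ x : ℤ, 0 ≤ (c 2 2 : ℝ) * x ^ 2 + c 1 2 * x + c 0 2 ∧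
        ((c 2 2 : ℝ) * x ^ 2 + c 1 2 * x + c 0 2 = 0 →
          (c 3 1 : ℝ) * x ^ 3 + c 2 1 * x ^ 2 + c 1 1 * x + c 0 1 = 0) := by
  have key : ∀ x : ℤ, (c 1 3 : ℝ) * x + c 0 3 = 0 ∧
      0 ≤ (c 2 2 : ℝ) * x ^ 2 + c 1 2 * x + c 0 2 ∧
        ((c 2 2 : ℝ) * x ^ 2 + c 1 2 * x + c 0 2 = 0 →
          (c 3 1 : ℝ) * x ^ 3 + c 2 1 * x ^ 2 + c 1 1 * x + c 0 1 = 0) := by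
    intro x
    -- For fixed `x` the function is a cubic in the second variable that is nonnegative on `ℤ`, so
    -- its leading coefficient vanishes.
    refine (quartic_coeff_of_nonneg (a₀ := c 4 0 * x ^ 4 + c 3 0 * x ^ 3 + c 2 0 * x ^ 2 + c 1 0 * x + c 0 0)
      (a₁ := (c 3 1 : ℝ) * x ^ 3 + c 2 1 * x ^ 2 + c 1 1 * x + c 0 1)
      (a₂ := (c 2 2 : ℝ) * x ^ 2 + c 1 2 * x + c 0 2) (a₃ := c 1 3 * x + c 0 3) (a₄ := 0)
      fun t => ?_).2 rfl
    have h1 := hf x t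
    have h2 : (0 : ℝ) ≤ f x t := Nat.cast_nonneg _
    rw [h1] at h2
    simp only [quarticEval, quarticForm, cubicPart, h04, Rat.cast_zero] at h2
    linarith
  have h0 := (key 0).1
  have h1 := (key 1).1
  rw [Int.cast_zero, mul_zero, zero_add] at h0
  rw [Int.cast_one, h0] at h1
  have h1' : (c 1 3 : ℝ) = 0 := by linarith
  exact ⟨by exact_mod_cast h1', by exact_mod_cast h0, fun x => (key x).2⟩

/-- Top form `x² Q(x, y)` with `Q` positive definite. -/
lemma IsQuarticFun.sparseSet_of_sq_mul_posDef (hf : IsQuarticFun c f) (h04 : c 0 4 = 0)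
    (h22 : 0 < c 2 2) (hdisc : (c 3 1) ^ 2 < 4 * c 2 2 * c 4 0) :
    SparseSet {n | ∃ x y, f x y = n} := by
  obtain ⟨h13, h03, -⟩ := hf.coeff_of_c04_eq_zero h04
  have h22' : (0 : ℝ) < c 2 2 := by exact_mod_cast h22
  have hdisc' : (c 3 1 : ℝ) ^ 2 < 4 * c 2 2 * c 4 0 := by exact_mod_cast hdisc
  have h40 : (0 : ℝ) < c 4 0 := by nlinarith [sq_nonneg (c 3 1 : ℝ)]
  -- Determinant over trace of the matrix of the quadratic cofactor: a lower bound for its smallest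
  -- eigenvalue.
  set κ : ℝ := (c 2 2 * c 4 0 - (c 3 1 : ℝ) ^ 2 / 4) / (c 2 2 + c 4 0) with hκdef
  have hκ : 0 < κ := div_pos (by linarith) (by linarith)
  have hκ' : κ * (c 2 2 + c 4 0) = c 2 2 * c 4 0 - (c 3 1 : ℝ) ^ 2 / 4 :=
    div_mul_cancel₀ _ (by linarith)
  have hκlt : κ < c 2 2 := by
    rw [hκdef, div_lt_iff₀ (by linarith)]
    nlinarith [sq_nonneg (c 3 1 : ℝ)]
  have hQ : ∀ x y : ℝ, κ * (x ^ 2 + y ^ 2) ≤ c 4 0 * x ^ 2 + c 3 1 * x * y + c 2 2 * y ^ 2 := by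
    intro x y
    have h1 : 0 < c 2 2 - κ := by linarith
    have h2 : 0 ≤ (c 2 2 - κ) * (c 4 0 * x ^ 2 + c 3 1 * x * y + c 2 2 * y ^ 2 - κ * (x ^ 2 + y ^ 2)) := by
      have : (c 2 2 - κ) * (c 4 0 * x ^ 2 + c 3 1 * x * y + c 2 2 * y ^ 2 - κ * (x ^ 2 + y ^ 2)) =
          ((c 2 2 - κ) * y + c 3 1 / 2 * x) ^ 2 + κ ^ 2 * x ^ 2 := by
        linear_combination -x ^ 2 * hκ'
      rw [this]
      positivity
    have h3 := nonneg_of_mul_nonneg_right h2 h1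
    linarith
  obtain ⟨R, hR, h⟩ := exists_lower_bound_sq_mul_sq_add_sq hκ (c 3 0) (c 2 1) (c 1 2) (c 2 0)
    (c 1 1) (c 0 2) (c 1 0) (c 0 1) (c 0 0)
  refine hf.sparseSet_of_strip h04 (B := R + 1 / (κ / 2)) (by positivity) fun x z y hy hfy =>
    abs_le_of_lower_bound (by positivity) hR hy fun hx => ?_
  have h1 := h x z hx
  have h2 := mul_le_mul_of_nonneg_left (hQ x z) (sq_nonneg (x : ℝ))
  rw [hf] at hfy
  simp only [quarticEval, quarticForm, cubicPart, h04, h13, h03, Rat.cast_zero] at hfy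
  have h3 : κ / 2 * (x : ℝ) ^ 4 ≤ κ / 2 * ((x : ℝ) ^ 2 * ((x : ℝ) ^ 2 + (z : ℝ) ^ 2)) := by
    have : 0 ≤ κ / 2 * ((x : ℝ) ^ 2 * (z : ℝ) ^ 2) := by positivity
    linarith
  linarith

/-- Top form `γ x² (y + ρ x)²`. -/
lemma IsQuarticFun.sparseSet_of_sq_mul_sq (hf : IsQuarticFun c f) (h04 : c 0 4 = 0)
    (h22 : 0 < c 2 2) (hdisc : (c 3 1) ^ 2 = 4 * c 2 2 * c 4 0) :
    SparseSet {n | ∃ x y, f x y = n} := by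
  obtain ⟨h13, h03, -⟩ := hf.coeff_of_c04_eq_zero h04
  have h22' : (0 : ℝ) < c 2 2 := by exact_mod_cast h22
  set ρ : ℚ := c 3 1 / (2 * c 2 2) with hρ
  have e31 : c 3 1 = 2 * c 2 2 * ρ := by rw [hρ]; field_simp
  have e40 : c 4 0 = c 2 2 * ρ ^ 2 := by
    rw [e31] at hdisc
    have := h22.ne'
    have h1 : 4 * c 2 2 * (c 4 0 - c 2 2 * ρ ^ 2) = 0 := by linear_combination -hdisc
    rcases mul_eq_zero.1 h1 with h2 | h2
    · exact absurd h2 (by positivity)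
    · linarith
  -- With `ρ = l/m` in lowest terms, `(m, -l)` is the primitive integer vector on the second zero
  -- line `y = -ρ x`.
  obtain ⟨m, hm⟩ : ∃ m : ℤ, m = (ρ.den : ℤ) := ⟨_, rfl⟩
  obtain ⟨l, hl⟩ : ∃ l : ℤ, l = ρ.num := ⟨_, rfl⟩
  have hmρ : (m : ℝ) * ρ = l := by
    have := Rat.den_mul_eq_num ρ
    rw [hm, hl]
    exact_mod_cast this
  have hm0 : (0 : ℝ) < m := by rw [hm]; exact_mod_cast ρ.den_pos
  have hm1 : (1 : ℝ) ≤ m := by rw [hm]; exact_mod_cast ρ.den_pos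
  have hform : ∀ x y : ℝ, quarticForm c x y = c 2 2 * (x ^ 2 * (y + ρ * x) ^ 2) := by
    intro x y
    simp only [quarticForm, h04, h13, e31, e40]
    push_cast
    ring
  have hform0 : quarticForm c m (-l : ℤ) = 0 := by
    rw [hform]
    push_cast
    rw [← hmρ]
    ring
  -- the cubic part vanishes along the second zero
  have hcub : (c 3 0 : ℝ) - c 2 1 * ρ + c 1 2 * ρ ^ 2 = 0 := by
    have h1 := (quartic_coeff_of_nonneg (a₀ := c 0 0) (a₁ := c 1 0 * m - c 0 1 * l)
      (a₂ := c 2 0 * m ^ 2 - c 1 1 * m * l + c 0 2 * l ^ 2)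
      (a₃ := c 3 0 * m ^ 3 - c 2 1 * m ^ 2 * l + c 1 2 * m * l ^ 2) (a₄ := 0) (fun t => by
        have h2 : (0 : ℝ) ≤ f (m * t) (-l * t) := Nat.cast_nonneg _
        rw [hf] at h2
        have h3 : quarticForm c ((m * t : ℤ) : ℝ) ((-l * t : ℤ) : ℝ) = 0 := by
          push_cast
          rw [mul_comm (m : ℝ), mul_comm (-l : ℝ), quarticForm_smul]
          push_cast at hform0
          rw [hform0, mul_zero]
        rw [quarticEval, h3, cubicPart, h03] at h2
        push_cast at h2
        linarith)).2 rfl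
    have h2 := h1.1
    rw [← hmρ] at h2
    have h3 : (m : ℝ) ^ 3 * (c 3 0 - c 2 1 * ρ + c 1 2 * ρ ^ 2) = 0 := by linear_combination h2
    exact (mul_eq_zero.1 h3).resolve_left (by positivity)
  -- These are the coefficients of the lower-order part in the variables `x` and `y + ρ x`; the pure
  -- cube of `x` has disappeared by `hcub`.
  obtain ⟨R, hR, h⟩ := exists_lower_bound_sq_mul_sq h22' (c 2 1 - 2 * c 1 2 * ρ) (c 1 2)
    (c 2 0 - c 1 1 * ρ + c 0 2 * ρ ^ 2) (c 1 1 - 2 * c 0 2 * ρ) (c 0 2) (c 1 0 - c 0 1 * ρ) (c 0 1)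
    (c 0 0)
  have hlow : ∀ x z : ℤ, R ≤ |(x : ℝ)| → R ≤ |(z : ℝ) + ρ * x| →
      c 2 2 / 2 * ((x : ℝ) ^ 2 * (z + ρ * x) ^ 2) ≤ f x z := by
    intro x z hx hz
    refine (h x (z + ρ * x) hx hz).trans_eq ?_
    rw [hf, quarticEval, hform, cubicPart, h03]
    push_cast
    linear_combination -(x : ℝ) ^ 3 * hcub
  set B := R + 1 / (c 2 2 / 2 : ℝ) with hB
  have hB0 : 0 ≤ B := by positivity
  -- second family of lines
  obtain ⟨u, v, huv⟩ : ∃ u v : ℤ, m * v + l * u = 1 := by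
    have hc : IsCoprime m l := by
      have := ρ.reduced
      rw [Int.isCoprime_iff_gcd_eq_one, Int.gcd_comm]
      rw [hm, hl, Int.gcd, Int.natAbs_natCast]
      exact this
    obtain ⟨a, b, hab⟩ := hc
    exact ⟨b, a, by linarith⟩
  let g : ℤ → ℤ → ℕ := fun e t => f (u * e + m * t) (v * e + -l * t)
  refine sparseSet_of_card_le (C := (12 * B + 6) + (12 * (m * B) + 6)) fun y hy T hT => ?_
  classical
  have hcover : ∀ n ∈ T, (∃ x z : ℤ, |(x : ℝ)| ≤ B * √√y ∧ f x z = n) ∨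
      ∃ e t : ℤ, |(e : ℝ)| ≤ m * B * √√y ∧ g e t = n := by
    intro n hn
    obtain ⟨-, hny, x, z, rfl⟩ := hT n hn
    -- The product of the squares dominates the fourth power of the smaller factor, so one of the
    -- two linear forms is `O(y^(1/4))`.
    rcases le_total |(x : ℝ)| |(z : ℝ) + ρ * x| with hxz | hxz
    · left
      refine ⟨x, z, abs_le_of_lower_bound (by positivity) hR hy fun hx => ?_, rfl⟩
      refine le_trans ?_ ((hlow x z hx (hx.trans hxz)).trans hny)
      have : (x : ℝ) ^ 2 ≤ (z + ρ * x) ^ 2 := sq_le_sq.2 hxz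
      have := mul_le_mul_of_nonneg_left this (sq_nonneg (x : ℝ))
      refine mul_le_mul_of_nonneg_left ?_ (by positivity)
      linarith [show (x : ℝ) ^ 4 = (x : ℝ) ^ 2 * (x : ℝ) ^ 2 by ring]
    · right
      have h1 : |(z : ℝ) + ρ * x| ≤ B * √√y := by
        refine abs_le_of_lower_bound (by positivity) hR hy fun hz => ?_
        refine le_trans ?_ ((hlow x z (hz.trans hxz) hz).trans hny)
        have : (z + ρ * x : ℝ) ^ 2 ≤ (x : ℝ) ^ 2 := sq_le_sq.2 hxz
        have := mul_le_mul_of_nonneg_right this (sq_nonneg (z + ρ * x : ℝ))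
        refine mul_le_mul_of_nonneg_left ?_ (by positivity)
        linarith [show (z + ρ * x : ℝ) ^ 4 = (z + ρ * x : ℝ) ^ 2 * (z + ρ * x : ℝ) ^ 2 by ring]
      -- The inverse of the unimodular parametrisation used in `g`; the first coordinate equals `m
      -- (z + ρ x)`.
      refine ⟨m * z + l * x, v * x - u * z, ?_, ?_⟩
      · push_cast
        rw [← hmρ, show (m * z + m * ρ * x : ℝ) = m * (z + ρ * x) by ring, abs_mul,
          abs_of_pos hm0, mul_assoc]
        exact mul_le_mul_of_nonneg_left h1 hm0.le
      · have e1 : u * (m * z + l * x) + m * (v * x - u * z) = x := by linear_combination x * huv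
        have e2 : v * (m * z + l * x) + -l * (v * x - u * z) = z := by linear_combination z * huv
        simp only [g, e1, e2]
  have hu : T = T.filter (fun n => ∃ x z : ℤ, |(x : ℝ)| ≤ B * √√y ∧ f x z = n) ∪
      T.filter (fun n => ∃ e t : ℤ, |(e : ℝ)| ≤ m * B * √√y ∧ g e t = n) := by
    rw [← Finset.filter_or, Finset.filter_true_of_mem hcover]
  have hc1 := card_values_strip_le (g := f) (fun k => by
    obtain ⟨a₀, a₁, a₂, a₃, h⟩ := hf.line k 0 0 1
    refine ⟨a₀, a₁, a₂, a₃, fun t => ?_⟩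
    have := h t
    simp only [zero_mul, add_zero, zero_add, one_mul] at this
    rw [this]
    simp [quarticForm, h04]) hB0 hy
    (T := T.filter (fun n => ∃ x z : ℤ, |(x : ℝ)| ≤ B * √√y ∧ f x z = n)) (by
      intro n hn
      rw [Finset.mem_filter] at hn
      exact ⟨(hT n hn.1).2.1, hn.2⟩)
  have hc2 := card_values_strip_le (g := g) (fun k => by
    obtain ⟨a₀, a₁, a₂, a₃, h⟩ := hf.line (u * k) (v * k) m (-l)
    refine ⟨a₀, a₁, a₂, a₃, fun t => ?_⟩
    rw [h t, hform0, zero_mul, add_zero]) (B := m * B) (by positivity) hy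
    (T := T.filter (fun n => ∃ e t : ℤ, |(e : ℝ)| ≤ m * B * √√y ∧ g e t = n)) (by
      intro n hn
      rw [Finset.mem_filter] at hn
      exact ⟨(hT n hn.1).2.1, hn.2⟩)
  have hc3 : (T.card : ℝ) ≤ (T.filter (fun n => ∃ x z : ℤ, |(x : ℝ)| ≤ B * √√y ∧ f x z = n)).card +
      (T.filter (fun n => ∃ e t : ℤ, |(e : ℝ)| ≤ m * B * √√y ∧ g e t = n)).card := by
    rw [← Nat.cast_add]
    conv_lhs => rw [hu]
    exact_mod_cast Finset.card_union_le _ _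
  linarith
end VerticalZero

/-! ### Positive definite top form -/

/-- Lower bound `(x² + y²)² ≪ F` outside of a disc. -/
lemma exists_lower_bound_sq_add_sq_sq {κ : ℝ} (hκ : 0 < κ) (c : ℕ → ℕ → ℚ) :
    ∃ R : ℝ, 1 ≤ R ∧ ∀ x y r : ℝ, 0 ≤ r → x ^ 2 + y ^ 2 = r ^ 2 → R ≤ r →
      κ / 2 * r ^ 4 ≤ κ * r ^ 4 + cubicPart c x y := by
  let a : Fin 10 → ℝ := ![c 3 0, c 2 1, c 1 2, c 0 3, c 2 0, c 1 1, c 0 2, c 1 0, c 0 1, c 0 0]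
  have hR1 : 1 ≤ 2 * (∑ i, |a i|) / κ + 1 := by
    have : 0 ≤ 2 * (∑ i, |a i|) / κ := by positivity
    linarith
  refine ⟨2 * (∑ i, |a i|) / κ + 1, hR1, fun x y r hr hxy hRr => ?_⟩
  generalize hRdef : 2 * (∑ i, |a i|) / κ + 1 = R at *
  have hX : |x| ≤ r := abs_le_of_sq_le_sq (by nlinarith [sq_nonneg y]) hr
  have hY : |y| ≤ r := abs_le_of_sq_le_sq (by nlinarith [sq_nonneg x]) hr
  have h := sum_mul_ge_of_dominated a
    ![x ^ 3, x ^ 2 * y, x * y ^ 2, y ^ 3, x ^ 2, x * y, y ^ 2, x, y, 1] (W := r ^ 4)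
    (R := R) hκ (by positivity) hRdef.le (by
      have hX0 := abs_nonneg x
      have hY0 := abs_nonneg y
      simp only [Fin.forall_fin_succ, Matrix.cons_val_zero, Matrix.cons_val_succ, abs_mul, abs_pow,
        abs_one, IsEmpty.forall_iff, and_true]
      generalize |x| = X at *
      generalize |y| = Y at *
      have hr1 : 1 ≤ r := hR1.trans hRr
      have hR0 : 0 ≤ R := by linarith
      have h3 : r ^ 3 * R ≤ r ^ 4 := by
        have := mul_le_mul_of_nonneg_left hRr (by positivity : 0 ≤ r ^ 3)
        linarith [show r ^ 3 * r = r ^ 4 by ring]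
      have h2 : r ^ 2 * R ≤ r ^ 4 :=
        (mul_le_mul_of_nonneg_right (pow_le_pow_right₀ hr1 (by norm_num)) hR0).trans h3
      have h1 : r * R ≤ r ^ 4 :=
        (mul_le_mul_of_nonneg_right (le_self_pow₀ hr1 (by norm_num)) hR0).trans h3
      have h0 : 1 * R ≤ r ^ 4 :=
        (mul_le_mul_of_nonneg_right hr1 hR0).trans h1
      refine ⟨?_, ?_, ?_, ?_, ?_, ?_, ?_, ?_, ?_, h0⟩
      · exact (mul_le_mul_of_nonneg_right (by gcongr) hR0).trans h3
      · refine (mul_le_mul_of_nonneg_right ?_ hR0).trans h3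
        calc X ^ 2 * Y ≤ r ^ 2 * r := by gcongr
          _ = r ^ 3 := by ring
      · refine (mul_le_mul_of_nonneg_right ?_ hR0).trans h3
        calc X * Y ^ 2 ≤ r * r ^ 2 := by gcongr
          _ = r ^ 3 := by ring
      · exact (mul_le_mul_of_nonneg_right (by gcongr) hR0).trans h3
      · exact (mul_le_mul_of_nonneg_right (by gcongr) hR0).trans h2
      · refine (mul_le_mul_of_nonneg_right ?_ hR0).trans h2
        calc X * Y ≤ r * r := by gcongr
          _ = r ^ 2 := by ring
      · exact (mul_le_mul_of_nonneg_right (by gcongr) hR0).trans h2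
      · exact (mul_le_mul_of_nonneg_right (by gcongr) hR0).trans h1
      · exact (mul_le_mul_of_nonneg_right (by gcongr) hR0).trans h1)
  simp only [a, Fin.sum_univ_succ, Fin.sum_univ_zero, Matrix.cons_val_zero, Matrix.cons_val_succ] at h
  unfold cubicPart
  linarith

/-- The form attains a positive minimum on the compact unit circle; homogeneity does the rest. -/
lemma exists_quarticForm_lower_bound {c : ℕ → ℕ → ℚ}
    (hpos : ∀ x y : ℝ, (x, y) ≠ 0 → 0 < quarticForm c x y) :
    ∃ κ : ℝ, 0 < κ ∧ ∀ x y : ℝ, κ * (x ^ 2 + y ^ 2) ^ 2 ≤ quarticForm c x y := by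
  have hcomp : IsCompact {p : ℝ × ℝ | p.1 ^ 2 + p.2 ^ 2 = 1} := by
    refine IsCompact.of_isClosed_subset (isCompact_Icc (a := ((-1, -1) : ℝ × ℝ)) (b := (1, 1)))
      (isClosed_eq (by fun_prop) continuous_const) fun p hp => ?_
    have hp' : p.1 ^ 2 + p.2 ^ 2 = 1 := hp
    have h1 := abs_le.1 (abs_le_of_sq_le_sq (a := p.1) (b := 1) (by nlinarith [sq_nonneg p.2]) zero_le_one)
    have h2 := abs_le.1 (abs_le_of_sq_le_sq (a := p.2) (b := 1) (by nlinarith [sq_nonneg p.1]) zero_le_one)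
    exact ⟨⟨h1.1, h2.1⟩, ⟨h1.2, h2.2⟩⟩
  obtain ⟨p, hp, hmin⟩ := hcomp.exists_isMinOn ⟨(1, 0), by simp⟩
    (continuous_quarticForm c).continuousOn
  have hp' : p.1 ^ 2 + p.2 ^ 2 = 1 := hp
  refine ⟨quarticForm c p.1 p.2, hpos _ _ fun h0 => ?_, fun x y => ?_⟩
  · have h1 : p.1 = 0 := congrArg Prod.fst h0
    have h2 : p.2 = 0 := congrArg Prod.snd h0
    rw [h1, h2] at hp'
    norm_num at hp'
  · rcases eq_or_ne (x ^ 2 + y ^ 2) 0 with h0 | h0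
    · have hx : x = 0 := by nlinarith [sq_nonneg x, sq_nonneg y]
      have hy : y = 0 := by nlinarith [sq_nonneg x, sq_nonneg y]
      simp [hx, hy, quarticForm]
    · have hr : 0 < x ^ 2 + y ^ 2 := lt_of_le_of_ne (by positivity) h0.symm
      set r := √(x ^ 2 + y ^ 2) with hrdef
      have hr0 : 0 < r := Real.sqrt_pos.2 hr
      have hr2 : r ^ 2 = x ^ 2 + y ^ 2 := Real.sq_sqrt hr.le
      have hmem : (x / r) ^ 2 + (y / r) ^ 2 = 1 := by
        field_simp
        linarith
      have h1 := isMinOn_iff.1 hmin (x / r, y / r) hmem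
      simp only at h1
      have h2 := quarticForm_smul c r (x / r) (y / r)
      rw [mul_div_cancel₀ _ hr0.ne', mul_div_cancel₀ _ hr0.ne'] at h2
      rw [h2, ← hr2]
      have h3 : 0 ≤ r ^ 4 := by positivity
      have h4 := mul_le_mul_of_nonneg_left h1 h3
      linarith

/-- Positive definite top form. -/
lemma IsQuarticFun.sparseSet_of_posDef {c : ℕ → ℕ → ℚ} {f : ℤ → ℤ → ℕ} (hf : IsQuarticFun c f)
    (hpos : ∀ x y : ℝ, (x, y) ≠ 0 → 0 < quarticForm c x y) :
    SparseSet {n | ∃ x y, f x y = n} := by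
  obtain ⟨κ, hκ, hlow⟩ := exists_quarticForm_lower_bound hpos
  obtain ⟨R, hR, h⟩ := exists_lower_bound_sq_add_sq_sq hκ c
  set B := R + 1 / (κ / 2) with hB
  have hB0 : 0 ≤ B := by positivity
  have hbound : ∀ x z : ℤ, ∀ y : ℝ, 1 ≤ y → (f x z : ℝ) ≤ y →
      |(x : ℝ)| ≤ B * √√y ∧ |(z : ℝ)| ≤ B * √√y := by
    intro x z y hy hfy
    set r := √((x : ℝ) ^ 2 + (z : ℝ) ^ 2) with hr
    have hr0 : 0 ≤ r := Real.sqrt_nonneg _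
    have hr2 : r ^ 2 = (x : ℝ) ^ 2 + (z : ℝ) ^ 2 := Real.sq_sqrt (by positivity)
    have h1 : |r| ≤ B * √√y := by
      refine abs_le_of_lower_bound (by positivity) hR hy fun hRr => ?_
      rw [abs_of_nonneg hr0] at hRr
      have h2 := h x z r hr0 hr2.symm hRr
      have h3 := hlow x z
      rw [← hr2, show (r ^ 2) ^ 2 = r ^ 4 by ring] at h3
      rw [hf, quarticEval] at hfy
      linarith
    rw [abs_of_nonneg hr0] at h1
    exact ⟨(abs_le_of_sq_le_sq (by nlinarith [sq_nonneg (z : ℝ)]) hr0).trans h1,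
      (abs_le_of_sq_le_sq (by nlinarith [sq_nonneg (x : ℝ)]) hr0).trans h1⟩
  -- There are `O(y^(1/4))` choices for each coordinate, hence only `O(√y)` values.
  refine sparseSet_of_card_le (C := (2 * B + 1) * (2 * B + 1)) fun y hy T hT => ?_
  have hs : 1 ≤ √y := Real.one_le_sqrt.2 hy
  have hss : 1 ≤ √√y := Real.one_le_sqrt.2 hs
  have hmain := Finset.card_le_of_fiber (T := T)
    (Q := fun k n => ∃ z : ℤ, |(z : ℝ)| ≤ B * √√y ∧ f k z = n) (A := 0) (R := B * √√y)
    (b := 2 * (B * √√y) + 1) (by positivity) (by positivity) (fun n hn => by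
      obtain ⟨-, hny, x, z, rfl⟩ := hT n hn
      obtain ⟨h1, h2⟩ := hbound x z y hy hny
      exact ⟨x, by rwa [sub_zero], z, h2, rfl⟩) (fun k T' _ hQ =>
      Finset.card_le_of_forall_exists (P := fun z : ℤ => |(z : ℝ)| ≤ B * √√y) (g := f k)
        (fun I hI => Finset.card_int_le_of_abs_sub_le (a := 0) (by positivity) fun z hz => by
          rw [sub_zero]
          exact hI z hz) hQ)
  have h1 : 2 * (B * √√y) + 1 ≤ (2 * B + 1) * √√y := by linarith
  calc (T.card : ℝ) ≤ _ := hmain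
    _ ≤ ((2 * B + 1) * √√y) * ((2 * B + 1) * √√y) := by gcongr
    _ = (2 * B + 1) * (2 * B + 1) * √y := by
        rw [mul_mul_mul_comm, Real.mul_self_sqrt (by linarith)]
    _ ≤ (2 * B + 1) * (2 * B + 1) * (√y * √√y) :=
        mul_le_mul_of_nonneg_left (le_mul_of_one_le_right (by linarith) hss) (by positivity)

/-! ### Top form a fourth power: the source of binary quadratic forms -/

/-- Top form `c x⁴`. -/
lemma IsQuarticFun.sparseSet_of_c22_eq_zero {c : ℕ → ℕ → ℚ} {f : ℤ → ℤ → ℕ}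
    (hf : IsQuarticFun c f) (h04 : c 0 4 = 0) (h22 : c 2 2 = 0) (htop : c 4 0 ≠ 0 ∨ c 3 1 ≠ 0) :
    SparseSet {n | ∃ x y, f x y = n} := by
  obtain ⟨h13, h03, hp⟩ := hf.coeff_of_c04_eq_zero h04
  have h12 : c 1 2 = 0 := by
    have := ((quartic_coeff_of_nonneg (a₀ := c 0 2) (a₁ := c 1 2) (a₂ := 0) (a₃ := 0) (a₄ := 0)
      fun t => by
        have := (hp t).1
        rw [h22, Rat.cast_zero] at this
        linarith).2 rfl).2.2 rfl
    exact_mod_cast this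
  have h31 : c 3 1 = 0 := by
    have := ((quartic_coeff_of_nonneg (a₀ := c 4 0) (a₁ := c 3 1) (a₂ := 0) (a₃ := 0) (a₄ := 0)
      fun t => by
        have := hf.quarticForm_int_nonneg 1 t
        simp only [quarticForm, h04, h13, h22, Rat.cast_zero] at this
        push_cast at this
        linarith).2 rfl).2.2 rfl
    exact_mod_cast this
  have h40 : (0 : ℝ) < c 4 0 := by
    have h1 := hf.quarticForm_int_nonneg 1 0
    simp only [quarticForm, h04, h13, h22, h31, Rat.cast_zero] at h1
    push_cast at h1
    have h2 : (c 4 0 : ℝ) ≠ 0 := by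
      have := htop.resolve_right (fun h => h h31)
      exact_mod_cast this
    exact lt_of_le_of_ne (by linarith) h2.symm
  have h02 : (0 : ℝ) ≤ c 0 2 := by simpa using (hp 0).1
  have hF : ∀ x z : ℤ, (f x z : ℝ) = c 0 2 * z ^ 2 + (c 2 1 * x ^ 2 + c 1 1 * x + c 0 1) * z +
      (c 4 0 * x ^ 4 + c 3 0 * x ^ 3 + c 2 0 * x ^ 2 + c 1 0 * x + c 0 0) := by
    intro x z
    rw [hf]
    simp only [quarticEval, quarticForm, cubicPart, h04, h13, h22, h31, h03, h12, Rat.cast_zero]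
    ring
  -- a bound for `x` from a quartic minorant
  have hstrip : ∀ a₀ a₁ a₂ a₃ a₄ : ℝ, 0 < a₄ →
      (∀ x z : ℤ, a₄ * x ^ 4 + (a₃ * x ^ 3 + a₂ * x ^ 2 + a₁ * x + a₀) ≤ (f x z : ℝ)) →
      SparseSet {n | ∃ x y, f x y = n} := by
    intro a₀ a₁ a₂ a₃ a₄ h4 hle
    obtain ⟨R, hR, h⟩ := exists_lower_bound_sq_mul_sq_add_sq h4 a₃ 0 0 a₂ 0 0 a₁ 0 a₀
    refine hf.sparseSet_of_strip h04 (B := R + 1 / (a₄ / 2)) (by positivity) fun x z y hy hfy =>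
      abs_le_of_lower_bound (by positivity) hR hy fun hx => ?_
    have h1 := h x 0 hx
    have h2 := hle x z
    linarith
  rcases h02.eq_or_lt with h02 | h02
  -- Without a `z²` term the coefficient of `z` must vanish for every integer `x`, so `f` depends on
  -- `x` alone.
  · have hr : ∀ x : ℤ, (c 2 1 : ℝ) * x ^ 2 + c 1 1 * x + c 0 1 = 0 := by
      intro x
      have h1 := (hp x).2
      rw [h22, h12, ← h02, h31] at h1
      simp only [Rat.cast_zero, zero_mul, zero_add, forall_const] at h1
      exact h1
    refine hstrip (c 0 0) (c 1 0) (c 2 0) (c 3 0) (c 4 0) h40 fun x z => ?_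
    rw [hF, hr, ← h02]
    linarith
  -- The `gᵢ` are the coefficients of the polynomial in `x` left after completing the square in `z`.
  set g₄ : ℚ := c 4 0 - c 2 1 ^ 2 / (4 * c 0 2) with hg₄
  set g₃ : ℚ := c 3 0 - 2 * c 1 1 * c 2 1 / (4 * c 0 2) with hg₃
  set g₂ : ℚ := c 2 0 - (c 1 1 ^ 2 + 2 * c 0 1 * c 2 1) / (4 * c 0 2) with hg₂
  set g₁ : ℚ := c 1 0 - 2 * c 0 1 * c 1 1 / (4 * c 0 2) with hg₁
  set g₀ : ℚ := c 0 0 - c 0 1 ^ 2 / (4 * c 0 2) with hg₀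
  have h02' : (0 : ℚ) < c 0 2 := by exact_mod_cast h02
  have hFQ : ∀ x z : ℤ, (f x z : ℚ) = c 0 2 * (z + (c 2 1 * x ^ 2 + c 1 1 * x + c 0 1) / (2 * c 0 2)) ^ 2 +
      (g₄ * x ^ 4 + g₃ * x ^ 3 + g₂ * x ^ 2 + g₁ * x + g₀) := by
    intro x z
    have h1 : (f x z : ℚ) = c 0 2 * z ^ 2 + (c 2 1 * x ^ 2 + c 1 1 * x + c 0 1) * z +
      (c 4 0 * x ^ 4 + c 3 0 * x ^ 3 + c 2 0 * x ^ 2 + c 1 0 * x + c 0 0) := by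
      exact_mod_cast hF x z
    rw [h1, hg₄, hg₃, hg₂, hg₁, hg₀]
    field_simp
    ring
  have hFR : ∀ x z : ℤ, (f x z : ℝ) = c 0 2 * (z + (c 2 1 * x ^ 2 + c 1 1 * x + c 0 1) / (2 * c 0 2)) ^ 2 +
      (g₄ * x ^ 4 + g₃ * x ^ 3 + g₂ * x ^ 2 + g₁ * x + g₀) := by
    intro x z
    exact_mod_cast congrArg (Rat.cast : ℚ → ℝ) (hFQ x z)
  have hglow : ∀ x : ℤ, 0 ≤ (g₀ + c 0 2) + g₁ * x + g₂ * (x : ℝ) ^ 2 + g₃ * (x : ℝ) ^ 3 +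
      g₄ * (x : ℝ) ^ 4 := by
    intro x
    -- Taking `z = -⌊w⌋` makes the square at most 1, so the remainder plus `c 0 2` is nonnegative at
    -- every integer.
    set w : ℝ := (c 2 1 * x ^ 2 + c 1 1 * x + c 0 1) / (2 * c 0 2) with hw
    have h1 := hFR x (-⌊w⌋)
    have h2 : (0 : ℝ) ≤ f x (-⌊w⌋) := Nat.cast_nonneg _
    rw [h1, ← hw] at h2
    push_cast at h2
    have h3 : (-(⌊w⌋ : ℝ) + w) ^ 2 ≤ 1 := by
      have := Int.floor_le w
      have := Int.lt_floor_add_one w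
      nlinarith
    nlinarith [mul_le_mul_of_nonneg_left h3 h02.le]
  obtain ⟨hg4, hg⟩ := quartic_coeff_of_nonneg hglow
  rcases hg4.eq_or_lt with hg4 | hg4
  swap
  · refine hstrip g₀ g₁ g₂ g₃ g₄ hg4 fun x z => ?_
    rw [hFR]
    have : 0 ≤ (c 0 2 : ℝ) * (z + (c 2 1 * x ^ 2 + c 1 1 * x + c 0 1) / (2 * c 0 2)) ^ 2 := by
      positivity
    linarith
  obtain ⟨hg3, hg2, hg1⟩ := hg hg4.symm
  have hg4' : g₄ = 0 := by exact_mod_cast hg4.symm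
  have hg3' : g₃ = 0 := by exact_mod_cast hg3
  -- clear denominators
  set M : ℕ := (c 2 1 / (2 * c 0 2)).den * (c 1 1 / (2 * c 0 2)).den * (c 0 1 / (2 * c 0 2)).den with hM
  have hM0 : 0 < M := by
    rw [hM]
    exact Nat.mul_pos (Nat.mul_pos (Rat.den_pos _) (Rat.den_pos _)) (Rat.den_pos _)
  have hM0' : (0 : ℚ) < M := by exact_mod_cast hM0
  have hint : ∀ x z : ℤ, ∃ w : ℤ,
      (z + (c 2 1 * x ^ 2 + c 1 1 * x + c 0 1) / (2 * c 0 2) : ℚ) = w / M := by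
    intro x z
    refine ⟨M * z + ((c 2 1 / (2 * c 0 2)).num * (c 1 1 / (2 * c 0 2)).den * (c 0 1 / (2 * c 0 2)).den * x ^ 2 +
      (c 2 1 / (2 * c 0 2)).den * (c 1 1 / (2 * c 0 2)).num * (c 0 1 / (2 * c 0 2)).den * x +
      (c 2 1 / (2 * c 0 2)).den * (c 1 1 / (2 * c 0 2)).den * (c 0 1 / (2 * c 0 2)).num), ?_⟩
    rw [eq_div_iff hM0'.ne', hM]
    push_cast
    rw [← Rat.den_mul_eq_num (c 2 1 / (2 * c 0 2)), ← Rat.den_mul_eq_num (c 1 1 / (2 * c 0 2)),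
      ← Rat.den_mul_eq_num (c 0 1 / (2 * c 0 2))]
    ring
  -- The remainder now has degree at most two: if it is constant, `f` is a quadratic in one integer
  -- variable; otherwise `f` is a sum of two squares with positive rational weights, plus a
  -- constant.
  rcases hg2.eq_or_lt with hg2 | hg2
  · have hg1 := hg1 hg2.symm
    have hg2' : g₂ = 0 := by exact_mod_cast hg2.symm
    have hg1' : g₁ = 0 := by exact_mod_cast hg1
    refine sparseSet_of_quadratic (p := c 0 2 / (M : ℝ) ^ 2) (q := 0) (s := g₀) (by positivity) ?_
    rintro n ⟨x, z, rfl⟩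
    obtain ⟨w, hw⟩ := hint x z
    refine ⟨w, ?_⟩
    have h1 := hFQ x z
    rw [hw, hg4', hg3', hg2', hg1'] at h1
    have h2 : (f x z : ℝ) = c 0 2 * (w / M) ^ 2 + (0 * x ^ 4 + 0 * x ^ 3 + 0 * x ^ 2 + 0 * x + g₀) := by
      exact_mod_cast congrArg (Rat.cast : ℚ → ℝ) h1
    rw [h2]
    ring
  · have hg2' : 0 < g₂ := by exact_mod_cast hg2
    -- Completes the square in `x`: the remainder is `g₂ (x + σ)² + g₀ - g₂ σ²`.
    set σ : ℚ := g₁ / (2 * g₂) with hσ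
    have hσd : (0 : ℚ) < σ.den := by exact_mod_cast σ.den_pos
    refine sparseSet_of_binary_quadratic (p := c 0 2 / (M : ℚ) ^ 2) (q := g₂ / (σ.den : ℚ) ^ 2)
      (s := g₀ - g₂ * σ ^ 2) (by positivity) (by positivity) ?_
    rintro n ⟨x, z, rfl⟩
    obtain ⟨w, hw⟩ := hint x z
    refine ⟨w, σ.den * x + σ.num, ?_⟩
    rw [hFQ, hw, hg4', hg3']
    push_cast
    rw [← Rat.den_mul_eq_num σ]
    have : g₁ = 2 * g₂ * σ := by rw [hσ]; field_simp
    rw [this]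
    field_simp
    ring

/-! ### Moving a rational zero to `(0, 1)` -/

/-- Coefficients of a quartic polynomial after the substitution
`(x, y) ↦ (u x + a y, v x + b y)`. -/
def substCoeff (c : ℕ → ℕ → ℚ) (u a v b : ℚ) : ℕ → ℕ → ℚ
  | 4, 0 => c 4 0 * u ^ 4 + c 3 1 * u ^ 3 * v + c 2 2 * u ^ 2 * v ^ 2 + c 1 3 * u * v ^ 3
      + c 0 4 * v ^ 4
  | 3, 1 => c 4 0 * (4 * u ^ 3 * a) + c 3 1 * (3 * u ^ 2 * a * v + u ^ 3 * b)
      + c 2 2 * (2 * u * a * v ^ 2 + u ^ 2 * (2 * v * b)) + c 1 3 * (a * v ^ 3 + u * (3 * v ^ 2 * b))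
      + c 0 4 * (4 * v ^ 3 * b)
  | 2, 2 => c 4 0 * (6 * u ^ 2 * a ^ 2) + c 3 1 * (3 * u * a ^ 2 * v + 3 * u ^ 2 * a * b)
      + c 2 2 * (a ^ 2 * v ^ 2 + 4 * u * a * v * b + u ^ 2 * b ^ 2)
      + c 1 3 * (3 * a * v ^ 2 * b + 3 * u * v * b ^ 2) + c 0 4 * (6 * v ^ 2 * b ^ 2)
  | 1, 3 => c 4 0 * (4 * u * a ^ 3) + c 3 1 * (a ^ 3 * v + 3 * u * a ^ 2 * b)
      + c 2 2 * (2 * a ^ 2 * v * b + 2 * u * a * b ^ 2) + c 1 3 * (3 * a * v * b ^ 2 + u * b ^ 3)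
      + c 0 4 * (4 * v * b ^ 3)
  | 0, 4 => c 4 0 * a ^ 4 + c 3 1 * a ^ 3 * b + c 2 2 * a ^ 2 * b ^ 2 + c 1 3 * a * b ^ 3
      + c 0 4 * b ^ 4
  | 3, 0 => c 3 0 * u ^ 3 + c 2 1 * u ^ 2 * v + c 1 2 * u * v ^ 2 + c 0 3 * v ^ 3
  | 2, 1 => c 3 0 * (3 * u ^ 2 * a) + c 2 1 * (2 * u * a * v + u ^ 2 * b)
      + c 1 2 * (a * v ^ 2 + 2 * u * v * b) + c 0 3 * (3 * v ^ 2 * b)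
  | 1, 2 => c 3 0 * (3 * u * a ^ 2) + c 2 1 * (a ^ 2 * v + 2 * u * a * b)
      + c 1 2 * (2 * a * v * b + u * b ^ 2) + c 0 3 * (3 * v * b ^ 2)
  | 0, 3 => c 3 0 * a ^ 3 + c 2 1 * a ^ 2 * b + c 1 2 * a * b ^ 2 + c 0 3 * b ^ 3
  | 2, 0 => c 2 0 * u ^ 2 + c 1 1 * u * v + c 0 2 * v ^ 2
  | 1, 1 => c 2 0 * (2 * u * a) + c 1 1 * (a * v + u * b) + c 0 2 * (2 * v * b)
  | 0, 2 => c 2 0 * a ^ 2 + c 1 1 * a * b + c 0 2 * b ^ 2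
  | 1, 0 => c 1 0 * u + c 0 1 * v
  | 0, 1 => c 1 0 * a + c 0 1 * b
  | 0, 0 => c 0 0
  | _, _ => 0

lemma quarticForm_substCoeff (c : ℕ → ℕ → ℚ) (u a v b : ℚ) (x y : ℝ) :
    quarticForm (substCoeff c u a v b) x y = quarticForm c (u * x + a * y) (v * x + b * y) := by
  simp only [quarticForm, substCoeff]
  push_cast
  ring

lemma cubicPart_substCoeff (c : ℕ → ℕ → ℚ) (u a v b : ℚ) (x y : ℝ) :
    cubicPart (substCoeff c u a v b) x y = cubicPart c (u * x + a * y) (v * x + b * y) := by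
  simp only [cubicPart, substCoeff]
  push_cast
  ring

/-- The top form is `x²` times a nonnegative quadratic form, whose leading coefficient `c 2 2` and
discriminant separate the three cases treated above. -/
lemma IsQuarticFun.sparseSet_of_c04_eq_zero {c : ℕ → ℕ → ℚ} {f : ℤ → ℤ → ℕ}
    (hf : IsQuarticFun c f) (h04 : c 0 4 = 0) (hne : ∃ x y : ℝ, quarticForm c x y ≠ 0) :
    SparseSet {n | ∃ x y, f x y = n} := by
  obtain ⟨h13, -, hp⟩ := hf.coeff_of_c04_eq_zero h04
  have h22 : 0 ≤ c 2 2 := by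
    have := ((quartic_coeff_of_nonneg (a₀ := c 0 2) (a₁ := c 1 2) (a₂ := c 2 2) (a₃ := 0) (a₄ := 0)
      fun t => by linarith [(hp t).1]).2 rfl).2.1
    exact_mod_cast this
  rcases h22.eq_or_lt with h22 | h22
  · refine hf.sparseSet_of_c22_eq_zero h04 h22.symm ?_
    by_contra! h
    obtain ⟨x, y, hxy⟩ := hne
    simp [quarticForm, h04, h13, ← h22, h.1, h.2] at hxy
  have hdisc : (c 3 1) ^ 2 ≤ 4 * c 2 2 * c 4 0 := by
    -- On this line the quadratic factor is smallest relative to `x²`; the value is `4 c₂₂³ (4 c₂₂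
    -- c₄₀ - c₃₁²)`.
    have h1 := hf.quarticForm_rat_nonneg (2 * c 2 2) (-c 3 1)
    simp only [quarticForm, h04, h13] at h1
    have h2 : 0 ≤ c 4 0 * (2 * c 2 2) ^ 4 + c 3 1 * (2 * c 2 2) ^ 3 * -c 3 1
        + c 2 2 * (2 * c 2 2) ^ 2 * (-c 3 1) ^ 2 := by
      have h3 : (0 : ℝ) ≤ ((c 4 0 * (2 * c 2 2) ^ 4 + c 3 1 * (2 * c 2 2) ^ 3 * -c 3 1
        + c 2 2 * (2 * c 2 2) ^ 2 * (-c 3 1) ^ 2 : ℚ) : ℝ) := by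
        push_cast at h1 ⊢
        linarith
      exact_mod_cast h3
    have h3 : 0 ≤ (4 * c 2 2 ^ 3) * (4 * c 2 2 * c 4 0 - c 3 1 ^ 2) := by
      linarith [h2, show c 4 0 * (2 * c 2 2) ^ 4 + c 3 1 * (2 * c 2 2) ^ 3 * -c 3 1
        + c 2 2 * (2 * c 2 2) ^ 2 * (-c 3 1) ^ 2 =
          (4 * c 2 2 ^ 3) * (4 * c 2 2 * c 4 0 - c 3 1 ^ 2) by ring]
    have h4 := nonneg_of_mul_nonneg_right h3 (by positivity)
    linarith
  rcases hdisc.eq_or_lt with hdisc | hdisc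
  · exact hf.sparseSet_of_sq_mul_sq h04 h22 hdisc
  · exact hf.sparseSet_of_sq_mul_posDef h04 h22 hdisc

/-- A quartic whose top form has a rational zero. -/
lemma IsQuarticFun.sparseSet_of_int_zero {c : ℕ → ℕ → ℚ} {f : ℤ → ℤ → ℕ}
    (hf : IsQuarticFun c f) {a b : ℤ} (hab : IsCoprime a b) (h0 : quarticForm c a b = 0)
    (hne : ∃ x y : ℝ, quarticForm c x y ≠ 0) :
    SparseSet {n | ∃ x y, f x y = n} := by
  obtain ⟨p, q, hpq⟩ := hab
  -- The Bézout coefficients complete `(a, b)` to an integer matrix of determinant 1 sending `(0,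
  -- 1)` to `(a, b)`.
  have hf' : IsQuarticFun (substCoeff c q a (-p) b) fun x y => f (q * x + a * y) (-p * x + b * y) := by
    intro x y
    rw [hf, quarticEval, quarticEval, quarticForm_substCoeff, cubicPart_substCoeff]
    push_cast
    rfl
  have h04 : substCoeff c q a (-p) b 0 4 = 0 := by
    have h1 : ((substCoeff c q a (-p) b 0 4 : ℚ) : ℝ) = 0 := by
      rw [← h0]
      simp only [substCoeff, quarticForm]
      push_cast
      ring
    exact_mod_cast h1
  have hpq' : (p * a + q * b : ℝ) = 1 := by exact_mod_cast hpq
  have hne' : ∃ x y : ℝ, quarticForm (substCoeff c q a (-p) b) x y ≠ 0 := by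
    obtain ⟨x, y, hxy⟩ := hne
    refine ⟨b * x - a * y, p * x + q * y, ?_⟩
    rw [quarticForm_substCoeff]
    push_cast
    rwa [show (q * (b * x - a * y) + a * (p * x + q * y) : ℝ) = x by linear_combination x * hpq',
      show (-p * (b * x - a * y) + b * (p * x + q * y) : ℝ) = y by linear_combination y * hpq']
  convert! hf'.sparseSet_of_c04_eq_zero h04 hne' using 1
  ext n
  constructor
  · rintro ⟨x, y, rfl⟩
    refine ⟨b * x - a * y, p * x + q * y, ?_⟩
    rw [show q * (b * x - a * y) + a * (p * x + q * y) = x by linear_combination x * hpq,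
      show -p * (b * x - a * y) + b * (p * x + q * y) = y by linear_combination y * hpq]
  · rintro ⟨x, y, rfl⟩
    exact ⟨_, _, rfl⟩

/-! ### Integer points near asymptotes of irrational slope -/

/-- Inhomogeneous Diophantine approximation. -/
lemma Irrational.exists_inhomogeneous_approx {θ : ℝ} (hθ : Irrational θ) (γ : ℝ) (N : ℕ) :
    ∃ x y : ℤ, (N : ℤ) ≤ y ∧ 0 < y ∧ |x - θ * y - γ| * y ≤ 5 := by
  -- Rationals of denominator at most `N` stay at distance `ε` from `θ`, so a finer approximation
  -- has denominator above `N`.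
  obtain ⟨ε, hε, hε0⟩ := ((hθ.eventually_forall_le_dist_cast_rat_of_den_le N).filter_mono
    (nhdsWithin_le_nhds (s := Set.Ioi (0 : ℝ)))).and self_mem_nhdsWithin |>.exists
  obtain ⟨M, hM⟩ := exists_nat_gt (1 / ε)
  have hε0' : 0 < ε := hε0
  have hM0 : (0 : ℝ) < M := (by positivity : 0 < 1 / ε).trans hM
  obtain ⟨r, hr, hrM⟩ := Real.exists_rat_abs_sub_le_and_den_le θ (Nat.cast_pos.1 hM0)
  have hden : (0 : ℝ) < r.den := by exact_mod_cast r.den_pos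
  have hden1 : (1 : ℝ) ≤ r.den := by exact_mod_cast r.den_pos
  have hrN : N < r.den := by
    by_contra! h
    have h1 := hε r h
    rw [Real.dist_eq] at h1
    have h2 : 1 / (((M : ℝ) + 1) * r.den) < ε := by
      rw [div_lt_iff₀ (by positivity)]
      rw [div_lt_iff₀ hε0'] at hM
      nlinarith
    linarith
  have hr2 : |θ - r| ≤ 1 / (r.den : ℝ) ^ 2 := by
    refine hr.trans (one_div_le_one_div_of_le (by positivity) ?_)
    rw [sq]
    refine mul_le_mul_of_nonneg_right ?_ hden.le
    have : (r.den : ℝ) ≤ M := by exact_mod_cast hrM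
    linarith
  obtain ⟨q, hq⟩ : ∃ q : ℤ, q = (r.den : ℤ) := ⟨_, rfl⟩
  have hq0 : 0 < q := by rw [hq]; exact_mod_cast r.den_pos
  have hqR : (q : ℝ) = r.den := by rw [hq, Int.cast_natCast]
  obtain ⟨a, b, hab⟩ : IsCoprime r.num q := by
    rw [Int.isCoprime_iff_gcd_eq_one, hq, Int.gcd, Int.natAbs_natCast]
    exact r.reduced
  -- With `r = p/q`, solving `q x - p y = g` gives `x - θ y - γ = (g - γ q)/q - (θ - r) y`. The two
  -- terms are at most `1/(2q)` and `2/q` when `y ≤ 2q`, whence the constant 5.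
  set g : ℤ := round (γ * q) with hg
  set t : ℤ := (-(g * a)) / q with ht
  -- `q x - p y = g` with `q ≤ y < 2 q`
  refine ⟨g * b - r.num * (t - 1), -(g * a) - q * (t - 1), ?_, ?_, ?_⟩
  · have := Int.emod_nonneg (-(g * a)) hq0.ne'
    have h2 := Int.mul_ediv_add_emod (-(g * a)) q
    rw [← ht] at h2
    have : (N : ℤ) < q := by rw [hq]; exact_mod_cast hrN
    linarith [mul_sub q t 1]
  · have := Int.emod_nonneg (-(g * a)) hq0.ne'
    have h2 := Int.mul_ediv_add_emod (-(g * a)) q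
    rw [← ht] at h2
    linarith [mul_sub q t 1]
  · have hlt := Int.emod_lt_of_pos (-(g * a)) hq0
    have hge := Int.emod_nonneg (-(g * a)) hq0.ne'
    have h2 := Int.mul_ediv_add_emod (-(g * a)) q
    rw [← ht] at h2
    obtain ⟨y, hy⟩ : ∃ y : ℤ, y = -(g * a) - q * (t - 1) := ⟨_, rfl⟩
    obtain ⟨x, hx⟩ : ∃ x : ℤ, x = g * b - r.num * (t - 1) := ⟨_, rfl⟩
    rw [← hx, ← hy]
    have hy2 : y ≤ 2 * q := by rw [hy]; linarith [mul_sub q t 1]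
    have hy0 : 0 < y := by rw [hy]; linarith [mul_sub q t 1]
    have hxy : q * x - r.num * y = g := by rw [hx, hy]; linear_combination g * hab
    have hy2' : (y : ℝ) ≤ 2 * q := by exact_mod_cast hy2
    have hy0' : (0 : ℝ) < y := by exact_mod_cast hy0
    have hq0' : (0 : ℝ) < q := by exact_mod_cast hq0
    have hxy' : (q : ℝ) * x - q * r * y = g := by
      have : (q : ℝ) * r = r.num := by
        rw [hqR]
        exact_mod_cast Rat.den_mul_eq_num r
      rw [this]
      exact_mod_cast hxy
    have e1 : (x : ℝ) - θ * y - γ = (g - γ * q) / q - (θ - r) * y := by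
      rw [← hxy']
      field_simp
      ring
    have e2 : |(g - γ * q) / q| ≤ 1 / 2 / q := by
      rw [abs_div, abs_of_pos hq0', abs_sub_comm]
      exact div_le_div_of_nonneg_right (abs_sub_round _) hq0'.le
    have e3 : |(θ - r) * y| ≤ 2 / q := by
      rw [abs_mul, abs_of_pos hy0']
      calc |θ - r| * y ≤ 1 / (q : ℝ) ^ 2 * (2 * q) := by
            rw [hqR] at *
            gcongr
        _ = 2 / q := by field_simp
    have e4 : |(x : ℝ) - θ * y - γ| ≤ 5 / 2 / q := by
      rw [e1]
      refine (abs_sub _ _).trans ?_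
      calc _ ≤ 1 / 2 / (q : ℝ) + 2 / q := add_le_add e2 e3
        _ = 5 / 2 / q := by ring
    calc |(x : ℝ) - θ * y - γ| * y ≤ 5 / 2 / q * (2 * q) := by gcongr
      _ = 5 := by field_simp

/-- Integer points far out along an asymptote of the conic `x² + b x y + d y² + l₁ x + l₀ y`. -/
lemma Irrational.exists_near_asymptote {θ b d : ℝ} (hθ : Irrational θ)
    (hroot : θ ^ 2 + b * θ + d = 0) (hs : 2 * θ + b ≠ 0) (l₁ l₀ : ℝ) :
    ∃ K : ℝ, ∀ N : ℕ, ∃ x y : ℤ, (N : ℤ) ≤ y ∧ 0 < y ∧ |(x : ℝ) - θ * y| ≤ K ∧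
      |(x : ℝ) ^ 2 + b * x * y + d * y ^ 2 + l₁ * x + l₀ * y| ≤ K := by
  set s := 2 * θ + b with hsdef
  -- The asymptote is `x = θ y + γ`: this `γ` cancels the term linear in `y` when the conic is
  -- restricted to that line.
  set γ := -(l₁ * θ + l₀) / s with hγ
  have hsγ : s * γ = -(l₁ * θ + l₀) := mul_div_cancel₀ _ hs
  set L := |γ| + 5 with hL
  have hL0 : 0 ≤ L := by positivity
  refine ⟨L + (L ^ 2 + |l₁| * L + 5 * |s|), fun N => ?_⟩
  obtain ⟨x, y, hNy, hy, h⟩ := hθ.exists_inhomogeneous_approx γ N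
  have hy1 : (1 : ℝ) ≤ y := by exact_mod_cast hy
  obtain ⟨δ, hδ⟩ : ∃ δ : ℝ, δ = x - θ * y - γ := ⟨_, rfl⟩
  rw [← hδ] at h
  have hδ5 : |δ| ≤ 5 := (le_mul_of_one_le_right (abs_nonneg _) hy1).trans h
  have hw : (x : ℝ) - θ * y = γ + δ := by rw [hδ]; ring
  have hwL : |γ + δ| ≤ L := (abs_add_le _ _).trans (by linarith)
  refine ⟨x, y, hNy, hy, ?_, ?_⟩
  · rw [hw]
    have : 0 ≤ L ^ 2 + |l₁| * L + 5 * |s| := by positivity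
    linarith
  · have hx : (x : ℝ) = θ * y + (γ + δ) := by linarith
    have e : (x : ℝ) ^ 2 + b * x * y + d * y ^ 2 + l₁ * x + l₀ * y =
        (γ + δ) ^ 2 + l₁ * (γ + δ) + s * (δ * y) := by
      rw [hx]
      linear_combination (y : ℝ) ^ 2 * hroot + (y : ℝ) * hsγ - (y : ℝ) * (γ + δ) * hsdef
    rw [e]
    refine (abs_add_three _ _ _).trans ?_
    rw [abs_pow, abs_mul, abs_mul, abs_mul, abs_of_pos (by linarith : (0 : ℝ) < y)]
    have h1 : |γ + δ| ^ 2 ≤ L ^ 2 := by gcongr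
    have h2 : |l₁| * |γ + δ| ≤ |l₁| * L := by gcongr
    have h3 : |s| * (|δ| * y) ≤ |s| * 5 := by gcongr
    linarith

open Filter Topology in
/-- If `Q(z) + G(x, y)` is nonnegative on points with `z` bounded tending to infinity in the
direction `(θ, 1)`, then the leading homogeneous part of `G` is nonnegative there. -/
lemma nonneg_leading_of_near_asymptote {θ κ lam K g₃₀ g₂₁ g₁₂ g₀₃ g₂₀ g₁₁ g₀₂ g₁₀ g₀₁ g₀₀ : ℝ}
    {z : ℤ → ℤ → ℝ}
    (hpts : ∀ N : ℕ, ∃ x y : ℤ, (N : ℤ) ≤ y ∧ 0 < y ∧ |(x : ℝ) - θ * y| ≤ K ∧ |z x y| ≤ K)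
    (h : ∀ x y : ℤ, 0 ≤ κ * z x y ^ 2 + lam * z x y + (g₃₀ * (x : ℝ) ^ 3 + g₂₁ * (x : ℝ) ^ 2 * y +
      g₁₂ * x * (y : ℝ) ^ 2 + g₀₃ * (y : ℝ) ^ 3 + g₂₀ * (x : ℝ) ^ 2 + g₁₁ * x * y +
      g₀₂ * (y : ℝ) ^ 2 + g₁₀ * x + g₀₁ * y + g₀₀)) :
    0 ≤ g₃₀ * θ ^ 3 + g₂₁ * θ ^ 2 + g₁₂ * θ + g₀₃ ∧
    (g₃₀ = 0 → g₂₁ = 0 → g₁₂ = 0 → g₀₃ = 0 → 0 ≤ g₂₀ * θ ^ 2 + g₁₁ * θ + g₀₂ ∧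
      (g₂₀ = 0 → g₁₁ = 0 → g₀₂ = 0 → 0 ≤ g₁₀ * θ + g₀₁)) := by
  choose x y hN hy hx hz using hpts
  have hyR : ∀ n, (0 : ℝ) < y n := fun n => by exact_mod_cast hy n
  have hyt : Tendsto (fun n => (y n : ℝ)) atTop atTop := by
    refine tendsto_atTop_mono (fun n => ?_) tendsto_natCast_atTop_atTop
    exact_mod_cast hN n
  have hu : Tendsto (fun n => (y n : ℝ)⁻¹) atTop (𝓝 0) := tendsto_inv_atTop_zero.comp hyt
  have hr : Tendsto (fun n => (x n : ℝ) * (y n : ℝ)⁻¹) atTop (𝓝 θ) := by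
    have h1 : Tendsto (fun n => ((x n : ℝ) - θ * y n) * (y n : ℝ)⁻¹) atTop (𝓝 0) :=
      bdd_le_mul_tendsto_zero' K (Eventually.of_forall hx) hu
    have h2 := h1.add_const θ
    rw [zero_add] at h2
    refine h2.congr fun n => ?_
    have := (hyR n).ne'
    field_simp
    ring
  obtain ⟨H, hH⟩ : ∃ H : ℕ → ℝ, H = fun n => κ * z (x n) (y n) ^ 2 + lam * z (x n) (y n) := ⟨_, rfl⟩
  have hHu : Tendsto (fun n => H n * (y n : ℝ)⁻¹) atTop (𝓝 0) := by
    refine bdd_le_mul_tendsto_zero' (|κ| * K ^ 2 + |lam| * K) (Eventually.of_forall fun n => ?_) hu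
    rw [hH]
    refine (abs_add_le _ _).trans ?_
    rw [abs_mul, abs_mul, abs_pow]
    have := hz n
    gcongr
  have hpos : ∀ n, 0 ≤ H n + (g₃₀ * (x n : ℝ) ^ 3 + g₂₁ * (x n : ℝ) ^ 2 * y n +
      g₁₂ * x n * (y n : ℝ) ^ 2 + g₀₃ * (y n : ℝ) ^ 3 + g₂₀ * (x n : ℝ) ^ 2 + g₁₁ * x n * y n +
      g₀₂ * (y n : ℝ) ^ 2 + g₁₀ * x n + g₀₁ * y n + g₀₀) := by
    intro n
    rw [hH]
    exact h _ _
  -- After division by a power of `y`, each expression below is continuous in `(H/y, x/y, 1/y)`,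
  -- whose limit leaves only the leading form at `θ`.
  have hlim : Tendsto (fun n => ((H n * (y n : ℝ)⁻¹), ((x n : ℝ) * (y n : ℝ)⁻¹), (y n : ℝ)⁻¹)) atTop
      (𝓝 (0, θ, 0)) := hHu.prodMk_nhds (hr.prodMk_nhds hu)
  refine ⟨?_, fun h30 h21 h12 h03 => ⟨?_, fun h20 h11 h02 => ?_⟩⟩
  · have hc : Continuous fun p : ℝ × ℝ × ℝ => p.1 * p.2.2 ^ 2 + (g₃₀ * p.2.1 ^ 3 + g₂₁ * p.2.1 ^ 2 +
      g₁₂ * p.2.1 + g₀₃ + (g₂₀ * p.2.1 ^ 2 + g₁₁ * p.2.1 + g₀₂) * p.2.2 +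
      (g₁₀ * p.2.1 + g₀₁) * p.2.2 ^ 2 + g₀₀ * p.2.2 ^ 3) := by fun_prop
    have h1 := ge_of_tendsto' ((hc.tendsto _).comp hlim) (b := 0) fun n => by
      have h2 : 0 < (y n : ℝ)⁻¹ := inv_pos.2 (hyR n)
      have h3 := mul_nonneg (hpos n) (pow_pos h2 3).le
      refine h3.trans_eq ?_
      simp only [Function.comp_apply]
      have := (hyR n).ne'
      field_simp
      ring
    simpa using h1
  · have hc : Continuous fun p : ℝ × ℝ × ℝ => p.1 * p.2.2 + (g₂₀ * p.2.1 ^ 2 + g₁₁ * p.2.1 + g₀₂ +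
      (g₁₀ * p.2.1 + g₀₁) * p.2.2 + g₀₀ * p.2.2 ^ 2) := by fun_prop
    have h1 := ge_of_tendsto' ((hc.tendsto _).comp hlim) (b := 0) fun n => by
      have h2 : 0 < (y n : ℝ)⁻¹ := inv_pos.2 (hyR n)
      have h3 := mul_nonneg (hpos n) (pow_pos h2 2).le
      refine h3.trans_eq ?_
      simp only [Function.comp_apply, h30, h21, h12, h03]
      have := (hyR n).ne'
      field_simp
      ring
    simpa using h1
  · have hc : Continuous fun p : ℝ × ℝ × ℝ => p.1 + (g₁₀ * p.2.1 + g₀₁ + g₀₀ * p.2.2) := by fun_prop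
    have h1 := ge_of_tendsto' ((hc.tendsto _).comp hlim) (b := 0) fun n => by
      have h2 : 0 < (y n : ℝ)⁻¹ := inv_pos.2 (hyR n)
      have h3 := mul_nonneg (hpos n) h2.le
      refine h3.trans_eq ?_
      simp only [Function.comp_apply, h30, h21, h12, h03, h20, h11, h02]
      have := (hyR n).ne'
      field_simp
      ring
    simpa using h1

/-- Consequences of nonnegativity of `κ z² + lam z + G` on `ℤ²`, where `z = 0` is a conic with an
asymptote of irrational slope. -/
lemma Irrational.leading_of_nonneg {θ b d l₁ l₀ κ lam g₃₀ g₂₁ g₁₂ g₀₃ g₂₀ g₁₁ g₀₂ g₁₀ g₀₁ g₀₀ : ℝ}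
    (hθ : Irrational θ) (hroot : θ ^ 2 + b * θ + d = 0) (hs : 2 * θ + b ≠ 0)
    (h : ∀ x y : ℤ, 0 ≤ κ * ((x : ℝ) ^ 2 + b * x * y + d * y ^ 2 + l₁ * x + l₀ * y) ^ 2 +
      lam * ((x : ℝ) ^ 2 + b * x * y + d * y ^ 2 + l₁ * x + l₀ * y) +
      (g₃₀ * (x : ℝ) ^ 3 + g₂₁ * (x : ℝ) ^ 2 * y +
      g₁₂ * x * (y : ℝ) ^ 2 + g₀₃ * (y : ℝ) ^ 3 + g₂₀ * (x : ℝ) ^ 2 + g₁₁ * x * y +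
      g₀₂ * (y : ℝ) ^ 2 + g₁₀ * x + g₀₁ * y + g₀₀)) :
    g₃₀ * θ ^ 3 + g₂₁ * θ ^ 2 + g₁₂ * θ + g₀₃ = 0 ∧
    (g₃₀ = 0 → g₂₁ = 0 → g₁₂ = 0 → g₀₃ = 0 → 0 ≤ g₂₀ * θ ^ 2 + g₁₁ * θ + g₀₂ ∧
      (g₂₀ = 0 → g₁₁ = 0 → g₀₂ = 0 → g₁₀ * θ + g₀₁ = 0)) := by
  obtain ⟨K, hK⟩ := hθ.exists_near_asymptote hroot hs l₁ l₀
  -- The reflection `(x, y) ↦ (-x, -y)` gives the opposite inequality for the odd-degree forms,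
  -- which therefore vanish at `θ`.
  obtain ⟨K', hK'⟩ := hθ.exists_near_asymptote hroot hs (-l₁) (-l₀)
  have h1 := nonneg_leading_of_near_asymptote
    (z := fun x y => (x : ℝ) ^ 2 + b * x * y + d * y ^ 2 + l₁ * x + l₀ * y) hK h
  have h2 := nonneg_leading_of_near_asymptote (κ := κ) (lam := lam)
    (z := fun x y => (x : ℝ) ^ 2 + b * x * y + d * y ^ 2 + -l₁ * x + -l₀ * y)
    (g₃₀ := -g₃₀) (g₂₁ := -g₂₁) (g₁₂ := -g₁₂) (g₀₃ := -g₀₃) (g₂₀ := g₂₀) (g₁₁ := g₁₁) (g₀₂ := g₀₂)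
    (g₁₀ := -g₁₀) (g₀₁ := -g₀₁) (g₀₀ := g₀₀) hK' (fun x y => by
      have h3 := h (-x) (-y)
      push_cast at h3
      refine h3.trans_eq ?_
      ring)
  refine ⟨by linarith [h1.1, h2.1], fun h30 h21 h12 h03 => ?_⟩
  obtain ⟨h3, h4⟩ := h1.2 h30 h21 h12 h03
  obtain ⟨-, h5⟩ := h2.2 (by simp [h30]) (by simp [h21]) (by simp [h12]) (by simp [h03])
  exact ⟨h3, fun h20 h11 h02 => by linarith [h4 h20 h11 h02, h5 h20 h11 h02]⟩

/-! ### Top form with an irrational zero -/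

open Polynomial in
/-- A nonnegative rational quartic form with an irrational zero is a multiple of a square. -/
lemma exists_eq_mul_sq_of_irrational_zero {c : ℕ → ℕ → ℚ} {θ : ℝ} (hθ : Irrational θ)
    (hnn : ∀ x y, 0 ≤ quarticForm c x y) (h0 : quarticForm c θ 1 = 0)
    (hne : ∃ x y : ℝ, quarticForm c x y ≠ 0) :
    ∃ κ b d : ℚ, 0 < κ ∧ θ ^ 2 + b * θ + d = 0 ∧ c 4 0 = κ ∧ c 3 1 = 2 * κ * b ∧
      c 2 2 = κ * (b ^ 2 + 2 * d) ∧ c 1 3 = 2 * κ * b * d ∧ c 0 4 = κ * d ^ 2 := by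
  set P : ℚ[X] := C (c 4 0) * X ^ 4 + C (c 3 1) * X ^ 3 + C (c 2 2) * X ^ 2 + C (c 1 3) * X + C (c 0 4)
    with hP
  have haeval : ∀ t : ℝ, aeval t P = quarticForm c t 1 := by
    intro t
    simp [hP, quarticForm]
  have hroot : aeval θ P = 0 := by rw [haeval, h0]
  have hP0 : P ≠ 0 := by
    intro h
    obtain ⟨x, y, hxy⟩ := hne
    have hz : ∀ t : ℚ, c 4 0 * t ^ 4 + c 3 1 * t ^ 3 + c 2 2 * t ^ 2 + c 1 3 * t + c 0 4 = 0 := by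
      intro t
      have := congrArg (Polynomial.eval t) h
      simpa [hP] using this
    have e0 := hz 0
    have e1 := hz 1
    have e2 := hz (-1)
    have e3 := hz 2
    have e4 := hz (-2)
    have f04 : c 0 4 = 0 := by linarith
    have f22 : c 2 2 = 0 := by linarith
    have f40 : c 4 0 = 0 := by linarith
    have f13 : c 1 3 = 0 := by linarith
    have f31 : c 3 1 = 0 := by linarith
    simp [quarticForm, f04, f22, f40, f13, f31] at hxy
  have halg : IsAlgebraic ℚ θ := ⟨P, hP0, hroot⟩
  have hint : IsIntegral ℚ θ := halg.isIntegral
  -- A zero of a nonnegative polynomial is a minimum, hence a multiple root. As the minimal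
  -- polynomial is separable, its square divides `P`; being of degree at least 2, it leaves only a
  -- constant cofactor.
  have hder : aeval θ (derivative P) = 0 := by
    have hmin : IsLocalMin (fun t : ℝ => aeval t P) θ := by
      refine Filter.Eventually.of_forall fun t => ?_
      change aeval θ P ≤ aeval t P
      rw [hroot, haeval]
      exact hnn t 1
    have h1 := hmin.deriv_eq_zero
    rwa [Polynomial.deriv_aeval] at h1
  set q := minpoly ℚ θ with hq
  obtain ⟨g, hg⟩ := minpoly.dvd ℚ θ hroot
  have hsep : (minpoly ℚ θ).Separable := (minpoly.irreducible hint).separable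
  have hg0 : aeval θ g = 0 := by
    rw [hg, derivative_mul, map_add, map_mul, map_mul, minpoly.aeval, zero_mul, add_zero] at hder
    exact (mul_eq_zero.1 hder).resolve_left (hsep.aeval_derivative_ne_zero (minpoly.aeval ℚ θ))
  obtain ⟨k, hk⟩ := minpoly.dvd ℚ θ hg0
  rw [hk, ← mul_assoc, ← hq] at hg
  have hk0 : k ≠ 0 := by
    rintro rfl
    rw [mul_zero] at hg
    exact hP0 hg
  have hqm : q.Monic := minpoly.monic hint
  have hdeg2 : 2 ≤ q.natDegree := by
    rw [hq, minpoly.two_le_natDegree_iff hint]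
    rintro ⟨r, hr⟩
    exact hθ ⟨r, by simpa using hr⟩
  have hPdeg : P.natDegree ≤ 4 := by rw [hP]; compute_degree
  have hdeg : q.natDegree + q.natDegree + k.natDegree ≤ 4 := by
    rw [← natDegree_mul hqm.ne_zero hqm.ne_zero, ← natDegree_mul (mul_ne_zero hqm.ne_zero hqm.ne_zero) hk0, ← hg]
    exact hPdeg
  have hq2 : q.natDegree = 2 := by omega
  have hkdeg : k.natDegree = 0 := by omega
  obtain ⟨κ, rfl⟩ := natDegree_eq_zero.1 hkdeg
  set b := q.coeff 1 with hb
  set d := q.coeff 0 with hd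
  have hqe : q = X ^ 2 + C b * X + C d := by
    rw [hqm.as_sum, hq2, Finset.sum_range_succ, Finset.sum_range_one, ← hb, ← hd]
    simp only [pow_zero, pow_one, mul_one]
    ring
  have heq : ∀ t : ℚ, c 4 0 * t ^ 4 + c 3 1 * t ^ 3 + c 2 2 * t ^ 2 + c 1 3 * t + c 0 4 =
      κ * (t ^ 2 + b * t + d) ^ 2 := by
    intro t
    have := congrArg (Polynomial.eval t) hg
    rw [hqe] at this
    simp [hP] at this
    rw [this]
    ring
  have e0 := heq 0
  have e1 := heq 1
  have e2 := heq (-1)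
  have e3 := heq 2
  have e4 := heq (-2)
  have f04 : c 0 4 = κ * d ^ 2 := by linear_combination e0
  have f40 : c 4 0 = κ := by linarith
  have f22 : c 2 2 = κ * (b ^ 2 + 2 * d) := by linarith
  have f31 : c 3 1 = 2 * κ * b := by linarith
  have f13 : c 1 3 = 2 * κ * b * d := by linarith
  refine ⟨κ, b, d, ?_, ?_, f40, f31, f22, f13, f04⟩
  · have h1 := hnn 1 0
    simp [quarticForm, f40] at h1
    refine lt_of_le_of_ne h1 fun h => hk0 ?_
    rw [← h, map_zero]
  · have h1 := minpoly.aeval ℚ θ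
    rw [← hq, hqe] at h1
    simpa using h1

lemma Irrational.eq_zero_of_linear {θ : ℝ} (hθ : Irrational θ) {e₁ e₀ : ℚ}
    (h : (e₁ : ℝ) * θ + e₀ = 0) : e₁ = 0 ∧ e₀ = 0 := by
  have h1 : e₁ = 0 := by
    by_contra h1
    have h1' : (e₁ : ℝ) ≠ 0 := by exact_mod_cast h1
    refine hθ ⟨-e₀ / e₁, ?_⟩
    push_cast
    field_simp
    linarith
  rw [h1, Rat.cast_zero, zero_mul, zero_add] at h
  exact ⟨h1, by exact_mod_cast h⟩

/-- A quartic whose top form has an irrational zero. -/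
lemma IsQuarticFun.sparseSet_of_irrational_zero {c : ℕ → ℕ → ℚ} {f : ℤ → ℤ → ℕ}
    (hf : IsQuarticFun c f) {θ : ℝ} (hθ : Irrational θ) (h0 : quarticForm c θ 1 = 0)
    (hne : ∃ x y : ℝ, quarticForm c x y ≠ 0) :
    SparseSet {n | ∃ x y, f x y = n} := by
  obtain ⟨κ, b, d, hκ, hroot, f40, f31, f22, f13, f04⟩ :=
    exists_eq_mul_sq_of_irrational_zero hθ hf.quarticForm_nonneg h0 hne
  have hκ' : (0 : ℝ) < κ := by exact_mod_cast hκ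
  have hs : 2 * θ + b ≠ 0 := by
    intro h
    have := (hθ.eq_zero_of_linear (e₁ := 2) (e₀ := b) (by push_cast; exact h)).1
    norm_num at this
  -- the conjugate root
  obtain ⟨θ', hθ'⟩ : ∃ θ' : ℝ, θ' = -b - θ := ⟨_, rfl⟩
  have hirr' : Irrational θ' := by
    rw [hθ', ← Rat.cast_neg]
    exact hθ.ratCast_sub _
  have hroot' : θ' ^ 2 + b * θ' + d = 0 := by rw [hθ']; linear_combination hroot
  have hs' : 2 * θ' + b ≠ 0 := by
    rw [hθ']
    intro h
    exact hs (by linarith)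
  have hpos : ∀ x y : ℤ, (0 : ℝ) ≤ f x y := fun x y => Nat.cast_nonneg _
  -- divisibility of the cubic form
  have hcub : ∃ l₁ l₀ : ℚ, c 3 0 = 2 * κ * l₁ ∧ c 2 1 = 2 * κ * (l₀ + b * l₁) ∧
      c 1 2 = 2 * κ * (b * l₀ + d * l₁) ∧ c 0 3 = 2 * κ * (d * l₀) := by
    -- The cubic form vanishes at `θ`, so its remainder modulo the quadratic, a rational linear
    -- polynomial with an irrational root, is zero.
    have h1 := (hθ.leading_of_nonneg (κ := κ) (lam := 0) (l₁ := 0) (l₀ := 0) (g₃₀ := c 3 0)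
      (g₂₁ := c 2 1) (g₁₂ := c 1 2) (g₀₃ := c 0 3) (g₂₀ := c 2 0) (g₁₁ := c 1 1) (g₀₂ := c 0 2)
      (g₁₀ := c 1 0) (g₀₁ := c 0 1) (g₀₀ := c 0 0) hroot hs (fun x y => by
        refine (hpos x y).trans_eq ?_
        rw [hf]
        simp only [quarticEval, quarticForm, cubicPart, f40, f31, f22, f13, f04]
        push_cast
        ring)).1
    have h2 := hθ.eq_zero_of_linear (e₁ := c 1 2 - c 3 0 * d - b * (c 2 1 - c 3 0 * b))
      (e₀ := c 0 3 - d * (c 2 1 - c 3 0 * b)) (by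
        push_cast
        linear_combination h1 - (c 3 0 * θ + (c 2 1 - c 3 0 * b)) * hroot)
    refine ⟨c 3 0 / (2 * κ), (c 2 1 - c 3 0 * b) / (2 * κ), ?_, ?_, ?_, ?_⟩
    · field_simp
    · field_simp
      ring
    · field_simp
      linarith [h2.1]
    · field_simp
      linarith [h2.2]
  obtain ⟨l₁, l₀, f30, f21, f12, f03⟩ := hcub
  obtain ⟨z, hz⟩ : ∃ z : ℤ → ℤ → ℝ,
      z = fun (x y : ℤ) => (x : ℝ) ^ 2 + b * x * y + d * y ^ 2 + l₁ * x + l₀ * y := ⟨_, rfl⟩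
  set r₂₀ := c 2 0 - κ * l₁ ^ 2 with hr20
  set r₁₁ := c 1 1 - 2 * κ * l₁ * l₀ with hr11
  set r₀₂ := c 0 2 - κ * l₀ ^ 2 with hr02
  have hF : ∀ x y : ℤ, (f x y : ℝ) = κ * z x y ^ 2 + (r₂₀ * x ^ 2 + r₁₁ * x * y + r₀₂ * y ^ 2 +
      c 1 0 * x + c 0 1 * y + c 0 0) := by
    intro x y
    rw [hf, hz, hr20, hr11, hr02]
    simp only [quarticEval, quarticForm, cubicPart, f40, f31, f22, f13, f04, f30, f21, f12, f03]
    push_cast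
    ring
  have hlead : ∀ t : ℝ, Irrational t → t ^ 2 + b * t + d = 0 → 2 * t + b ≠ 0 →
      0 ≤ r₂₀ * t ^ 2 + r₁₁ * t + r₀₂ := by
    intro t h1 h2 h3
    refine ((h1.leading_of_nonneg (κ := κ) (lam := 0) (l₁ := l₁) (l₀ := l₀) (g₃₀ := 0)
      (g₂₁ := 0) (g₁₂ := 0) (g₀₃ := 0) (g₂₀ := r₂₀) (g₁₁ := r₁₁) (g₀₂ := r₀₂)
      (g₁₀ := c 1 0) (g₀₁ := c 0 1) (g₀₀ := c 0 0) h2 h3 (fun x y => ?_)).2 rfl rfl rfl rfl).1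
    refine (hpos x y).trans_eq ?_
    rw [hF, hz]
    ring
  have hR := hlead θ hθ hroot hs
  have hR' := hlead θ' hirr' hroot' hs'
  -- Whether the remaining quadratic form is a multiple of the leading part of `z`. If so, the
  -- leftover linear form vanishes at `θ` and hence identically.
  by_cases hdiv : r₁₁ = b * r₂₀ ∧ r₀₂ = d * r₂₀
  · -- `f` is a quadratic polynomial in `z`
    obtain ⟨h11, h02⟩ := hdiv
    have h1 := ((hθ.leading_of_nonneg (κ := κ) (lam := r₂₀) (l₁ := l₁) (l₀ := l₀) (g₃₀ := 0)
      (g₂₁ := 0) (g₁₂ := 0) (g₀₃ := 0) (g₂₀ := 0) (g₁₁ := 0) (g₀₂ := 0)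
      (g₁₀ := c 1 0 - r₂₀ * l₁) (g₀₁ := c 0 1 - r₂₀ * l₀) (g₀₀ := c 0 0) hroot hs (fun x y => by
        refine (hpos x y).trans_eq ?_
        rw [hF, hz, h11, h02]
        push_cast
        ring)).2 rfl rfl rfl rfl).2 rfl rfl rfl
    obtain ⟨h10, h01⟩ := hθ.eq_zero_of_linear (e₁ := c 1 0 - r₂₀ * l₁) (e₀ := c 0 1 - r₂₀ * l₀)
      (by push_cast; exact h1)
    have h10' : c 1 0 = r₂₀ * l₁ := by linarith
    have h01' : c 0 1 = r₂₀ * l₀ := by linarith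
    set M : ℕ := b.den * d.den * l₁.den * l₀.den with hM
    have hM0 : (0 : ℝ) < M := by
      rw [hM]
      exact_mod_cast Nat.mul_pos (Nat.mul_pos (Nat.mul_pos b.den_pos d.den_pos) l₁.den_pos) l₀.den_pos
    refine sparseSet_of_quadratic (p := κ / (M : ℝ) ^ 2) (q := r₂₀ / M) (s := c 0 0)
      (by positivity) ?_
    rintro n ⟨x, y, rfl⟩
    refine ⟨M * x ^ 2 + b.num * d.den * l₁.den * l₀.den * x * y
      + b.den * d.num * l₁.den * l₀.den * y ^ 2 + b.den * d.den * l₁.num * l₀.den * x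
      + b.den * d.den * l₁.den * l₀.num * y, ?_⟩
    have hnum : ∀ r : ℚ, (r.num : ℝ) = r.den * r := fun r => by
      exact_mod_cast (Rat.den_mul_eq_num r).symm
    have hw : ((M * x ^ 2 + b.num * d.den * l₁.den * l₀.den * x * y
      + b.den * d.num * l₁.den * l₀.den * y ^ 2 + b.den * d.den * l₁.num * l₀.den * x
      + b.den * d.den * l₁.den * l₀.num * y : ℤ) : ℝ) = M * z x y := by
      push_cast
      rw [hnum, hnum, hnum, hnum, hz, hM]
      push_cast
      ring
    rw [hw, hF, h11, h02, h10', h01']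
    have : (κ : ℝ) / (M : ℝ) ^ 2 * (M * z x y) ^ 2 + r₂₀ / M * (M * z x y) =
        κ * z x y ^ 2 + r₂₀ * z x y := by
      field_simp
    rw [this, hz]
    push_cast
    ring
  -- the quadratic part is positive on both asymptotes
  have hsne : (0 : ℝ) < (2 * θ + b) ^ 2 := by positivity
  have hne1 : ∀ t : ℝ, Irrational t → t ^ 2 + b * t + d = 0 →
      r₂₀ * t ^ 2 + r₁₁ * t + r₀₂ ≠ 0 := by
    intro t h1 h2 h3
    have h4 := h1.eq_zero_of_linear (e₁ := r₁₁ - b * r₂₀) (e₀ := r₀₂ - d * r₂₀) (by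
      push_cast
      linear_combination h3 - r₂₀ * h2)
    exact hdiv ⟨by linarith [h4.1], by linarith [h4.2]⟩
  have hRpos := lt_of_le_of_ne hR (hne1 θ hθ hroot).symm
  have hRpos' := lt_of_le_of_ne hR' (hne1 θ' hirr' hroot').symm
  -- Coordinates of the quadratic form in the basis `(x - θ y)²`, `(x - θ' y)²`, `x² + b x y + d
  -- y²`. Evaluation at the conjugate roots gives `A` and `E`, both positive.
  obtain ⟨E, hE⟩ : ∃ E : ℝ, E = (r₂₀ * θ ^ 2 + r₁₁ * θ + r₀₂) / (2 * θ + b) ^ 2 := ⟨_, rfl⟩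
  obtain ⟨A, hA⟩ : ∃ A : ℝ, A = (r₂₀ * θ' ^ 2 + r₁₁ * θ' + r₀₂) / (2 * θ + b) ^ 2 := ⟨_, rfl⟩
  have hE0 : 0 < E := by rw [hE]; positivity
  have hA0 : 0 < A := by rw [hA]; positivity
  have hE' : E * (2 * θ + b) ^ 2 = r₂₀ * θ ^ 2 + r₁₁ * θ + r₀₂ := by rw [hE, div_mul_cancel₀ _ hsne.ne']
  have hA' : A * (2 * θ + b) ^ 2 = r₂₀ * θ' ^ 2 + r₁₁ * θ' + r₀₂ := by rw [hA, div_mul_cancel₀ _ hsne.ne']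
  obtain ⟨β, hβ⟩ : ∃ β : ℝ, β = r₂₀ - A - E := ⟨_, rfl⟩
  have hquad : ∀ x y : ℝ, r₂₀ * x ^ 2 + r₁₁ * x * y + r₀₂ * y ^ 2 =
      A * (x - θ * y) ^ 2 + E * (x - θ' * y) ^ 2 + β * (x ^ 2 + b * x * y + d * y ^ 2) := by
    intro x y
    have hd : (d : ℝ) = -θ ^ 2 - b * θ := by linear_combination hroot
    refine mul_left_cancel₀ hsne.ne' ?_
    rw [hβ, hd]
    rw [hθ'] at hA' ⊢
    linear_combination
      -((x - θ * y) ^ 2 - (x ^ 2 + b * x * y + (-θ ^ 2 - b * θ) * y ^ 2)) * hA' -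
        ((x - (-b - θ) * y) ^ 2 - (x ^ 2 + b * x * y + (-θ ^ 2 - b * θ) * y ^ 2)) * hE'
  obtain ⟨mu, hmu⟩ : ∃ mu : ℝ, mu = (-(c 1 0 - β * l₁) * θ' - (c 0 1 - β * l₀)) / (2 * θ + b) :=
    ⟨_, rfl⟩
  obtain ⟨mv, hmv⟩ : ∃ mv : ℝ, mv = ((c 1 0 - β * l₁) * θ + (c 0 1 - β * l₀)) / (2 * θ + b) :=
    ⟨_, rfl⟩
  have hmu' : mu * (2 * θ + b) = -(c 1 0 - β * l₁) * θ' - (c 0 1 - β * l₀) := by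
    rw [hmu, div_mul_cancel₀ _ hs]
  have hmv' : mv * (2 * θ + b) = (c 1 0 - β * l₁) * θ + (c 0 1 - β * l₀) := by
    rw [hmv, div_mul_cancel₀ _ hs]
  have hlin : ∀ x y : ℝ, (c 1 0 - β * l₁) * x + (c 0 1 - β * l₀) * y =
      mu * (x - θ * y) + mv * (x - θ' * y) := by
    intro x y
    refine mul_left_cancel₀ hs ?_
    rw [hθ'] at hmu' ⊢
    linear_combination -(x - θ * y) * hmu' - (x - (-b - θ) * y) * hmv'
  -- `K` collects the losses from absorbing the linear terms `β z`, `mu (x - θ y)`, `mv (x - θ' y)`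
  -- into half of their squares, and the constant term.
  obtain ⟨K, hK⟩ : ∃ K : ℝ, K = 1 + (β ^ 2 / (2 * κ) + mu ^ 2 / (2 * A) + mv ^ 2 / (2 * E) +
      |(c 0 0 : ℝ)|) := ⟨_, rfl⟩
  have hK1 : 1 ≤ K := by
    rw [hK]
    have : 0 ≤ β ^ 2 / (2 * κ) + mu ^ 2 / (2 * A) + mv ^ 2 / (2 * E) + |(c 0 0 : ℝ)| := by positivity
    linarith
  have hsquare : ∀ p m w : ℝ, 0 < p → p / 2 * w ^ 2 - m ^ 2 / (2 * p) ≤ p * w ^ 2 + m * w := by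
    intro p m w hp
    have : p * w ^ 2 + m * w - (p / 2 * w ^ 2 - m ^ 2 / (2 * p)) = (p * w + m) ^ 2 / (2 * p) := by
      field_simp
      ring
    have h2 : 0 ≤ (p * w + m) ^ 2 / (2 * p) := by positivity
    linarith
  have hcoer : ∀ x w : ℤ, ∀ y : ℝ, 1 ≤ y → (f x w : ℝ) ≤ y →
      κ / 2 * z x w ^ 2 + A / 2 * ((x : ℝ) - θ * w) ^ 2 + E / 2 * ((x : ℝ) - θ' * w) ^ 2 ≤ K * y := by
    intro x w y hy hfy
    have h1 := hsquare κ β (z x w) hκ'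
    have h2 := hsquare A mu ((x : ℝ) - θ * w) hA0
    have h3 := hsquare E mv ((x : ℝ) - θ' * w) hE0
    have h4 := hquad x w
    have h5 := hlin x w
    have h6 : (f x w : ℝ) = κ * z x w ^ 2 + β * z x w + A * ((x : ℝ) - θ * w) ^ 2 +
        E * ((x : ℝ) - θ' * w) ^ 2 + (mu * (x - θ * w) + mv * (x - θ' * w)) + c 0 0 := by
      rw [← h5, hF]
      have h7 : z x w = (x : ℝ) ^ 2 + b * x * w + d * w ^ 2 + l₁ * x + l₀ * w := by rw [hz]
      linear_combination h4 - β * h7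
    have h8 : K - 1 ≤ (K - 1) * y := le_mul_of_one_le_right (by linarith) hy
    have h9 := neg_abs_le (c 0 0 : ℝ)
    rw [h6] at hfy
    linarith
  obtain ⟨Z, hZ⟩ : ∃ Z : ℝ, Z = √(2 * K / κ) := ⟨_, rfl⟩
  obtain ⟨W, hW⟩ : ∃ W : ℝ, W = √((4 / A + 4 / E) * K / (2 * θ + b) ^ 2) := ⟨_, rfl⟩
  have hZ0 : 0 ≤ Z := by rw [hZ]; positivity
  have hW0 : 0 ≤ W := by rw [hW]; positivity
  have hbound : ∀ x w : ℤ, ∀ y : ℝ, 1 ≤ y → (f x w : ℝ) ≤ y →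
      |z x w| ≤ Z * √y ∧ |(w : ℝ)| ≤ W * √y := by
    intro x w y hy hfy
    have h1 := hcoer x w y hy hfy
    have e1 : 0 ≤ κ / 2 * z x w ^ 2 := by positivity
    have e2 : 0 ≤ A / 2 * ((x : ℝ) - θ * w) ^ 2 := by positivity
    have e3 : 0 ≤ E / 2 * ((x : ℝ) - θ' * w) ^ 2 := by positivity
    constructor
    · rw [hZ, ← Real.sqrt_mul (by positivity)]
      refine Real.abs_le_sqrt ?_
      rw [div_mul_eq_mul_div, le_div_iff₀ hκ']
      linarith
    · rw [hW, ← Real.sqrt_mul (by positivity)]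
      refine Real.abs_le_sqrt ?_
      rw [div_mul_eq_mul_div, le_div_iff₀ hsne]
      have h2 : ((x : ℝ) - θ * w) ^ 2 ≤ 2 / A * (K * y) := by
        rw [div_mul_eq_mul_div, le_div_iff₀ hA0]
        linarith
      have h3 : ((x : ℝ) - θ' * w) ^ 2 ≤ 2 / E * (K * y) := by
        rw [div_mul_eq_mul_div, le_div_iff₀ hE0]
        linarith
      have h4 : (w : ℝ) ^ 2 * (2 * θ + b) ^ 2 = (((x : ℝ) - θ' * w) - (x - θ * w)) ^ 2 := by
        rw [hθ']
        ring
      rw [h4]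
      have h5 : (4 / A + 4 / E) * K * y = 2 * (2 / A * (K * y)) + 2 * (2 / E * (K * y)) := by ring
      rw [h5]
      linarith [sq_nonneg (((x : ℝ) - θ' * w) + (x - θ * w)),
        show (((x : ℝ) - θ' * w) - (x - θ * w)) ^ 2 + (((x : ℝ) - θ' * w) + (x - θ * w)) ^ 2 =
          2 * ((x : ℝ) - θ' * w) ^ 2 + 2 * (x - θ * w) ^ 2 by ring]
  -- There are `O(√y)` values of `w`; for each, `z` is a monic quadratic in `x` of size `O(√y)`,
  -- leaving `O(y^(1/4))` values of `x`.
  refine sparseSet_of_card_le (C := (2 * W + 1) * (2 * √(2 * Z) + 2)) fun y hy T hT => ?_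
  have hsy : 1 ≤ √y := Real.one_le_sqrt.2 hy
  have hss : 1 ≤ √√y := Real.one_le_sqrt.2 hsy
  have hmain := Finset.card_le_of_fiber (T := T)
    (Q := fun w n => ∃ x : ℤ, |z x w| ≤ Z * √y ∧ f x w = n) (A := 0) (R := W * √y)
    (b := 2 * √(2 * (Z * √y) / 1) + 2) (by positivity) (by positivity) (fun n hn => by
      obtain ⟨-, hny, x, w, rfl⟩ := hT n hn
      obtain ⟨h1, h2⟩ := hbound x w y hy hny
      exact ⟨w, by rwa [sub_zero], x, h1, rfl⟩) (fun w T' _ hQ =>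
      Finset.card_le_of_forall_exists (P := fun x : ℤ => |z x w| ≤ Z * √y) (g := fun x => f x w)
        (fun I hI => Finset.card_int_le_of_abs_quadratic_le (r := b * w + l₁)
          (s := d * (w : ℝ) ^ 2 + l₀ * w) one_pos (by positivity) fun x hx => by
            have h1 := hI x hx
            rw [hz] at h1
            convert h1 using 2
            ring) hQ)
  have h1 : √(2 * (Z * √y) / 1) = √(2 * Z) * √√y := by
    rw [← Real.sqrt_mul (by positivity)]
    congr 1
    ring
  rw [h1] at hmain
  refine hmain.trans ?_
  calc (2 * (W * √y) + 1) * (2 * (√(2 * Z) * √√y) + 2)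
      ≤ ((2 * W + 1) * √y) * ((2 * √(2 * Z) + 2) * √√y) := by
        refine mul_le_mul (by linarith) (by linarith) (by positivity) (by positivity)
    _ = _ := by ring

/-! ### Assembly and translation to `MvPolynomial` -/

/-- The set of values of a quartic polynomial that maps `ℤ²` to `ℕ` is sparse. -/
theorem IsQuarticFun.sparseSet {c : ℕ → ℕ → ℚ} {f : ℤ → ℤ → ℕ} (hf : IsQuarticFun c f)
    (hne : ∃ x y : ℝ, quarticForm c x y ≠ 0) : SparseSet {n | ∃ x y, f x y = n} := by
  by_cases hpos : ∀ x y : ℝ, (x, y) ≠ 0 → 0 < quarticForm c x y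
  · exact hf.sparseSet_of_posDef hpos
  push Not at hpos
  obtain ⟨x, y, hxy, hle⟩ := hpos
  have h0 : quarticForm c x y = 0 := le_antisymm hle (hf.quarticForm_nonneg x y)
  rcases eq_or_ne y 0 with rfl | hy
  · have hx : x ≠ 0 := fun h => hxy (by rw [h]; rfl)
    refine hf.sparseSet_of_int_zero (a := 1) (b := 0) isCoprime_one_left ?_ hne
    have h1 := quarticForm_smul c x 1 0
    rw [mul_one, mul_zero, h0] at h1
    push_cast
    exact (mul_eq_zero.1 h1.symm).resolve_left (pow_ne_zero 4 hx)
  · have h1 : quarticForm c (x / y) 1 = 0 := by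
      have h2 := quarticForm_smul c y (x / y) 1
      rw [mul_div_cancel₀ _ hy, mul_one, h0] at h2
      exact (mul_eq_zero.1 h2.symm).resolve_left (pow_ne_zero 4 hy)
    by_cases hθ : Irrational (x / y)
    · exact hf.sparseSet_of_irrational_zero hθ h1 hne
    · obtain ⟨r, hr⟩ := not_not.1 hθ
      refine hf.sparseSet_of_int_zero (a := r.num) (b := r.den) ?_ ?_ hne
      · rw [Int.isCoprime_iff_gcd_eq_one, Int.gcd, Int.natAbs_natCast]
        exact r.reduced
      · have h2 := quarticForm_smul c r.den r 1
        have h3 : (r.den : ℝ) * r = r.num := by exact_mod_cast Rat.den_mul_eq_num r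
        rw [hr, h1, mul_zero, mul_one, ← hr, h3] at h2
        rw [Int.cast_natCast, h2]

/-- The coefficients of a polynomial in two variables. -/
noncomputable def MvPolynomial.coeffTwo (F : MvPolynomial (Fin 2) ℚ) (i j : ℕ) : ℚ :=
  F.coeff (Finsupp.single 0 i + Finsupp.single 1 j)

lemma Finsupp.eq_single_add_single_fin_two (d : Fin 2 →₀ ℕ) :
    d = Finsupp.single 0 (d 0) + Finsupp.single 1 (d 1) := by
  ext i
  fin_cases i <;> simp

lemma MvPolynomial.eval_eq_quarticEval {F : MvPolynomial (Fin 2) ℚ} (hdeg : F.totalDegree ≤ 4)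
    (x y : ℚ) :
    ((MvPolynomial.eval ![x, y] F : ℚ) : ℝ) = quarticEval F.coeffTwo x y := by
  classical
  let S : Finset (Σ _ : ℕ, ℕ) := (Finset.range 5).sigma fun i => Finset.range (5 - i)
  let e : (Σ _ : ℕ, ℕ) → (Fin 2 →₀ ℕ) := fun p => Finsupp.single 0 p.1 + Finsupp.single 1 p.2
  have he : Function.Injective e := by
    rintro ⟨i, j⟩ ⟨i', j'⟩ h
    have h0 := DFunLike.congr_fun h 0
    have h1 := DFunLike.congr_fun h 1
    simp [e] at h0 h1
    rw [h0, h1]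
  have hsub : F.support ⊆ S.image e := by
    intro d hd
    have h1 := (MvPolynomial.le_totalDegree hd).trans hdeg
    rw [Finsupp.sum_fintype _ _ (fun _ => rfl), Fin.sum_univ_two] at h1
    refine Finset.mem_image.2 ⟨⟨d 0, d 1⟩, ?_, (Finsupp.eq_single_add_single_fin_two d).symm⟩
    simp only [S, Finset.mem_sigma, Finset.mem_range]
    omega
  have h1 : MvPolynomial.eval ![x, y] F =
      ∑ p ∈ S, F.coeffTwo p.1 p.2 * (x ^ p.1 * y ^ p.2) := by
    rw [MvPolynomial.eval_eq', Finset.sum_subset hsub, Finset.sum_image he.injOn]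
    · refine Finset.sum_congr rfl fun p _ => ?_
      simp [e, MvPolynomial.coeffTwo, Fin.prod_univ_two]
    · intro d _ hd
      rw [MvPolynomial.notMem_support_iff.1 hd, zero_mul]
  rw [h1, Finset.sum_sigma]
  simp only [Finset.sum_range_succ, Finset.sum_range_zero, quarticEval, quarticForm, cubicPart,
    Nat.reduceSub, Nat.sub_zero]
  push_cast
  ring

lemma MvPolynomial.exists_quarticForm_ne_zero {F : MvPolynomial (Fin 2) ℚ}
    (hdeg : F.totalDegree = 4) : ∃ x y : ℝ, quarticForm F.coeffTwo x y ≠ 0 := by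
  by_contra! h
  set c := F.coeffTwo with hc
  -- A binary quartic form vanishing at five pairwise non-proportional points is zero, contradicting
  -- total degree 4.
  have e0 := h 1 0
  have e1 := h 0 1
  have e2 := h 1 1
  have e3 := h 1 (-1)
  have e4 := h 1 2
  simp only [quarticForm] at e0 e1 e2 e3 e4
  have f40 : (c 4 0 : ℝ) = 0 := by linarith
  have f04 : (c 0 4 : ℝ) = 0 := by linarith
  have f22 : (c 2 2 : ℝ) = 0 := by linarith
  have f13 : (c 1 3 : ℝ) = 0 := by linarith
  have f31 : (c 3 1 : ℝ) = 0 := by linarith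
  have hne : F.support.Nonempty := by
    rw [Finset.nonempty_iff_ne_empty, ne_eq, MvPolynomial.support_eq_empty]
    rintro rfl
    simp at hdeg
  obtain ⟨d, hd, hd4⟩ := Finset.exists_mem_eq_sup F.support hne fun s => s.sum fun _ e => e
  have hd4' : d.sum (fun _ e => e) = 4 := hd4.symm.trans hdeg
  rw [Finsupp.sum_fintype _ _ (fun _ => rfl), Fin.sum_univ_two] at hd4'
  have hcd : c (d 0) (d 1) ≠ 0 := by
    rw [hc, MvPolynomial.coeffTwo, ← Finsupp.eq_single_add_single_fin_two]
    exact MvPolynomial.mem_support_iff.1 hd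
  have hd0 : d 0 ≤ 4 := by omega
  have hd1 : d 1 = 4 - d 0 := by omega
  rw [hd1] at hcd
  generalize d 0 = i at hcd hd0
  refine hcd ?_
  interval_cases i
  · exact_mod_cast f04
  · exact_mod_cast f13
  · exact_mod_cast f22
  · exact_mod_cast f31
  · exact_mod_cast f40

theorem theorem1p4 (F : MvPolynomial (Fin 2) ℚ)
    (hdeg : F.totalDegree = 4)
    (hirr : Irreducible F)
    (hval : valueSet F ⊆ {q : ℚ | ∃ n : ℕ, q = (n : ℚ)}) :
    ∃ C : ℝ, 0 < C ∧ ∀ N : ℕ, 2 ≤ N →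
      ((representedIn F (Set.Icc (1 : ℝ) (N : ℝ))).ncard : ℝ)
        ≤ C * ((N : ℝ) / Real.sqrt (Real.log (N : ℝ))) := by
  classical
  have hex : ∀ x y : ℤ, ∃ n : ℕ, MvPolynomial.eval ![(x : ℚ), (y : ℚ)] F = n :=
    fun x y => hval ⟨x, y, rfl⟩
  choose f hf using hex
  have hfun : IsQuarticFun F.coeffTwo f := by
    intro x y
    have h1 := MvPolynomial.eval_eq_quarticEval hdeg.le x y
    rw [hf] at h1
    exact_mod_cast h1
  obtain ⟨C, hC, h⟩ := hfun.sparseSet (MvPolynomial.exists_quarticForm_ne_zero hdeg)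
  refine ⟨C, hC, fun N hN => ?_⟩
  have hN2 : (2 : ℝ) ≤ N := by exact_mod_cast hN
  set T : Finset ℕ := (Finset.Icc 1 N).filter fun n => ∃ x y, f x y = n with hT
  have hsub : representedIn F (Set.Icc (1 : ℝ) (N : ℝ)) ⊆ (T.image (Nat.cast : ℕ → ℝ) : Finset ℝ) := by
    rintro r ⟨⟨q, ⟨x, y, hq⟩, rfl⟩, h1, h2⟩
    rw [hf] at hq
    subst hq
    simp only [Rat.cast_natCast] at h1 h2 ⊢
    refine Finset.mem_coe.2 (Finset.mem_image_of_mem _ (Finset.mem_filter.2 ⟨?_, x, y, rfl⟩))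
    exact Finset.mem_Icc.2 ⟨by exact_mod_cast h1, by exact_mod_cast h2⟩
  have h1 : (representedIn F (Set.Icc (1 : ℝ) (N : ℝ))).ncard ≤ T.card := by
    refine (Set.ncard_le_ncard hsub (Finset.finite_toSet _)).trans ?_
    rw [Set.ncard_coe_finset]
    exact Finset.card_image_le
  have h2 := h N (by linarith) T fun n hn => by
    obtain ⟨h3, h4⟩ := Finset.mem_filter.1 hn
    obtain ⟨h5, h6⟩ := Finset.mem_Icc.1 h3
    exact ⟨h5, by exact_mod_cast h6, h4⟩
  have hlog : 0 < Real.log N := Real.log_pos (by linarith)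
  have h3 : 0 < √(Real.log N) := Real.sqrt_pos.2 hlog
  calc ((representedIn F (Set.Icc (1 : ℝ) (N : ℝ))).ncard : ℝ) ≤ T.card := by exact_mod_cast h1
    _ ≤ C * (N / √(1 + Real.log N)) := h2
    _ ≤ C * (N / √(Real.log N)) := by
        gcongr
        linarith
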